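/- Let $N\ge 2$ be an integer and let $p>1$, $\theta,l\in\mathbb R$. Put $N'=N+\theta$ and $\tau=l-\theta$, and assume $N'>2$ and $\tau>-2$. Consider $$-\operatorname{div}(|x|^\theta\nabla v)=|x|^l|v|^{p-1}v\quad\text{in }\mathbb R^N.\tag{1}$$ Let $H^{1,\theta}(\mathbb R^N)$ be the space of functions $\varphi$ with $|x|^{\theta/2}\varphi\in L^2(\mathbb R^N)$ and $|x|^{\theta/2}|\nabla\varphi|\in L^2(\mathbb R^N)$, where $\nabla\varphi$ is the weak gradient on $\mathbb R^N\setminus\{0\}$; let $H^{1,\theta}_{loc}(\mathbb R^N)$ be the corresponding local space (the two functions are in $L^2$ on every compact set), and let $H^{1,\theta}_c(\mathbb R^N)$ be the subspace of those $\varphi\in H^{1,\theta}(\mathbb R^N)$ that have compact support. A solution of (1) is a function $v\in H^{1,\theta}_{loc}(\mathbb R^N)\cap L^\infty_{loc}(\mathbb R^N)$ such that $$\int_{\mathbb R^N}\bigl(|x|^\theta\nabla v\cdot\nabla\phi-|x|^l|v|^{p-1}v\,\phi\bigr)\,dx=0\qquad\text{for all }\phi\in H^{1,\theta}_c(\mathbb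 R^N)\cap L^\infty_{loc}(\mathbb R^N),$$ and it is called stable if $$\int_{\mathbb R^N}\bigl(|x|^\theta|\nabla\psi|^2-p|x|^l|v|^{p-1}\psi^2\bigr)\,dx\ge 0\qquad\text{for all }\psi\in H^{1,\theta}_c(\mathbb R^N)\cap L^\infty_{loc}(\mathbb R^N).$$ Define $p_c(N',\tau)=\infty$ if $2<N'\le 10+4\tau$ and $$p_c(N',\tau)=\frac{(N'-2)^2-2(2+\tau)(N'+\tau)+2(2+\tau)\sqrt{(2+\tau)(2N'+\tau-2)}}{(N'-2)(N'-4\tau-10)}\quad\text{if }N'>10+4\tau.$$ (i) If $2<N'\le 10+4\tau$, or if $N'>10+4\tau$ and $1<p<p_c(N',\tau)$, then every stable solution $v$ of (1), nonnegative or not, is zero (almost everywhere). (ii) If $p\ge p_c(N',\tau)$ (which is possible only if $N'>10+4\tau$), then (1) has a family of stable positive radial solutions in $\mathbb R^N$: for every $\kappa>0$ there is a stable solution $v_\kappa$ of (1) that is continuous, radial and positive on $\mathbb R^N$ and satisfies $v_\kappa(0)=\kappa$. -/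

import Mathlib

open MeasureTheory Set
open scoped ContDiff

noncomputable section

namespace WeightedElliptic

/-- `g` is the weak gradient of `u` on the set `Ω` with the origin removed. The origin is excluded
because the weight `|x|^θ` may be singular or degenerate there; for `0 ∉ Ω` this is the usual weak
gradient on `Ω`. -/
structure HasWeakGradient {N : ℕ} (Ω : Set (EuclideanSpace ℝ (Fin N)))
    (u : EuclideanSpace ℝ (Fin N) → ℝ)
    (g : EuclideanSpace ℝ (Fin N) → EuclideanSpace ℝ (Fin N)) : Prop where
  locInt_fun : LocallyIntegrableOn u (Ω \ {0}) volume
  locInt_grad : LocallyIntegrableOn g (Ω \ {0}) volume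
  integral_eq : ∀ η : EuclideanSpace ℝ (Fin N) → ℝ, ContDiff ℝ ∞ η → HasCompactSupport η →
    tsupport η ⊆ Ω \ {0} → ∀ e : EuclideanSpace ℝ (Fin N),
      ∫ x, u x * fderiv ℝ η x e = -∫ x, inner ℝ (g x) e * η x

/-- `u ∈ H^{1,θ}(Ω)`, with weak gradient `g`. -/
structure MemH1 {N : ℕ} (Ω : Set (EuclideanSpace ℝ (Fin N))) (θ : ℝ)
    (u : EuclideanSpace ℝ (Fin N) → ℝ)
    (g : EuclideanSpace ℝ (Fin N) → EuclideanSpace ℝ (Fin N)) : Prop where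
  weakGrad : HasWeakGradient Ω u g
  memLp_fun : MemLp (fun x => ‖x‖ ^ (θ / 2) * u x) 2 (volume.restrict Ω)
  memLp_grad : MemLp (fun x => ‖x‖ ^ (θ / 2) • g x) 2 (volume.restrict Ω)

/-- `u ∈ H^{1,θ}_loc(Ω)`, with weak gradient `g`. -/
structure MemH1Loc {N : ℕ} (Ω : Set (EuclideanSpace ℝ (Fin N))) (θ : ℝ)
    (u : EuclideanSpace ℝ (Fin N) → ℝ)
    (g : EuclideanSpace ℝ (Fin N) → EuclideanSpace ℝ (Fin N)) : Prop where
  weakGrad : HasWeakGradient Ω u g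
  memLp_fun : ∀ K : Set (EuclideanSpace ℝ (Fin N)), IsCompact K → K ⊆ Ω →
    MemLp (fun x => ‖x‖ ^ (θ / 2) * u x) 2 (volume.restrict K)
  memLp_grad : ∀ K : Set (EuclideanSpace ℝ (Fin N)), IsCompact K → K ⊆ Ω →
    MemLp (fun x => ‖x‖ ^ (θ / 2) • g x) 2 (volume.restrict K)

/-- `u ∈ H^{1,θ}_c(Ω)`, with weak gradient `g`: `u ∈ H^{1,θ}(Ω)` has compact support in `Ω`. -/
def MemH1c {N : ℕ} (Ω : Set (EuclideanSpace ℝ (Fin N))) (θ : ℝ)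
    (u : EuclideanSpace ℝ (Fin N) → ℝ)
    (g : EuclideanSpace ℝ (Fin N) → EuclideanSpace ℝ (Fin N)) : Prop :=
  MemH1 Ω θ u g ∧ ∃ K : Set (EuclideanSpace ℝ (Fin N)), IsCompact K ∧ K ⊆ Ω ∧
    ∀ᵐ x ∂(volume.restrict Ω), x ∉ K → u x = 0

/-- `u ∈ L^∞_loc(Ω)`. -/
def MemLinftyLoc {N : ℕ} (Ω : Set (EuclideanSpace ℝ (Fin N)))
    (u : EuclideanSpace ℝ (Fin N) → ℝ) : Prop :=
  ∀ K : Set (EuclideanSpace ℝ (Fin N)), IsCompact K → K ⊆ Ω → MemLp u ⊤ (volume.restrict K)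

/-- `v` is a solution of `-div(|x|^θ ∇v) = |x|^l |v|^{p-1} v` in `Ω`: it belongs to
`H^{1,θ}_loc(Ω) ∩ L^∞_loc(Ω)` and satisfies the weak form of the equation against every test
function in `H^{1,θ}_c(Ω) ∩ L^∞_loc(Ω)`; the integral in the weak form has to exist (which is
automatic if `N + θ > 2` and `l - θ > -2`). The weak gradient is unique almost everywhere, so
nothing depends on the choice of `g`. -/
def IsSolution {N : ℕ} (Ω : Set (EuclideanSpace ℝ (Fin N))) (θ l p : ℝ)
    (v : EuclideanSpace ℝ (Fin N) → ℝ) : Prop :=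
  MemLinftyLoc Ω v ∧ ∃ g, MemH1Loc Ω θ v g ∧
    ∀ φ h, MemH1c Ω θ φ h → MemLinftyLoc Ω φ →
      IntegrableOn (fun x => ‖x‖ ^ θ * inner ℝ (g x) (h x)
        - ‖x‖ ^ l * (|v x| ^ (p - 1) * v x) * φ x) Ω volume ∧
      ∫ x in Ω, (‖x‖ ^ θ * inner ℝ (g x) (h x)
        - ‖x‖ ^ l * (|v x| ^ (p - 1) * v x) * φ x) = 0

/-- A solution `v` is stable if `Q_v(ψ) = ∫_Ω (|x|^θ |∇ψ|² - p |x|^l |v|^{p-1} ψ²) ≥ 0` for all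
`ψ ∈ H^{1,θ}_c(Ω) ∩ L^∞_loc(Ω)`. Here `h` is the weak gradient of `ψ`. The integral exists
automatically if `N + θ > 2` and `l - θ > -2`. -/
def IsStableSolution {N : ℕ} (Ω : Set (EuclideanSpace ℝ (Fin N))) (θ l p : ℝ)
    (v : EuclideanSpace ℝ (Fin N) → ℝ) : Prop :=
  IsSolution Ω θ l p v ∧
    ∀ ψ h, MemH1c Ω θ ψ h → MemLinftyLoc Ω ψ →
      IntegrableOn (fun x => ‖x‖ ^ θ * ‖h x‖ ^ 2
        - p * ‖x‖ ^ l * |v x| ^ (p - 1) * ψ x ^ 2) Ω volume ∧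
      0 ≤ ∫ x in Ω, (‖x‖ ^ θ * ‖h x‖ ^ 2 - p * ‖x‖ ^ l * |v x| ^ (p - 1) * ψ x ^ 2)

/-- The number `P_+(N', τ)`. -/
def PPlus (N' τ : ℝ) : ℝ :=
  ((N' - 2) ^ 2 - 2 * (2 + τ) * (N' + τ)
      + 2 * (2 + τ) * Real.sqrt ((2 + τ) * (2 * N' + τ - 2)))
    / ((N' - 2) * (N' - 4 * τ - 10))

open Classical in
/-- The critical power `p_c(N', τ)`, which is `∞` for `N' ≤ 10 + 4τ`. -/
def pc (N' τ : ℝ) : EReal :=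
  if N' ≤ 10 + 4 * τ then ⊤ else (PPlus N' τ : EReal)

end WeightedElliptic

end

/-! Put m = (N'-2)/(2+τ). Both halves turn on whether m(p-1) < 2p + 2√(p(p-1)). For m > 4, that is
N' > 10+4τ, this is p < p_c in disguise (`lt_PPlus_iff`, `mul_sq_lt_iff`); for m ≤ 4 it always
holds.

Nonexistence is Farina's method. The equation is tested with |v|^{2s} v φ² and stability with |v|^s
v φ. If (s+1)² < p(2s+1), eliminating the energy ∫ |x|^θ |v|^{2s} |∇v|² φ² leaves ∫ |x|^l
|v|^{p+2s+1} φ² ≤ C ∫ |x|^θ |v|^{2s+2} |∇φ|² (`IsStableSolution.integral_estimate`). With φ a high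
power of a cutoff at scale R, Young's inequality absorbs the right side and bounds the integral of
|x|^l |v|^{p+2s+1} over the ball of radius R by C R^E, where E = N'-2-(2+τ)(2s+2)/(p-1). If m(p-1) <
2s+2, then E < 0 and R → ∞ gives v = 0 (`IsStableSolution.ae_eq_zero`). The admissible values of
2s+2 have supremum 2p + 2√(p(p-1)), which is the threshold (`exists_admissible_exponent`).

For existence, q = r^{2+τ} turns the radial equation into q V' = P, q P' = -m P - c q V^p with c =
1/(2+τ)². With k = 1/(p-1), the function w = q^k V solves an autonomous equation in log q with a
positive rest point β. At or above the threshold 4(m-k) ≤ (m-2k)², so the linearisation at β has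
real roots, and convexity of w ↦ w^p keeps w below β and nondecreasing (`emdenFowler_trapped`).
Hence V never vanishes. The same inequality says p k (m-k) ≤ m²/4, so w ≤ β becomes p|x|^l v^{p-1} ≤
((N'-2)²/4)|x|^{θ-2}, and Hardy's inequality (`MemH1c.hardy`) gives stability.

Weak gradients are given only off the origin. Two tools handle this: a chain rule obtained by
mollification (`HasWeakGradient.comp_mul`), and a divergence theorem for radial fields
(`MemH1c.integral_radial`) in which the origin is negligible because N' > 2. Hardy's inequality and
the weak form of the radial solution are both instances of the latter. -/

noncomputable section

namespace WeightedElliptic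

open Filter Topology
open scoped Convolution

/-! ### Mollification and the chain rule for weak derivatives on the whole space -/

section Mollification

variable {E : Type*} [NormedAddCommGroup E] [InnerProductSpace ℝ E] [FiniteDimensional ℝ E]
  [MeasurableSpace E] [BorelSpace E]

/-- A standard sequence of bump functions shrinking to the origin. -/
def shrinkingBump (E : Type*) [NormedAddCommGroup E] (n : ℕ) : ContDiffBump (0 : E) where
  rIn := 1 / ((n : ℝ) + 1) / 2
  rOut := 1 / ((n : ℝ) + 1)
  rIn_pos := by positivity
  rIn_lt_rOut := half_lt_self (by positivity)

lemma tendsto_shrinkingBump_rOut {E : Type*} [NormedAddCommGroup E] :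
    Tendsto (fun n => (shrinkingBump E n).rOut) atTop (𝓝 0) :=
  tendsto_one_div_add_atTop_nhds_zero_nat

/-- Convolution of `f` with the `n`-th normed bump function. -/
def mollify (n : ℕ) (f : E → ℝ) : E → ℝ :=
  (shrinkingBump E n).normed volume ⋆[ContinuousLinearMap.lsmul ℝ ℝ, volume] f

lemma mollify_apply (n : ℕ) (f : E → ℝ) (x : E) :
    mollify n f x = ∫ t, (shrinkingBump E n).normed volume t * f (x - t) := by
  simp [mollify, convolution_def]

lemma mollify_apply_swap (n : ℕ) (f : E → ℝ) (x : E) :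
    mollify n f x = ∫ t, (shrinkingBump E n).normed volume (x - t) * f t := by
  simp [mollify, convolution_eq_swap]

lemma contDiff_mollify (n : ℕ) {f : E → ℝ} (hf : LocallyIntegrable f) :
    ContDiff ℝ ∞ (mollify n f) :=
  (shrinkingBump E n).hasCompactSupport_normed.contDiff_convolution_left _
    (shrinkingBump E n).contDiff_normed hf

lemma integrable_mollify (n : ℕ) {f : E → ℝ} (hf : Integrable f) :
    Integrable (mollify n f) :=
  (shrinkingBump E n).integrable_normed.integrable_convolution _ hf

lemma ae_tendsto_mollify {f : E → ℝ} (hf : LocallyIntegrable f) :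
    ∀ᵐ x, Tendsto (fun n => mollify n f x) atTop (𝓝 (f x)) := by
  refine ContDiffBump.ae_convolution_tendsto_right_of_locallyIntegrable (K := 2)
    tendsto_shrinkingBump_rOut (Eventually.of_forall fun n => ?_) hf
  simp only [shrinkingBump]
  linarith

lemma tendsto_mollify_of_continuous {f : E → ℝ} (hf : Continuous f) (x : E) :
    Tendsto (fun n => mollify n f x) atTop (𝓝 (f x)) :=
  ContDiffBump.convolution_tendsto_right_of_continuous tendsto_shrinkingBump_rOut hf x

lemma abs_mollify_le (n : ℕ) {f : E → ℝ} {M : ℝ} (hf : ∀ᵐ x, |f x| ≤ M) (x : E) :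
    |mollify n f x| ≤ M := by
  rw [mollify_apply_swap]
  have hint : Integrable (fun t => (shrinkingBump E n).normed volume (x - t)) :=
    ((shrinkingBump E n).integrable_normed (μ := volume)).comp_sub_left x
  calc |∫ t, (shrinkingBump E n).normed volume (x - t) * f t|
      ≤ ∫ t, |(shrinkingBump E n).normed volume (x - t) * f t| := abs_integral_le_integral_abs
    _ ≤ ∫ t, (shrinkingBump E n).normed volume (x - t) * M := by
        refine integral_mono_of_nonneg (Eventually.of_forall fun t => abs_nonneg _)
          (hint.mul_const M) ?_
        filter_upwards [hf] with t ht
        rw [abs_mul, abs_of_nonneg ((shrinkingBump E n).nonneg_normed _)]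
        exact mul_le_mul_of_nonneg_left ht ((shrinkingBump E n).nonneg_normed _)
    _ = M := by
        rw [integral_mul_const,
          integral_sub_left_eq_self (fun t => (shrinkingBump E n).normed volume t) volume x,
          (shrinkingBump E n).integral_normed, one_mul]

/-- Pointwise, the modulus of a mollification is at most the mollification of the modulus, and
mollifying preserves integrals. -/
lemma integral_abs_mollify_le (n : ℕ) {f : E → ℝ} (hf : Integrable f) :
    ∫ x, |mollify n f x| ≤ ∫ x, |f x| := by
  have h1 : ∫ x, mollify n (fun y => |f y|) x = ∫ x, |f x| := by
    rw [mollify, integral_convolution _ (shrinkingBump E n).integrable_normed hf.abs,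
      (shrinkingBump E n).integral_normed]
    simp
  rw [← h1]
  refine integral_mono (integrable_mollify n hf).abs (integrable_mollify n hf.abs) fun x => ?_
  simp only [mollify_apply]
  refine abs_integral_le_integral_abs.trans (le_of_eq ?_)
  refine integral_congr_ae (Eventually.of_forall fun t => ?_)
  simp only [abs_mul, abs_of_nonneg ((shrinkingBump E n).nonneg_normed _)]

lemma mollify_add (n : ℕ) {f g : E → ℝ} (hf : LocallyIntegrable f) (hg : LocallyIntegrable g) :
    mollify n (f + g) = mollify n f + mollify n g := by
  have hex : ∀ {f : E → ℝ}, LocallyIntegrable f →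
      ConvolutionExists ((shrinkingBump E n).normed volume) f (ContinuousLinearMap.lsmul ℝ ℝ)
        volume := fun hf =>
    (shrinkingBump E n).hasCompactSupport_normed.convolutionExists_left _
      (shrinkingBump E n).continuous_normed hf
  exact (hex hf).distrib_add (hex hg)

lemma mollify_eq_zero (n : ℕ) {f : E → ℝ} {R : ℝ} (hf : ∀ x, R < ‖x‖ → f x = 0) {x : E}
    (hx : R + 1 < ‖x‖) : mollify n f x = 0 := by
  rw [mollify_apply]
  refine integral_eq_zero_of_ae (Eventually.of_forall fun t => ?_)
  by_cases ht : t ∈ Function.support ((shrinkingBump E n).normed volume)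
  · rw [(shrinkingBump E n).support_normed_eq, mem_ball_zero_iff] at ht
    have h1 : (shrinkingBump E n).rOut ≤ 1 := by
      simp only [shrinkingBump]
      rw [div_le_one (by positivity)]
      linarith [Nat.cast_nonneg (α := ℝ) n]
    have h2 := norm_sub_norm_le x t
    simp [hf (x - t) (by linarith)]
  · simp [Function.notMem_support.1 ht]

lemma tendsto_integral_abs_mollify_sub_of_continuous {f : E → ℝ} (hf : Continuous f)
    (hfc : HasCompactSupport f) :
    Tendsto (fun n => ∫ x, |mollify n f x - f x|) atTop (𝓝 0) := by
  obtain ⟨C, hC⟩ := hf.bounded_above_of_compact_support hfc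
  obtain ⟨R, hR⟩ := hfc.isCompact.isBounded.exists_norm_le
  have hzero : ∀ x, R < ‖x‖ → f x = 0 := fun x hx => by
    by_contra h
    exact absurd (hR x (subset_tsupport _ h)) (not_le.2 hx)
  have hfi : LocallyIntegrable f := hf.locallyIntegrable
  have : Tendsto (fun n => ∫ x, |mollify n f x - f x|) atTop (𝓝 (∫ _ : E, (0 : ℝ))) := by
    refine tendsto_integral_of_dominated_convergence
      (indicator (Metric.closedBall 0 (R + 1)) fun _ => 2 * C) (fun n => ?_) ?_ (fun n => ?_) ?_
    · exact ((contDiff_mollify n hfi).continuous.sub hf).abs.aestronglyMeasurable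
    · exact (integrableOn_const (measure_closedBall_lt_top.ne)).integrable_indicator
        measurableSet_closedBall
    · refine Eventually.of_forall fun x => ?_
      by_cases hx : x ∈ Metric.closedBall (0 : E) (R + 1)
      · rw [indicator_of_mem hx, Real.norm_eq_abs, abs_abs]
        refine (abs_sub _ _).trans ?_
        have := abs_mollify_le n (Eventually.of_forall hC) x
        have h2 := hC x
        rw [Real.norm_eq_abs] at h2
        linarith
      · rw [indicator_of_notMem hx]
        rw [mem_closedBall_zero_iff, not_le] at hx
        simp [mollify_eq_zero n hzero hx, hzero x (by linarith)]
    · refine Eventually.of_forall fun x => ?_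
      have := ((tendsto_mollify_of_continuous hf x).sub_const (f x)).abs
      simpa using this
  simpa using this

/-- Mollifications of an integrable function converge to it in `L¹`. -/
lemma tendsto_integral_abs_mollify_sub {f : E → ℝ} (hf : Integrable f) :
    Tendsto (fun n => ∫ x, |mollify n f x - f x|) atTop (𝓝 0) := by
  rw [Metric.tendsto_atTop]
  intro ε hε
  obtain ⟨c, hcs, hfc, hc, hci⟩ := hf.exists_hasCompactSupport_integral_sub_le
    (show 0 < ε / 4 by positivity)
  obtain ⟨n₀, hn₀⟩ := Metric.tendsto_atTop.1
    (tendsto_integral_abs_mollify_sub_of_continuous hc hcs) (ε / 4) (by positivity)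
  refine ⟨n₀, fun n hn => ?_⟩
  have h0 := hn₀ n hn
  simp only [Real.dist_eq, sub_zero] at h0 ⊢
  rw [abs_of_nonneg (integral_nonneg fun _ => abs_nonneg _)] at h0 ⊢
  -- Mollifying contracts L¹, so both terms in f - c cost at most ε/4. With the continuous function
  -- c the total is below 3ε/4.
  have hd : Integrable (f - c) := hf.sub hci
  have hsplit : mollify n f = mollify n (f - c) + mollify n c := by
    rw [← mollify_add n hd.locallyIntegrable hci.locallyIntegrable, sub_add_cancel]
  have h1 := integral_abs_mollify_le n hd
  have i1 := (integrable_mollify n hd).abs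
  have i2 := ((integrable_mollify n hci).sub hci).abs
  have i3 := hd.abs
  calc ∫ x, |mollify n f x - f x|
      ≤ ∫ x, (|mollify n (f - c) x| + |(mollify n c - c) x| + |(f - c) x|) := by
        refine integral_mono ((integrable_mollify n hf).sub hf).abs ((i1.add i2).add i3)
          fun x => ?_
        rw [hsplit]
        simp only [Pi.add_apply, Pi.sub_apply]
        have e : mollify n (f - c) x + mollify n c x - f x
          = mollify n (f - c) x + (mollify n c x - c x) - (f x - c x) := by ring
        rw [e]
        exact (abs_sub _ _).trans (add_le_add_left (abs_add_le _ _) _)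
    _ = (∫ x, |mollify n (f - c) x|) + (∫ x, |(mollify n c - c) x|) + ∫ x, |(f - c) x| :=
        (integral_add (i1.add i2) i3).trans (congrArg (· + _) (integral_add i1 i2))
    _ < ε := by
        simp only [Pi.sub_apply, Real.norm_eq_abs] at *
        linarith

/-- The derivative falls on the bump, and t ↦ ρ(x - t) is itself an admissible test function in the
weak identity. The sign from differentiating x - t cancels the sign in that identity. -/
lemma fderiv_mollify (n : ℕ) {U G : E → ℝ} {e : E} (hU : LocallyIntegrable U)
    (hw : ∀ η : E → ℝ, ContDiff ℝ ∞ η → HasCompactSupport η →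
      ∫ x, U x * fderiv ℝ η x e = -∫ x, G x * η x) (x : E) :
    fderiv ℝ (mollify n U) x e = mollify n G x := by
  set ρ := (shrinkingBump E n).normed volume with hρ
  have hρs : ContDiff ℝ ∞ ρ := (shrinkingBump E n).contDiff_normed
  have hρc : HasCompactSupport ρ := (shrinkingBump E n).hasCompactSupport_normed
  have hd := hρc.hasFDerivAt_convolution_left (ContinuousLinearMap.lsmul ℝ ℝ)
    (hρs.of_le (by simp)) hU x
  have hex : ConvolutionExistsAt (fderiv ℝ ρ) U x
      (ContinuousLinearMap.precompL E (ContinuousLinearMap.lsmul ℝ ℝ)) volume :=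
    (hρc.fderiv ℝ).convolutionExists_left _ (hρs.continuous_fderiv (by simp)) hU x
  have h1 : fderiv ℝ (mollify n U) x e = ∫ t, fderiv ℝ ρ (x - t) e * U t := by
    rw [mollify, hd.fderiv, convolution_def, ContinuousLinearMap.integral_apply hex.integrable,
      ← integral_sub_left_eq_self _ volume x]
    refine integral_congr_ae (Eventually.of_forall fun t => ?_)
    simp [ContinuousLinearMap.precompL_apply]
  have hη := hw (fun t => ρ (x - t)) (hρs.comp (contDiff_const.sub contDiff_id))
    (hρc.comp_homeomorph (Homeomorph.subLeft x))
  have hdη : ∀ t, fderiv ℝ (fun t => ρ (x - t)) t e = -fderiv ℝ ρ (x - t) e := fun t => by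
    have h2 : HasFDerivAt (fun t => ρ (x - t)) ((fderiv ℝ ρ (x - t)).comp
        (-ContinuousLinearMap.id ℝ E)) t :=
      ((hρs.differentiable (by simp)) (x - t)).hasFDerivAt.comp t
        ((hasFDerivAt_id t).const_sub x)
    rw [h2.fderiv]
    simp
  rw [h1, mollify_apply_swap]
  simp only [hdη, mul_neg, integral_neg, neg_inj] at hη
  calc ∫ t, fderiv ℝ ρ (x - t) e * U t = ∫ t, U t * fderiv ℝ ρ (x - t) e := by
        simp only [mul_comm]
    _ = ∫ t, G t * ρ (x - t) := hη
    _ = _ := by simp only [mul_comm, hρ]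

/-- The chain rule for a bounded function with a weak directional derivative on the whole space,
tested against `C¹` functions. -/
lemma integral_comp_mul_fderiv {U G : E → ℝ} {e : E} (hU : Integrable U) (hG : Integrable G)
    (hw : ∀ η : E → ℝ, ContDiff ℝ ∞ η → HasCompactSupport η →
      ∫ x, U x * fderiv ℝ η x e = -∫ x, G x * η x)
    {M : ℝ} (hM : ∀ᵐ x, |U x| ≤ M) {F : ℝ → ℝ} (hF : ContDiff ℝ 1 F)
    {η : E → ℝ} (hη : ContDiff ℝ 1 η) (hηc : HasCompactSupport η) :
    ∫ x, F (U x) * fderiv ℝ η x e = -∫ x, deriv F (U x) * G x * η x := by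
  have hF' : Continuous (deriv F) := hF.continuous_deriv le_rfl
  obtain ⟨A, hA⟩ := isCompact_Icc.exists_bound_of_continuousOn (s := Icc (-M) M)
    hF.continuous.continuousOn
  obtain ⟨B, hB⟩ := isCompact_Icc.exists_bound_of_continuousOn (s := Icc (-M) M) hF'.continuousOn
  obtain ⟨H, hH⟩ := hη.continuous.bounded_above_of_compact_support hηc
  have hUl := hU.locallyIntegrable
  have hη' : Continuous fun x => fderiv ℝ η x e :=
    (hη.continuous_fderiv (by simp)).clm_apply continuous_const
  have hη'c : HasCompactSupport fun x => fderiv ℝ η x e := hηc.fderiv_apply ℝ e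
  have hη'i : Integrable fun x => fderiv ℝ η x e := hη'.integrable_of_hasCompactSupport hη'c
  have hbd : ∀ n x, mollify n U x ∈ Icc (-M) M := fun n x => abs_le.1 (abs_mollify_le n hM x)
  have hsm := fun n => contDiff_mollify n hUl
  have hsF : ∀ n, ContDiff ℝ 1 fun x => F (mollify n U x) := fun n =>
    hF.comp ((hsm n).of_le (by simp))
  have hdF : ∀ n x, fderiv ℝ (fun x => F (mollify n U x)) x e
      = deriv F (mollify n U x) * mollify n G x := fun n x => by
    rw [← fderiv_mollify n hUl hw x]
    have h1 := ((hF.differentiable (by simp)) (mollify n U x)).hasDerivAt.comp_hasFDerivAt x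
      (((hsm n).differentiable (by simp)) x).hasFDerivAt
    have : fderiv ℝ (fun x => F (mollify n U x)) x = _ := h1.fderiv
    rw [this]
    simp
  -- For the smooth mollifications this is ordinary integration by parts; the rest is passage to the
  -- limit.
  have hcl : ∀ n, ∫ x, F (mollify n U x) * fderiv ℝ η x e
      = -∫ x, deriv F (mollify n U x) * mollify n G x * η x := fun n => by
    have h1 : Continuous fun x => fderiv ℝ (fun x => F (mollify n U x)) x e :=
      ((hsF n).continuous_fderiv (by simp)).clm_apply continuous_const
    have h := integral_mul_fderiv_eq_neg_fderiv_mul_of_integrable (μ := volume) (v := e)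
      (f := fun x => F (mollify n U x)) (g := η)
      ((h1.mul hη.continuous).integrable_of_hasCompactSupport hηc.mul_left)
      (((hsF n).continuous.mul hη').integrable_of_hasCompactSupport hη'c.mul_left)
      (((hsF n).continuous.mul hη.continuous).integrable_of_hasCompactSupport hηc.mul_left)
      (fun x _ => (hsF n).differentiable (by simp) x)
      (fun x _ => hη.differentiable (by simp) x)
    simpa only [hdF] using h
  have hae := ae_tendsto_mollify hUl
  have lim1 : Tendsto (fun n => ∫ x, F (mollify n U x) * fderiv ℝ η x e) atTop
      (𝓝 (∫ x, F (U x) * fderiv ℝ η x e)) := by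
    refine tendsto_integral_of_dominated_convergence (fun x => A * |fderiv ℝ η x e|)
      (fun n => ((hsF n).continuous.mul hη').aestronglyMeasurable)
      (hη'i.abs.const_mul A) (fun n => Eventually.of_forall fun x => ?_) ?_
    · rw [norm_mul]
      exact mul_le_mul_of_nonneg_right (hA _ (hbd n x)) (abs_nonneg _)
    · filter_upwards [hae] with x hx
      exact ((hF.continuous.tendsto _).comp hx).mul_const _
  have hGη : Integrable fun x => deriv F (U x) * G x * η x := by
    have h1 : AEStronglyMeasurable (fun x => deriv F (U x)) volume :=
      hF'.comp_aestronglyMeasurable hU.1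
    have h2 : Integrable fun x => deriv F (U x) * G x :=
      hG.bdd_mul h1 (c := B) (by
        filter_upwards [hM] with x hx
        exact hB _ (abs_le.1 hx))
    exact h2.mul_bdd (c := H) hη.continuous.aestronglyMeasurable (Eventually.of_forall hH)
  have lim2 : Tendsto (fun n => ∫ x, deriv F (mollify n U x) * G x * η x) atTop
      (𝓝 (∫ x, deriv F (U x) * G x * η x)) := by
    refine tendsto_integral_of_dominated_convergence (fun x => B * |G x| * H)
      (fun n => ((hF'.comp (hsm n).continuous).aestronglyMeasurable.mul hG.1).mul
        hη.continuous.aestronglyMeasurable)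
      ((hG.abs.const_mul B).mul_const H) (fun n => Eventually.of_forall fun x => ?_) ?_
    · rw [norm_mul, norm_mul]
      have hB0 : 0 ≤ B := (norm_nonneg _).trans (hB _ (hbd n x))
      exact mul_le_mul (mul_le_mul_of_nonneg_right (hB _ (hbd n x)) (abs_nonneg _)) (hH x)
        (norm_nonneg _) (mul_nonneg hB0 (abs_nonneg _))
    · filter_upwards [hae] with x hx
      exact (((hF'.tendsto _).comp hx).mul_const _).mul_const _
  -- The mollifications of G converge in L¹ without a common dominating function. Their deviation
  -- from G is therefore handled separately, its coefficient being bounded by B H; `lim2` treats the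
  -- fixed G by dominated convergence.
  have lim3 : Tendsto (fun n => ∫ x, deriv F (mollify n U x) * (mollify n G x - G x) * η x) atTop
      (𝓝 0) := by
    have hlim := (tendsto_integral_abs_mollify_sub hG).const_mul (B * H)
    rw [mul_zero] at hlim
    refine squeeze_zero_norm (fun n => ?_) hlim
    refine (norm_integral_le_integral_norm _).trans ?_
    rw [← integral_const_mul]
    refine integral_mono_of_nonneg (Eventually.of_forall fun x => norm_nonneg _)
      (((integrable_mollify n hG).sub hG).abs.const_mul _) (Eventually.of_forall fun x => ?_)
    have hB0 : 0 ≤ B := (norm_nonneg _).trans (hB _ (hbd n x))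
    simp only [norm_mul]
    calc _ ≤ B * ‖mollify n G x - G x‖ * H :=
          mul_le_mul (mul_le_mul_of_nonneg_right (hB _ (hbd n x)) (abs_nonneg _)) (hH x)
            (norm_nonneg _) (mul_nonneg hB0 (abs_nonneg _))
      _ = _ := by rw [Real.norm_eq_abs]; ring
  have lim4 := lim3.add lim2
  rw [zero_add] at lim4
  refine tendsto_nhds_unique lim1 ?_
  refine lim4.neg.congr fun n => ?_
  rw [hcl n]
  congr 1
  rw [← integral_add]
  · refine integral_congr_ae (Eventually.of_forall fun x => ?_)
    simp only
    ring
  · refine Integrable.mul_bdd (c := H) ?_ hη.continuous.aestronglyMeasurable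
      (Eventually.of_forall hH)
    exact ((integrable_mollify n hG).sub hG).bdd_mul (c := B)
      (hF'.comp (hsm n).continuous).aestronglyMeasurable
      (Eventually.of_forall fun x => hB _ (hbd n x))
  · refine Integrable.mul_bdd (c := H) ?_ hη.continuous.aestronglyMeasurable
      (Eventually.of_forall hH)
    exact hG.bdd_mul (c := B) (hF'.comp (hsm n).continuous).aestronglyMeasurable
      (Eventually.of_forall fun x => hB _ (hbd n x))

end Mollification

/-! ### Chain and product rules away from the origin, and admissible test functions -/

/-- The ambient Euclidean space. -/
abbrev Euc (N : ℕ) := EuclideanSpace ℝ (Fin N)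

/-- The cutoff is 1 in a neighbourhood of each point of K, and not just on K, so that its derivative
vanishes on K as well. -/
lemma exists_smooth_cutoff {E : Type*} [NormedAddCommGroup E] [NormedSpace ℝ E]
    [FiniteDimensional ℝ E] {K U : Set E} (hK : IsCompact K) (hU : IsOpen U) (hKU : K ⊆ U) :
    ∃ χ : E → ℝ, ContDiff ℝ ∞ χ ∧ HasCompactSupport χ ∧ tsupport χ ⊆ U ∧
      ∀ x ∈ K, χ =ᶠ[𝓝 x] 1 := by
  obtain ⟨L, hL, hKL, hLU⟩ := exists_compact_between hK hU hKU
  obtain ⟨f, hf1, hf0, -⟩ := exists_contMDiffMap_one_nhds_of_subset_interior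
    (n := ⊤) (modelWithCornersSelf ℝ E) hK.isClosed hKL
  have hts : tsupport f ⊆ L := by
    refine closure_minimal (fun x hx => ?_) hL.isClosed
    by_contra h
    exact hx (hf0 x h)
  refine ⟨f, f.contMDiff.contDiff, hL.of_isClosed_subset (isClosed_tsupport _) hts,
    hts.trans hLU, fun x hx => ?_⟩
  exact (eventually_nhdsSet_iff_forall.1 hf1) x hx

variable {N : ℕ}

lemma MemLinftyLoc.exists_bound {u : Euc N → ℝ} (hu : MemLinftyLoc univ u) {K : Set (Euc N)}
    (hK : IsCompact K) : ∃ M, 0 ≤ M ∧ ∀ᵐ x ∂volume.restrict K, |u x| ≤ M := by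
  have h := hu K hK (subset_univ _)
  refine ⟨(eLpNorm u ⊤ (volume.restrict K)).toReal, ENNReal.toReal_nonneg, ?_⟩
  have h1 := ae_le_eLpNormEssSup (f := u) (μ := volume.restrict K)
  filter_upwards [h1] with x hx
  rw [← eLpNorm_exponent_top] at hx
  have h2 := ENNReal.toReal_mono h.2.ne hx
  simpa using h2

lemma MemLinftyLoc.locallyIntegrable {u : Euc N → ℝ} (hu : MemLinftyLoc univ u) :
    LocallyIntegrable u := by
  rw [locallyIntegrable_iff]
  intro K hK
  have : IsFiniteMeasure (volume.restrict K) := ⟨by simpa using hK.measure_lt_top⟩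
  exact (hu K hK (subset_univ _)).integrable le_top

lemma MemLinftyLoc.aestronglyMeasurable {u : Euc N → ℝ} (hu : MemLinftyLoc univ u) :
    AEStronglyMeasurable u volume :=
  hu.locallyIntegrable.aestronglyMeasurable

lemma MemLinftyLoc.of_bound {u : Euc N → ℝ} (hm : AEStronglyMeasurable u volume)
    (h : ∀ K : Set (Euc N), IsCompact K → ∃ M, ∀ᵐ x ∂volume.restrict K, |u x| ≤ M) :
    MemLinftyLoc univ u := fun K hK _ => by
  obtain ⟨M, hM⟩ := h K hK
  exact memLp_top_of_bound hm.restrict M hM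

lemma MemLinftyLoc.comp {u : Euc N → ℝ} (hu : MemLinftyLoc univ u) {F : ℝ → ℝ}
    (hF : Continuous F) : MemLinftyLoc univ fun x => F (u x) := by
  refine .of_bound (hF.comp_aestronglyMeasurable hu.aestronglyMeasurable) fun K hK => ?_
  obtain ⟨M, -, hM⟩ := hu.exists_bound hK
  obtain ⟨A, hA⟩ := isCompact_Icc.exists_bound_of_continuousOn (s := Icc (-M) M) hF.continuousOn
  exact ⟨A, hM.mono fun x hx => hA _ (abs_le.1 hx)⟩

lemma MemLinftyLoc.mul {u v : Euc N → ℝ} (hu : MemLinftyLoc univ u) (hv : MemLinftyLoc univ v) :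
    MemLinftyLoc univ fun x => u x * v x :=
  fun K hK hKu => (hv K hK hKu).mul (hu K hK hKu)

lemma memLinftyLoc_of_continuous {u : Euc N → ℝ} (hu : Continuous u) : MemLinftyLoc univ u := by
  refine .of_bound hu.aestronglyMeasurable fun K hK => ?_
  obtain ⟨A, hA⟩ := hK.exists_bound_of_continuousOn hu.continuousOn
  exact ⟨A, (ae_restrict_mem hK.measurableSet).mono fun x hx => hA x hx⟩

lemma integrable_mul_of_continuous_of_hasCompactSupport {a f : Euc N → ℝ} (ha : Continuous a)
    (hac : HasCompactSupport a) (hf : IntegrableOn f (tsupport a)) :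
    Integrable fun x => a x * f x := by
  obtain ⟨C, hC⟩ := ha.bounded_above_of_compact_support hac
  have h : IntegrableOn (fun x => a x * f x) (tsupport a) :=
    hf.bdd_mul ha.aestronglyMeasurable (Eventually.of_forall hC)
  exact h.integrable_of_forall_notMem_eq_zero fun x hx => by
    simp [image_eq_zero_of_notMem_tsupport hx]

lemma fderiv_eq_zero_of_notMem_tsupport {a : Euc N → ℝ} {x : Euc N} (hx : x ∉ tsupport a) :
    fderiv ℝ a x = 0 :=
  image_eq_zero_of_notMem_tsupport fun h => hx (tsupport_fderiv_subset ℝ h)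

/-- The chain rule for a locally bounded function with a weak gradient away from the origin. -/
lemma HasWeakGradient.integral_comp {u : Euc N → ℝ} {g : Euc N → Euc N}
    (h : HasWeakGradient univ u g) (hu : MemLinftyLoc univ u) {F : ℝ → ℝ} (hF : ContDiff ℝ 1 F)
    {η : Euc N → ℝ} (hη : ContDiff ℝ 1 η) (hηc : HasCompactSupport η)
    (hηs : tsupport η ⊆ {0}ᶜ) (e : Euc N) :
    ∫ x, F (u x) * fderiv ℝ η x e = -∫ x, deriv F (u x) * inner ℝ (g x) e * η x := by
  -- The cutoff reduces to the whole space: χ u is integrable and bounded, its support avoids the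
  -- origin, and it agrees with u near the support of η.
  obtain ⟨χ, hχ, hχc, hχs, hχ1⟩ := exists_smooth_cutoff hηc isOpen_compl_singleton hηs
  have hK : IsCompact (tsupport χ) := hχc
  have hsub : tsupport χ ⊆ univ \ {0} := by rwa [← compl_eq_univ_sdiff]
  have hui : IntegrableOn u (tsupport χ) := h.locInt_fun.integrableOn_compact_subset hsub hK
  have hgi : IntegrableOn (fun x => inner ℝ (g x) e) (tsupport χ) :=
    (h.locInt_grad.integrableOn_compact_subset hsub hK).inner_const e
  have hχ' : Continuous fun x => fderiv ℝ χ x e :=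
    (hχ.continuous_fderiv (by simp)).clm_apply continuous_const
  have hχ'c : HasCompactSupport fun x => fderiv ℝ χ x e := hχc.fderiv_apply ℝ e
  have hU : Integrable fun x => χ x * u x :=
    integrable_mul_of_continuous_of_hasCompactSupport hχ.continuous hχc hui
  have hG1 : Integrable fun x => χ x * inner ℝ (g x) e :=
    integrable_mul_of_continuous_of_hasCompactSupport hχ.continuous hχc hgi
  have hG2 : Integrable fun x => fderiv ℝ χ x e * u x :=
    integrable_mul_of_continuous_of_hasCompactSupport hχ' hχ'c
      (hui.mono_set (tsupport_fderiv_apply_subset ℝ e))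
  obtain ⟨M, hM0, hM⟩ := hu.exists_bound hK
  obtain ⟨C, hC⟩ := hχ.continuous.bounded_above_of_compact_support hχc
  have hbd : ∀ᵐ x, |χ x * u x| ≤ C * M := by
    rw [ae_restrict_iff' hK.measurableSet] at hM
    filter_upwards [hM] with x hx
    rw [abs_mul]
    by_cases hx' : x ∈ tsupport χ
    · exact mul_le_mul (hC x) (hx hx') (abs_nonneg _) ((norm_nonneg _).trans (hC x))
    · rw [image_eq_zero_of_notMem_tsupport hx', abs_zero, zero_mul]
      exact mul_nonneg ((norm_nonneg _).trans (hC x)) hM0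
  -- The product rule for χ u against an arbitrary ξ: test the weak gradient of u with χ ξ, whose
  -- support avoids the origin.
  have hw : ∀ ξ : Euc N → ℝ, ContDiff ℝ ∞ ξ → HasCompactSupport ξ →
      ∫ x, (χ x * u x) * fderiv ℝ ξ x e
        = -∫ x, (χ x * inner ℝ (g x) e + fderiv ℝ χ x e * u x) * ξ x := by
    intro ξ hξ hξc
    have hp := h.integral_eq (fun x => χ x * ξ x) (hχ.mul hξ) hχc.mul_right
      ((tsupport_mul_subset_left).trans hsub) e
    have hd : ∀ x, fderiv ℝ (fun x => χ x * ξ x) x e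
        = χ x * fderiv ℝ ξ x e + ξ x * fderiv ℝ χ x e := fun x => by
      have := fderiv_mul (hχ.differentiable (by simp) x) (hξ.differentiable (by simp) x)
      change fderiv ℝ (χ * ξ) x e = _
      rw [this]
      simp
    simp only [hd] at hp
    have hξb := hξ.continuous.bounded_above_of_compact_support hξc
    obtain ⟨B, hB⟩ := hξb
    have hξ' : Continuous fun x => fderiv ℝ ξ x e :=
      (hξ.continuous_fderiv (by simp)).clm_apply continuous_const
    obtain ⟨B', hB'⟩ := hξ'.bounded_above_of_compact_support (hξc.fderiv_apply ℝ e)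
    have i1 : Integrable fun x => (χ x * u x) * fderiv ℝ ξ x e :=
      hU.mul_bdd hξ'.aestronglyMeasurable (Eventually.of_forall hB')
    have i2 : Integrable fun x => (fderiv ℝ χ x e * u x) * ξ x :=
      hG2.mul_bdd hξ.continuous.aestronglyMeasurable (Eventually.of_forall hB)
    have i3 : Integrable fun x => (χ x * inner ℝ (g x) e) * ξ x :=
      hG1.mul_bdd hξ.continuous.aestronglyMeasurable (Eventually.of_forall hB)
    have e1 : ∫ x, u x * (χ x * fderiv ℝ ξ x e + ξ x * fderiv ℝ χ x e)
        = (∫ x, (χ x * u x) * fderiv ℝ ξ x e) + ∫ x, (fderiv ℝ χ x e * u x) * ξ x := by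
      rw [← integral_add i1 i2]
      exact integral_congr_ae (Eventually.of_forall fun x => by ring)
    have e2 : ∫ x, (χ x * inner ℝ (g x) e + fderiv ℝ χ x e * u x) * ξ x
        = (∫ x, (χ x * inner ℝ (g x) e) * ξ x) + ∫ x, (fderiv ℝ χ x e * u x) * ξ x := by
      rw [← integral_add i3 i2]
      exact integral_congr_ae (Eventually.of_forall fun x => by ring)
    have e3 : ∫ x, inner ℝ (g x) e * (χ x * ξ x) = ∫ x, (χ x * inner ℝ (g x) e) * ξ x :=
      integral_congr_ae (Eventually.of_forall fun x => by ring)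
    rw [e1, e3] at hp
    rw [e2]
    linarith
  have key := integral_comp_mul_fderiv hU (hG1.add hG2) hw hbd hF hη hηc
  have c1 : ∀ x ∈ tsupport η, χ x = 1 := fun x hx => (hχ1 x hx).eq_of_nhds
  have c2 : ∀ x ∈ tsupport η, fderiv ℝ χ x e = 0 := fun x hx => by
    rw [(hχ1 x hx).fderiv_eq]
    simp [Pi.one_def]
  have k1 : ∀ x, F (χ x * u x) * fderiv ℝ η x e = F (u x) * fderiv ℝ η x e := fun x => by
    by_cases hx : x ∈ tsupport η
    · rw [c1 x hx, one_mul]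
    · simp [fderiv_eq_zero_of_notMem_tsupport hx]
  have k2 : ∀ x, deriv F (χ x * u x) * ((fun x => χ x * inner ℝ (g x) e)
      + fun x => fderiv ℝ χ x e * u x) x * η x = deriv F (u x) * inner ℝ (g x) e * η x :=
    fun x => by
    by_cases hx : x ∈ tsupport η
    · simp [c1 x hx, c2 x hx]
    · simp [image_eq_zero_of_notMem_tsupport hx]
  simpa only [k1, k2] using key

lemma MemLinftyLoc.smul_locallyIntegrableOn {a : Euc N → ℝ} (ha : MemLinftyLoc univ a)
    {g : Euc N → Euc N} (hg : LocallyIntegrableOn g (univ \ {0})) :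
    LocallyIntegrableOn (fun x => a x • g x) (univ \ {0}) := by
  have ho : IsOpen (univ \ {0} : Set (Euc N)) := by
    rw [← compl_eq_univ_sdiff]
    exact isOpen_compl_singleton
  rw [locallyIntegrableOn_iff ho.isLocallyClosed] at hg ⊢
  intro K hKs hK
  obtain ⟨M, -, hM⟩ := ha.exists_bound hK
  exact (hg K hKs hK).bdd_smul M ha.aestronglyMeasurable.restrict hM

lemma inner_gradient_eq {φ : Euc N → ℝ} (x e : Euc N) :
    inner ℝ (gradient φ x) e = fderiv ℝ φ x e := by
  rw [gradient, ← InnerProductSpace.toDual_apply_apply (𝕜 := ℝ),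
    (InnerProductSpace.toDual ℝ (Euc N)).apply_symm_apply]

lemma norm_gradient_eq {φ : Euc N → ℝ} (x : Euc N) : ‖gradient φ x‖ = ‖fderiv ℝ φ x‖ := by
  rw [gradient, LinearIsometryEquiv.norm_map]

lemma continuous_gradient {φ : Euc N → ℝ} (hφ : ContDiff ℝ 1 φ) : Continuous (gradient φ) :=
  (InnerProductSpace.toDual ℝ (Euc N)).symm.continuous.comp (hφ.continuous_fderiv (by simp))

/-- The product and chain rules: the weak gradient of `F(u) φ`. -/
lemma HasWeakGradient.comp_mul {u : Euc N → ℝ} {g : Euc N → Euc N}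
    (h : HasWeakGradient univ u g) (hu : MemLinftyLoc univ u) {F : ℝ → ℝ} (hF : ContDiff ℝ 1 F)
    {φ : Euc N → ℝ} (hφ : ContDiff ℝ ∞ φ) :
    HasWeakGradient univ (fun x => F (u x) * φ x)
      (fun x => (deriv F (u x) * φ x) • g x + F (u x) • gradient φ x) := by
  have hφ1 : ContDiff ℝ 1 φ := hφ.of_le (by simp)
  have hF' : Continuous (deriv F) := hF.continuous_deriv le_rfl
  have hFu := hu.comp hF.continuous
  have ha := (hu.comp hF').mul (memLinftyLoc_of_continuous hφ.continuous)
  refine ⟨(hFu.mul (memLinftyLoc_of_continuous hφ.continuous)).locallyIntegrable.locallyIntegrableOn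
    _, (ha.smul_locallyIntegrableOn h.locInt_grad).add (hFu.smul_locallyIntegrableOn
      ((continuous_gradient hφ1).locallyIntegrable.locallyIntegrableOn _)), ?_⟩
  intro ξ hξ hξc hξs e
  have hξs' : tsupport ξ ⊆ {0}ᶜ := by rwa [compl_eq_univ_sdiff]
  -- Testing F(u) with φ ξ makes the derivative of φ appear as the second term of the product rule.
  have key := h.integral_comp hu hF (η := fun x => φ x * ξ x) ((hφ.mul hξ).of_le (by simp))
    hξc.mul_left ((tsupport_mul_subset_right).trans hξs') e
  have hd : ∀ x, fderiv ℝ (fun x => φ x * ξ x) x e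
      = φ x * fderiv ℝ ξ x e + ξ x * fderiv ℝ φ x e := fun x => by
    have := fderiv_mul (hφ.differentiable (by simp) x) (hξ.differentiable (by simp) x)
    change fderiv ℝ (φ * ξ) x e = _
    rw [this]
    simp
  simp only [hd] at key
  have hξ' : Continuous fun x => fderiv ℝ ξ x e :=
    (hξ.continuous_fderiv (by simp)).clm_apply continuous_const
  have hφ' : Continuous fun x => fderiv ℝ φ x e :=
    (hφ.continuous_fderiv (by simp)).clm_apply continuous_const
  have hli := hFu.locallyIntegrable
  have hint : ∀ {a : Euc N → ℝ}, Continuous a → HasCompactSupport a →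
      Integrable fun x => a x * F (u x) := fun ha hac =>
    integrable_mul_of_continuous_of_hasCompactSupport ha hac (hli.integrableOn_isCompact hac)
  have i1 : Integrable fun x => F (u x) * φ x * fderiv ℝ ξ x e :=
    (hint (hφ.continuous.mul hξ') (hξc.fderiv_apply ℝ e).mul_left).congr
      (Eventually.of_forall fun x => by simp only [Pi.mul_apply]; ring)
  have i2 : Integrable fun x => F (u x) * fderiv ℝ φ x e * ξ x :=
    (hint (hφ'.mul hξ.continuous) hξc.mul_left).congr
      (Eventually.of_forall fun x => by simp only [Pi.mul_apply]; ring)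
  have hK : IsCompact (tsupport ξ) := hξc
  have i3 : Integrable fun x => deriv F (u x) * inner ℝ (g x) e * (φ x * ξ x) := by
    have h1 : IntegrableOn (fun x => inner ℝ ((deriv F (u x) * φ x) • g x) e) (tsupport ξ) :=
      ((ha.smul_locallyIntegrableOn h.locInt_grad).integrableOn_compact_subset hξs hK).inner_const e
    refine (integrable_mul_of_continuous_of_hasCompactSupport hξ.continuous hξc h1).congr
      (Eventually.of_forall fun x => ?_)
    simp only [real_inner_smul_left]
    ring
  have e1 : ∫ x, F (u x) * (φ x * fderiv ℝ ξ x e + ξ x * fderiv ℝ φ x e)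
      = (∫ x, F (u x) * φ x * fderiv ℝ ξ x e) + ∫ x, F (u x) * fderiv ℝ φ x e * ξ x := by
    rw [← integral_add i1 i2]
    exact integral_congr_ae (Eventually.of_forall fun x => by ring)
  have e2 : ∫ x, inner ℝ ((deriv F (u x) * φ x) • g x + F (u x) • gradient φ x) e * ξ x
      = (∫ x, deriv F (u x) * inner ℝ (g x) e * (φ x * ξ x))
        + ∫ x, F (u x) * fderiv ℝ φ x e * ξ x := by
    rw [← integral_add i3 i2]
    refine integral_congr_ae (Eventually.of_forall fun x => ?_)
    simp only [inner_add_left, real_inner_smul_left, inner_gradient_eq]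
    ring
  rw [e1] at key
  rw [e2]
  linarith

lemma locallyIntegrable_norm_rpow {a : ℝ} (hN : 1 ≤ N) (ha : -(N : ℝ) < a) :
    LocallyIntegrable fun x : Euc N => ‖x‖ ^ a := by
  refine locallyIntegrable_of_norm_le_rpow (C := 1) (α := -a) (by simpa using hN)
    (by simp; linarith) (Eventually.of_forall fun x => ?_)
    ((measurable_norm.pow_const a).aestronglyMeasurable)
  rw [neg_neg, one_mul, Real.norm_of_nonneg (by positivity)]

lemma memLp_norm_rpow {a : ℝ} (hN : 1 ≤ N) (ha : -(N : ℝ) < 2 * a) {K : Set (Euc N)}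
    (hK : IsCompact K) : MemLp (fun x : Euc N => ‖x‖ ^ a) 2 (volume.restrict K) := by
  rw [memLp_two_iff_integrable_sq (measurable_norm.pow_const a).aestronglyMeasurable]
  refine ((locallyIntegrable_norm_rpow hN ha).integrableOn_isCompact hK).congr
    (Eventually.of_forall fun x => ?_)
  simp only
  rw [mul_comm, Real.rpow_mul (norm_nonneg _)]
  simp

lemma memLp_univ_of_forall_notMem {F : Type*} [NormedAddCommGroup F] {f : Euc N → F}
    {K : Set (Euc N)} (hK : IsCompact K) (hf : MemLp f 2 (volume.restrict K))
    (h0 : ∀ x ∉ K, f x = 0) : MemLp f 2 (volume.restrict univ) := by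
  have : K.indicator f = f := by
    ext1 x
    by_cases hx : x ∈ K
    · simp [hx]
    · simp [hx, h0 x hx]
  rw [Measure.restrict_univ, ← this, memLp_indicator_iff_restrict hK.measurableSet]
  exact hf

/-- `F(u) φ` is an admissible test function if `u ∈ H^{1,θ}_loc ∩ L^∞_loc` and `φ` is smooth with
compact support. -/
lemma MemH1Loc.memH1c_comp_mul {θ : ℝ} (hN : 1 ≤ N) (hθ : -(N : ℝ) < θ) {u : Euc N → ℝ}
    {g : Euc N → Euc N} (h : MemH1Loc univ θ u g) (hu : MemLinftyLoc univ u) {F : ℝ → ℝ}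
    (hF : ContDiff ℝ 1 F) {φ : Euc N → ℝ} (hφ : ContDiff ℝ ∞ φ) (hφc : HasCompactSupport φ) :
    MemH1c univ θ (fun x => F (u x) * φ x)
      (fun x => (deriv F (u x) * φ x) • g x + F (u x) • gradient φ x) := by
  have hK : IsCompact (tsupport φ) := hφc
  have hφ1 : ContDiff ℝ 1 φ := hφ.of_le (by simp)
  have hF' : Continuous (deriv F) := hF.continuous_deriv le_rfl
  have hFu := hu.comp hF.continuous
  have hφb := memLinftyLoc_of_continuous hφ.continuous
  -- Here -N < θ enters: the weight |x|^θ is locally integrable, so bounded functions lie in the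
  -- weighted L² on compact sets.
  have hr := memLp_norm_rpow (a := θ / 2) hN (by linarith) hK
  have hgrad0 : ∀ x ∉ tsupport φ, gradient φ x = 0 := fun x hx => by
    rw [gradient, fderiv_eq_zero_of_notMem_tsupport hx, map_zero]
  have hgb : MemLp (fun x => gradient φ x) ⊤ (volume.restrict (tsupport φ)) := by
    obtain ⟨A, hA⟩ := hK.exists_bound_of_continuousOn (continuous_gradient hφ1).continuousOn
    exact memLp_top_of_bound (continuous_gradient hφ1).aestronglyMeasurable A
      ((ae_restrict_mem hK.measurableSet).mono fun x hx => hA x hx)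
  refine ⟨⟨h.weakGrad.comp_mul hu hF hφ, ?_, ?_⟩, tsupport φ, hK, subset_univ _,
    Eventually.of_forall fun x hx => by simp [image_eq_zero_of_notMem_tsupport hx]⟩
  · refine memLp_univ_of_forall_notMem hK ?_ fun x hx => by
      simp [image_eq_zero_of_notMem_tsupport hx]
    exact ((hFu.mul hφb) _ hK (subset_univ _)).mul hr
  · refine memLp_univ_of_forall_notMem hK ?_ fun x hx => by
      simp [image_eq_zero_of_notMem_tsupport hx, hgrad0 x hx]
    have m1 := (h.memLp_grad _ hK (subset_univ _)).smul (r := 2)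
      (((hu.comp hF').mul hφb) _ hK (subset_univ _))
    have m2 := (hgb.smul (r := 2) hr).smul (r := 2) (hFu _ hK (subset_univ _))
    refine (m1.add m2).ae_eq (Eventually.of_forall fun x => ?_)
    simp only [Pi.add_apply, Pi.smul_apply', smul_add]
    rw [smul_comm, smul_comm (F (u x))]

/-! ### Radial cutoffs, the divergence theorem for radial fields, and Hardy's inequality -/

section SmoothTransition

lemma hasDerivAt_smoothTransition (x : ℝ) :
    HasDerivAt Real.smoothTransition (deriv Real.smoothTransition x) x :=
  ((Real.smoothTransition.contDiff (n := 1)).differentiable (by simp) x).hasDerivAt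

lemma continuous_deriv_smoothTransition : Continuous (deriv Real.smoothTransition) :=
  (Real.smoothTransition.contDiff (n := 1)).continuous_deriv (by simp)

lemma deriv_smoothTransition_of_neg {x : ℝ} (hx : x < 0) : deriv Real.smoothTransition x = 0 := by
  have : Real.smoothTransition =ᶠ[𝓝 x] fun _ => 0 := by
    filter_upwards [Iio_mem_nhds hx] with y hy
    exact Real.smoothTransition.zero_of_nonpos (le_of_lt hy)
  rw [this.deriv_eq, deriv_const]

lemma deriv_smoothTransition_of_one_lt {x : ℝ} (hx : 1 < x) :
    deriv Real.smoothTransition x = 0 := by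
  have : Real.smoothTransition =ᶠ[𝓝 x] fun _ => 1 := by
    filter_upwards [Ioi_mem_nhds hx] with y hy
    exact Real.smoothTransition.one_of_one_le (le_of_lt hy)
  rw [this.deriv_eq, deriv_const]

lemma exists_bound_deriv_smoothTransition :
    ∃ C, 0 ≤ C ∧ ∀ x, |deriv Real.smoothTransition x| ≤ C := by
  obtain ⟨C, hC⟩ := isCompact_Icc.exists_bound_of_continuousOn (s := Icc (0 : ℝ) 1)
    continuous_deriv_smoothTransition.continuousOn
  have hC0 : 0 ≤ C := (norm_nonneg _).trans (hC 0 (by simp))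
  refine ⟨C, hC0, fun x => ?_⟩
  rcases lt_or_ge x 0 with h | h
  · rwa [deriv_smoothTransition_of_neg h, abs_zero]
  rcases lt_or_ge 1 x with h' | h'
  · rwa [deriv_smoothTransition_of_one_lt h', abs_zero]
  exact hC x ⟨h, h'⟩

end SmoothTransition

lemma volume_singleton_zero (hN : 1 ≤ N) : volume ({0} : Set (Euc N)) = 0 := by
  have : Nonempty (Fin N) := ⟨⟨0, hN⟩⟩
  have : Nontrivial (Euc N) := inferInstance
  exact measure_singleton _

lemma ae_ne_zero (hN : 1 ≤ N) : ∀ᵐ x : Euc N, x ≠ 0 := by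
  rw [ae_iff]
  simpa using volume_singleton_zero hN

/-- The weak gradient vanishes outside a compact set outside which the function vanishes. -/
lemma HasWeakGradient.ae_grad_eq_zero (hN : 1 ≤ N) {u : Euc N → ℝ} {h : Euc N → Euc N}
    (hw : HasWeakGradient univ u h) {K : Set (Euc N)} (hK : IsCompact K)
    (hu : ∀ᵐ x, x ∉ K → u x = 0) : ∀ᵐ x, x ∉ K → h x = 0 := by
  have hU : IsOpen (Kᶜ ∩ {0}ᶜ : Set (Euc N)) := hK.isClosed.isOpen_compl.inter
    isOpen_compl_singleton
  have hsub : (Kᶜ ∩ {0}ᶜ : Set (Euc N)) ⊆ univ \ {0} := by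
    rw [← compl_eq_univ_sdiff]
    exact inter_subset_right
  have h1 : ∀ᵐ x, x ∈ (Kᶜ ∩ {0}ᶜ : Set (Euc N)) → h x = 0 := by
    refine hU.ae_eq_zero_of_integral_contDiff_smul_eq_zero (hw.locInt_grad.mono_set hsub)
      fun η hη hηc hηs => ?_
    have hηs' := hηs.trans hsub
    have hi : IntegrableOn h (tsupport η) :=
      hw.locInt_grad.integrableOn_compact_subset hηs' hηc
    obtain ⟨C, hC⟩ := hη.continuous.bounded_above_of_compact_support hηc
    have hint : Integrable fun x => η x • h x := by
      have h2 : IntegrableOn (fun x => η x • h x) (tsupport η) :=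
        hi.bdd_smul C hη.continuous.aestronglyMeasurable (Eventually.of_forall hC)
      exact h2.integrable_of_forall_notMem_eq_zero fun x hx => by
        simp [image_eq_zero_of_notMem_tsupport hx]
    refine ext_inner_left ℝ fun e => ?_
    rw [← integral_inner hint, inner_zero_right]
    have h3 := hw.integral_eq η hη hηc hηs' e
    have h4 : ∫ x, u x * fderiv ℝ η x e = 0 := by
      refine integral_eq_zero_of_ae ?_
      filter_upwards [hu] with x hx
      by_cases hxK : x ∈ K
      · have : x ∉ tsupport η := fun hx' => (hηs hx').1 hxK
        simp [fderiv_eq_zero_of_notMem_tsupport this]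
      · simp [hx hxK]
    rw [h4, zero_eq_neg] at h3
    rw [← h3]
    refine integral_congr_ae (Eventually.of_forall fun x => ?_)
    simp only [inner_smul_right]
    rw [real_inner_comm, mul_comm]
  filter_upwards [h1, ae_ne_zero hN] with x hx hx0 hxK
  exact hx ⟨hxK, hx0⟩

lemma contDiffAt_one_of_hasDerivAt {b b' : ℝ → ℝ} (hb : ∀ r, 0 < r → HasDerivAt b (b' r) r)
    (hb' : ContinuousOn b' (Ioi 0)) {r : ℝ} (hr : 0 < r) : ContDiffAt ℝ 1 b r := by
  have : ContDiffOn ℝ (0 + 1) b (Ioi 0) := by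
    rw [contDiffOn_succ_iff_deriv_of_isOpen isOpen_Ioi]
    refine ⟨fun x hx => (hb x hx).differentiableAt.differentiableWithinAt, by simp, ?_⟩
    rw [contDiffOn_zero]
    exact hb'.congr fun x hx => (hb x hx).deriv
  simpa using this.contDiffAt (Ioi_mem_nhds hr)

/-- Only the origin is at issue, where the norm is not smooth; there the composite is locally zero.
-/
lemma contDiff_comp_norm {B B' : ℝ → ℝ} (hB : ∀ r, 0 < r → HasDerivAt B (B' r) r)
    (hB' : ContinuousOn B' (Ioi 0)) {δ : ℝ} (hδ : 0 < δ) (h0 : ∀ r ≤ δ, B r = 0) :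
    ContDiff ℝ 1 fun x : Euc N => B ‖x‖ := by
  rw [contDiff_iff_contDiffAt]
  intro x
  rcases eq_or_ne x 0 with rfl | hx
  · have : (fun x : Euc N => B ‖x‖) =ᶠ[𝓝 0] fun _ => 0 := by
      filter_upwards [Metric.ball_mem_nhds (0 : Euc N) hδ] with y hy
      exact h0 _ (mem_ball_zero_iff.1 hy).le
    exact contDiffAt_const.congr_of_eventuallyEq this
  · exact (contDiffAt_one_of_hasDerivAt hB hB' (norm_pos_iff.2 hx)).comp x
      (contDiffAt_norm ℝ hx)

lemma tsupport_comp_norm_subset {B : ℝ → ℝ} {δ R : ℝ} (h0 : ∀ r ≤ δ, B r = 0)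
    (hR : ∀ r, R ≤ r → B r = 0) :
    tsupport (fun x : Euc N => B ‖x‖) ⊆ {x | δ ≤ ‖x‖} ∩ Metric.closedBall 0 R := by
  refine closure_minimal (fun x hx => ?_)
    ((isClosed_le continuous_const continuous_norm).inter Metric.isClosed_closedBall)
  rw [Function.mem_support] at hx
  refine ⟨?_, ?_⟩
  · by_contra h
    exact hx (h0 _ (not_le.1 h).le)
  · rw [mem_closedBall_zero_iff]
    by_contra h
    exact hx (hR _ (not_le.1 h).le)

lemma hasFDerivAt_norm_apply {x : Euc N} (hx : x ≠ 0) :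
    HasFDerivAt (fun y : Euc N => ‖y‖) (‖x‖⁻¹ • innerSL ℝ x) x := by
  have h := (hasStrictFDerivAt_norm_sq x).hasFDerivAt.sqrt (by positivity)
  have e : (fun y : Euc N => Real.sqrt (‖y‖ ^ 2)) = fun y => ‖y‖ := by
    ext y
    exact Real.sqrt_sq (norm_nonneg _)
  rw [e] at h
  have e2 : (1 / (2 * √(‖x‖ ^ 2))) • 2 • (innerSL ℝ) x = ‖x‖⁻¹ • innerSL ℝ x := by
    rw [Real.sqrt_sq (norm_nonneg _)]
    ext y
    simp
    field_simp
  rwa [e2] at h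

/-- The divergence theorem for a radial field `B(|x|) x` vanishing near the origin and near
infinity, tested against `F(u)`. -/
lemma HasWeakGradient.integral_radial {u : Euc N → ℝ} {h : Euc N → Euc N}
    (hw : HasWeakGradient univ u h) (hu : MemLinftyLoc univ u) {F : ℝ → ℝ} (hF : ContDiff ℝ 1 F)
    {B B' : ℝ → ℝ} (hB : ∀ r, 0 < r → HasDerivAt B (B' r) r) (hB' : ContinuousOn B' (Ioi 0))
    {δ R : ℝ} (hδ : 0 < δ) (h0 : ∀ r ≤ δ, B r = 0) (hR : ∀ r, R ≤ r → B r = 0) :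
    AEStronglyMeasurable (fun x => F (u x) * (N * B ‖x‖ + ‖x‖ * B' ‖x‖)) volume ∧
    AEStronglyMeasurable (fun x => deriv F (u x) * (B ‖x‖ * inner ℝ (h x) x)) volume ∧
    ∫ x, F (u x) * (N * B ‖x‖ + ‖x‖ * B' ‖x‖)
      = -∫ x, deriv F (u x) * (B ‖x‖ * inner ℝ (h x) x) := by
  have hcd : ContDiff ℝ 1 fun x : Euc N => B ‖x‖ := contDiff_comp_norm hB hB' hδ h0
  have hts := tsupport_comp_norm_subset (N := N) h0 hR
  have hcs : HasCompactSupport fun x : Euc N => B ‖x‖ :=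
    (isCompact_closedBall (0 : Euc N) R).of_isClosed_subset (isClosed_tsupport _)
      (hts.trans inter_subset_right)
  have hts0 : tsupport (fun x : Euc N => B ‖x‖) ⊆ {0}ᶜ := fun x hx hx0 => by
    have := (hts hx).1
    simp only [mem_singleton_iff] at hx0
    simp [hx0] at this
    linarith
  let c : Fin N → Euc N → ℝ := fun i x => x i
  have hc : ∀ i, ContDiff ℝ 1 (c i) := fun i =>
    (EuclideanSpace.proj i : Euc N →L[ℝ] ℝ).contDiff
  let e : Fin N → Euc N := fun i => EuclideanSpace.single i 1
  -- The components of the field B(|x|) x; summing the identities for the i-th component in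
  -- direction i produces its divergence N B + r B'.
  let η : Fin N → Euc N → ℝ := fun i x => B ‖x‖ * c i x
  have hη : ∀ i, ContDiff ℝ 1 (η i) := fun i => hcd.mul (hc i)
  have hηc : ∀ i, HasCompactSupport (η i) := fun i => hcs.mul_right
  have hηs : ∀ i, tsupport (η i) ⊆ {0}ᶜ := fun i => tsupport_mul_subset_left.trans hts0
  have hF' : Continuous (deriv F) := hF.continuous_deriv le_rfl
  have key := fun i => hw.integral_comp hu hF (hη i) (hηc i) (hηs i) (e i)
  have hsum1 : ∀ x, ∑ i, F (u x) * fderiv ℝ (η i) x (e i)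
      = F (u x) * (N * B ‖x‖ + ‖x‖ * B' ‖x‖) := fun x => by
    rw [← Finset.mul_sum]
    rcases eq_or_ne x 0 with rfl | hx
    · have h1 : ∀ i, fderiv ℝ (η i) 0 = 0 := fun i =>
        fderiv_eq_zero_of_notMem_tsupport fun h => hηs i h rfl
      simp [h1, h0 0 hδ.le]
    · have hxp : 0 < ‖x‖ := norm_pos_iff.2 hx
      have h1 : ∀ i, fderiv ℝ (η i) x (e i) = B ‖x‖ + B' ‖x‖ * ‖x‖⁻¹ * (x i) ^ 2 := fun i => by
        have d1 : HasFDerivAt (fun x : Euc N => B ‖x‖) (B' ‖x‖ • (‖x‖⁻¹ • innerSL ℝ x)) x :=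
          (hB _ hxp).comp_hasFDerivAt x (hasFDerivAt_norm_apply hx)
        have d2 : HasFDerivAt (c i) (EuclideanSpace.proj i : Euc N →L[ℝ] ℝ) x :=
          (EuclideanSpace.proj i : Euc N →L[ℝ] ℝ).hasFDerivAt
        have d3 : fderiv ℝ (η i) x = _ := (d1.mul d2).fderiv
        rw [d3]
        simp [e, c, EuclideanSpace.inner_single_right]
        ring
      simp only [h1, Finset.sum_add_distrib, Finset.sum_const, Finset.card_univ, Fintype.card_fin,
        ← Finset.mul_sum]
      have h2 : ∑ i, x i ^ 2 = ‖x‖ ^ 2 := by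
        rw [EuclideanSpace.norm_sq_eq]
        simp
      rw [h2]
      field_simp
      simp
  have hsum2 : ∀ x, ∑ i, deriv F (u x) * inner ℝ (h x) (e i) * η i x
      = deriv F (u x) * (B ‖x‖ * inner ℝ (h x) x) := fun x => by
    have h1 : inner ℝ (h x) x = ∑ i, h x i * x i := by
      rw [PiLp.inner_apply]
      simp [mul_comm]
    rw [h1, Finset.mul_sum, Finset.mul_sum]
    refine Finset.sum_congr rfl fun i _ => ?_
    simp only [e, η, c, EuclideanSpace.inner_single_right, one_mul]
    simp
    ring
  have i1 : ∀ i, Integrable fun x => F (u x) * fderiv ℝ (η i) x (e i) := fun i => by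
    have hd : Continuous fun x => fderiv ℝ (η i) x (e i) :=
      ((hη i).continuous_fderiv (by simp)).clm_apply continuous_const
    have := integrable_mul_of_continuous_of_hasCompactSupport hd ((hηc i).fderiv_apply ℝ (e i))
      ((hu.comp hF.continuous).locallyIntegrable.integrableOn_isCompact
        ((hηc i).fderiv_apply ℝ (e i)))
    simpa only [mul_comm] using this
  have i2 : ∀ i, Integrable fun x => deriv F (u x) * inner ℝ (h x) (e i) * η i x := fun i => by
    have hs : tsupport (η i) ⊆ univ \ {0} := by
      rw [← compl_eq_univ_sdiff]
      exact hηs i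
    have h1 : IntegrableOn (fun x => inner ℝ (deriv F (u x) • h x) (e i)) (tsupport (η i)) :=
      (((hu.comp hF').smul_locallyIntegrableOn hw.locInt_grad).integrableOn_compact_subset hs
        (hηc i)).inner_const (e i)
    refine (integrable_mul_of_continuous_of_hasCompactSupport (hη i).continuous (hηc i) h1).congr
      (Eventually.of_forall fun x => ?_)
    simp only [real_inner_smul_left]
    ring
  have s1 := integral_finsetSum Finset.univ fun i _ => i1 i
  have s2 := integral_finsetSum Finset.univ fun i _ => i2 i
  have j1 := integrable_finsetSum Finset.univ fun i _ => i1 i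
  have j2 := integrable_finsetSum Finset.univ fun i _ => i2 i
  simp only [hsum1] at s1 j1
  simp only [hsum2] at s2 j2
  refine ⟨j1.1, j2.1, ?_⟩
  rw [s1, s2, ← Finset.sum_neg_distrib]
  exact Finset.sum_congr rfl fun i _ => key i

/-- The divergence theorem for a radial field `b(|x|) x` of size `O(|x|^{θ-1})` at the origin,
tested against `F(u)` for `u ∈ H^{1,θ}_c ∩ L^∞_loc`. -/
lemma MemH1c.integral_radial {θ : ℝ} (hN : 1 ≤ N) (hθ : 2 < N + θ) {u : Euc N → ℝ}
    {h : Euc N → Euc N} (hc : MemH1c univ θ u h) (hu : MemLinftyLoc univ u) {F : ℝ → ℝ}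
    (hF : ContDiff ℝ 1 F) (hF0 : F 0 = 0) {b b' : ℝ → ℝ}
    (hb : ∀ r, 0 < r → HasDerivAt b (b' r) r) (hb' : ContinuousOn b' (Ioi 0))
    (hbound : ∀ R, ∃ C, ∀ r, 0 < r → r ≤ R →
      |b r| ≤ C * r ^ (θ - 2) ∧ |N * b r + r * b' r| ≤ C * r ^ (θ - 2)) :
    Integrable (fun x => F (u x) * (N * b ‖x‖ + ‖x‖ * b' ‖x‖)) ∧
    Integrable (fun x => deriv F (u x) * (b ‖x‖ * inner ℝ (h x) x)) ∧
    ∫ x, F (u x) * (N * b ‖x‖ + ‖x‖ * b' ‖x‖)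
      = -∫ x, deriv F (u x) * (b ‖x‖ * inner ℝ (h x) x) := by
  obtain ⟨hH, K, hK, -, huK⟩ := hc
  rw [Measure.restrict_univ] at huK
  have hw := hH.weakGrad
  have hhK := HasWeakGradient.ae_grad_eq_zero hN hw hK huK
  obtain ⟨R, hRpos, hKR⟩ := hK.isBounded.exists_pos_norm_le
  obtain ⟨C, hC⟩ := hbound R
  have hC0 : 0 ≤ C := by
    have := (abs_nonneg _).trans (hC R hRpos le_rfl).1
    exact nonneg_of_mul_nonneg_left this (Real.rpow_pos_of_pos hRpos _)
  obtain ⟨D, hD0, hD⟩ := exists_bound_deriv_smoothTransition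
  have hF' : Continuous (deriv F) := hF.continuous_deriv le_rfl
  set S := Real.smoothTransition with hS
  obtain ⟨A, hA0, hA⟩ := (hu.comp hF.continuous).exists_bound (isCompact_closedBall (0 : Euc N) R)
  obtain ⟨A', hA'0, hA'⟩ := (hu.comp hF').exists_bound (isCompact_closedBall (0 : Euc N) R)
  rw [ae_restrict_iff' measurableSet_closedBall] at hA hA'
  -- This cutoff removes the origin: it is 0 for r ≤ 1/(n+1) and 1 for r ≥ 2/(n+1).
  let ζ : ℕ → ℝ → ℝ := fun n r => S (((n : ℝ) + 1) * r - 1)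
  let ζ' : ℕ → ℝ → ℝ := fun n r => deriv S (((n : ℝ) + 1) * r - 1) * ((n : ℝ) + 1)
  have hζ : ∀ n r, HasDerivAt (ζ n) (ζ' n r) r := fun n r => by
    have h1 : HasDerivAt (fun r : ℝ => ((n : ℝ) + 1) * r - 1) ((n : ℝ) + 1) r := by
      simpa using ((hasDerivAt_id r).const_mul ((n : ℝ) + 1)).sub_const 1
    exact (hasDerivAt_smoothTransition _).comp r h1
  have hζ'c : ∀ n, Continuous (ζ' n) := fun n =>
    (continuous_deriv_smoothTransition.comp (by fun_prop)).mul continuous_const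
  have hζc : ∀ n, Continuous (ζ n) := fun n =>
    Real.smoothTransition.continuous.comp (by fun_prop)
  -- This cutoff only serves to make the field compactly supported. It equals 1 up to R + 1, so it
  -- and its derivative are invisible on the ball of radius R, which contains K.
  let ϖ : ℝ → ℝ := fun r => S (R + 2 - r)
  let ϖ' : ℝ → ℝ := fun r => deriv S (R + 2 - r) * (-1)
  have hϖ : ∀ r, HasDerivAt ϖ (ϖ' r) r := fun r => by
    have h1 : HasDerivAt (fun r : ℝ => R + 2 - r) (-1) r := by
      simpa using (hasDerivAt_id r).const_sub (R + 2)
    exact (hasDerivAt_smoothTransition _).comp r h1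
  have hϖ'c : Continuous ϖ' :=
    (continuous_deriv_smoothTransition.comp (by fun_prop)).mul continuous_const
  have hϖc : Continuous ϖ := Real.smoothTransition.continuous.comp (by fun_prop)
  have hϖ1 : ∀ r ≤ R, ϖ r = 1 := fun r hr => Real.smoothTransition.one_of_one_le (by linarith)
  have hϖ'0 : ∀ r ≤ R, ϖ' r = 0 := fun r hr => by
    simp only [ϖ', hS]
    rw [deriv_smoothTransition_of_one_lt (by linarith), zero_mul]
  have hbc : ContinuousOn b (Ioi 0) := fun r hr => (hb r hr).continuousAt.continuousWithinAt
  let B : ℕ → ℝ → ℝ := fun n r => b r * ζ n r * ϖ r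
  let B' : ℕ → ℝ → ℝ := fun n r => (b' r * ζ n r + b r * ζ' n r) * ϖ r + b r * ζ n r * ϖ' r
  have hB : ∀ n r, 0 < r → HasDerivAt (B n) (B' n r) r := fun n r hr =>
    ((hb r hr).mul (hζ n r)).mul (hϖ r)
  have hB' : ∀ n, ContinuousOn (B' n) (Ioi 0) := fun n =>
    (((hb'.mul (hζc n).continuousOn).add (hbc.mul (hζ'c n).continuousOn)).mul
      hϖc.continuousOn).add ((hbc.mul (hζc n).continuousOn).mul hϖ'c.continuousOn)
  have hB0 : ∀ n : ℕ, ∀ r ≤ 1 / ((n : ℝ) + 1), B n r = 0 := fun n r hr => by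
    have h1 : ζ n r = 0 := by
      refine Real.smoothTransition.zero_of_nonpos ?_
      rw [le_div_iff₀ (by positivity)] at hr
      linarith
    simp [B, h1]
  have hBR : ∀ n r, R + 2 ≤ r → B n r = 0 := fun n r hr => by
    have h1 : ϖ r = 0 := Real.smoothTransition.zero_of_nonpos (by linarith)
    simp [B, h1]
  have key := fun n : ℕ => hw.integral_radial hu hF (hB n) (hB' n)
    (show (0 : ℝ) < 1 / ((n : ℝ) + 1) by positivity) (hB0 n) (hBR n)
  have hζ01 : ∀ n r, |ζ n r| ≤ 1 := fun n r => by
    rw [abs_of_nonneg (Real.smoothTransition.nonneg _)]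
    exact Real.smoothTransition.le_one _
  -- Scale invariance: the derivative of ζ lives where (n+1) r ≤ 2, so r ζ' is bounded uniformly in
  -- n. The cutoff error is thus dominated by a multiple of |b|.
  have hrζ' : ∀ n r, 0 < r → |r * ζ' n r| ≤ 2 * D := fun n r hr => by
    rcases lt_or_ge 1 (((n : ℝ) + 1) * r - 1) with h1 | h1
    · simp only [ζ', hS]
      rw [deriv_smoothTransition_of_one_lt h1]
      simp only [zero_mul, mul_zero, abs_zero]
      positivity
    · have e : r * ζ' n r = ((n : ℝ) + 1) * r * deriv S (((n : ℝ) + 1) * r - 1) := by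
        simp only [ζ']
        ring
      rw [e, abs_mul, abs_of_nonneg (by positivity)]
      exact mul_le_mul (by linarith) (hD _) (abs_nonneg _) (by norm_num)
  have hlarge : ∀ r, 0 < r → ∀ᶠ n : ℕ in atTop, 1 < ((n : ℝ) + 1) * r - 1 := fun r hr => by
    have : Tendsto (fun n : ℕ => ((n : ℝ) + 1) * r) atTop atTop :=
      (tendsto_natCast_atTop_atTop.atTop_add tendsto_const_nhds).atTop_mul_const hr
    filter_upwards [this.eventually_gt_atTop 2] with n hn
    linarith
  have hζlim : ∀ r, 0 < r → ∀ᶠ n in atTop, ζ n r = 1 ∧ ζ' n r = 0 := fun r hr => by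
    filter_upwards [hlarge r hr] with n hn
    refine ⟨Real.smoothTransition.one_of_one_le hn.le, ?_⟩
    simp only [ζ', hS]
    rw [deriv_smoothTransition_of_one_lt hn, zero_mul]
  have hNB : ∀ n r, r ≤ R → N * B n r + r * B' n r
      = (N * b r + r * b' r) * ζ n r + b r * (r * ζ' n r) := fun n r hr => by
    simp only [B, B', hϖ1 r hr, hϖ'0 r hr]
    ring
  have hball : ∀ x : Euc N, x ∉ Metric.closedBall (0 : Euc N) R → x ∉ K := fun x hx hxK =>
    hx (mem_closedBall_zero_iff.2 (hKR x hxK))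
  have lim1 : ∀ᵐ x, Tendsto (fun n => F (u x) * (N * B n ‖x‖ + ‖x‖ * B' n ‖x‖)) atTop
      (𝓝 (F (u x) * (N * b ‖x‖ + ‖x‖ * b' ‖x‖))) := by
    filter_upwards [huK, ae_ne_zero hN] with x hxu hx0
    refine tendsto_const_nhds.congr' ?_
    filter_upwards [hζlim _ (norm_pos_iff.2 hx0)] with n hn
    by_cases hx : x ∈ Metric.closedBall (0 : Euc N) R
    · rw [hNB n _ (mem_closedBall_zero_iff.1 hx), hn.1, hn.2]
      ring
    · simp [hxu (hball x hx), hF0]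
  have lim2 : ∀ᵐ x, Tendsto (fun n => deriv F (u x) * (B n ‖x‖ * inner ℝ (h x) x)) atTop
      (𝓝 (deriv F (u x) * (b ‖x‖ * inner ℝ (h x) x))) := by
    filter_upwards [hhK, ae_ne_zero hN] with x hxh hx0
    refine tendsto_const_nhds.congr' ?_
    filter_upwards [hζlim _ (norm_pos_iff.2 hx0)] with n hn
    by_cases hx : x ∈ Metric.closedBall (0 : Euc N) R
    · simp [B, hϖ1 _ (mem_closedBall_zero_iff.1 hx), hn.1]
    · simp [hxh (hball x hx)]
  -- The first dominating function is integrable because N + θ > 2. The second is a product of two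
  -- L² factors: r^{θ/2-1}, again by N + θ > 2, and r^{θ/2}|h|.
  let d1 : Euc N → ℝ := (Metric.closedBall 0 R).indicator fun x =>
    A * (C * (1 + 2 * D)) * ‖x‖ ^ (θ - 2)
  have hd1 : Integrable d1 := by
    have m : IntegrableOn (fun x : Euc N => ‖x‖ ^ (θ - 2)) (Metric.closedBall 0 R) :=
      (locallyIntegrable_norm_rpow hN (by linarith)).integrableOn_isCompact
        (isCompact_closedBall _ _)
    exact IntegrableOn.integrable_indicator (m.const_mul _) measurableSet_closedBall
  let d2 : Euc N → ℝ := (Metric.closedBall 0 R).indicator fun x =>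
    A' * C * (‖x‖ ^ (θ / 2 - 1) * ‖‖x‖ ^ (θ / 2) • h x‖)
  have hd2 : Integrable d2 := by
    have m1 : MemLp (fun x : Euc N => ‖x‖ ^ (θ / 2 - 1)) 2
        (volume.restrict (Metric.closedBall 0 R)) :=
      memLp_norm_rpow hN (by linarith) (isCompact_closedBall _ _)
    have m2 : MemLp (fun x => ‖‖x‖ ^ (θ / 2) • h x‖) 2
        (volume.restrict (Metric.closedBall 0 R)) :=
      (hH.memLp_grad.mono_measure (Measure.restrict_mono (subset_univ _) le_rfl)).norm
    exact IntegrableOn.integrable_indicator ((m1.integrable_mul m2).const_mul _)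
      measurableSet_closedBall
  have bd1 : ∀ n, ∀ᵐ x, ‖F (u x) * (N * B n ‖x‖ + ‖x‖ * B' n ‖x‖)‖ ≤ d1 x := fun n => by
    filter_upwards [huK, ae_ne_zero hN, hA] with x hxu hx0 hxA
    have hxp : 0 < ‖x‖ := norm_pos_iff.2 hx0
    by_cases hx : x ∈ Metric.closedBall (0 : Euc N) R
    · have hxR := mem_closedBall_zero_iff.1 hx
      simp only [d1, indicator_of_mem hx]
      rw [hNB n _ hxR, norm_mul, mul_assoc A]
      refine mul_le_mul (hxA hx) ?_ (norm_nonneg _) hA0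
      have hq := hC _ hxp hxR
      have hpos : 0 ≤ C * ‖x‖ ^ (θ - 2) := by positivity
      calc |(N * b ‖x‖ + ‖x‖ * b' ‖x‖) * ζ n ‖x‖ + b ‖x‖ * (‖x‖ * ζ' n ‖x‖)|
          ≤ |N * b ‖x‖ + ‖x‖ * b' ‖x‖| * |ζ n ‖x‖| + |b ‖x‖| * |‖x‖ * ζ' n ‖x‖| := by
            rw [← abs_mul, ← abs_mul]
            exact abs_add_le _ _
        _ ≤ C * ‖x‖ ^ (θ - 2) * 1 + C * ‖x‖ ^ (θ - 2) * (2 * D) :=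
            add_le_add (mul_le_mul hq.2 (hζ01 _ _) (abs_nonneg _) hpos)
              (mul_le_mul hq.1 (hrζ' _ _ hxp) (abs_nonneg _) hpos)
        _ = _ := by ring
    · simp [d1, indicator_of_notMem hx, hxu (hball x hx), hF0]
  have bd2 : ∀ n, ∀ᵐ x, ‖deriv F (u x) * (B n ‖x‖ * inner ℝ (h x) x)‖ ≤ d2 x := fun n => by
    filter_upwards [hhK, ae_ne_zero hN, hA'] with x hxh hx0 hxA
    have hxp : 0 < ‖x‖ := norm_pos_iff.2 hx0
    by_cases hx : x ∈ Metric.closedBall (0 : Euc N) R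
    · have hxR := mem_closedBall_zero_iff.1 hx
      simp only [d2, indicator_of_mem hx]
      rw [norm_mul, mul_assoc A']
      refine mul_le_mul (hxA hx) ?_ (norm_nonneg _) hA'0
      have hq := (hC _ hxp hxR).1
      have e1 : B n ‖x‖ = b ‖x‖ * ζ n ‖x‖ := by simp [B, hϖ1 _ hxR]
      have e2 : ‖x‖ ^ (θ - 2) * (‖h x‖ * ‖x‖)
          = ‖x‖ ^ (θ / 2 - 1) * ‖‖x‖ ^ (θ / 2) • h x‖ := by
        rw [norm_smul, Real.norm_of_nonneg (by positivity)]
        have : ‖x‖ ^ (θ - 2) * ‖x‖ = ‖x‖ ^ (θ / 2 - 1) * ‖x‖ ^ (θ / 2) := by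
          nth_rewrite 2 [← Real.rpow_one ‖x‖]
          rw [← Real.rpow_add hxp, ← Real.rpow_add hxp]
          congr 1
          ring
        linear_combination ‖h x‖ * this
      rw [norm_mul, e1, ← e2, ← mul_assoc]
      refine mul_le_mul ?_ (abs_real_inner_le_norm _ _) (norm_nonneg _) (by positivity)
      rw [norm_mul]
      calc ‖b ‖x‖‖ * ‖ζ n ‖x‖‖ ≤ C * ‖x‖ ^ (θ - 2) * 1 :=
            mul_le_mul hq (hζ01 _ _) (abs_nonneg _) (by positivity)
        _ = _ := mul_one _
    · simp [d2, indicator_of_notMem hx, hxh (hball x hx)]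
  have T1 := tendsto_integral_of_dominated_convergence d1 (fun n => (key n).1) hd1 bd1 lim1
  have T2 := tendsto_integral_of_dominated_convergence d2 (fun n => (key n).2.1) hd2 bd2 lim2
  refine ⟨?_, ?_, ?_⟩
  · refine hd1.mono' (aestronglyMeasurable_of_tendsto_ae _ (fun n => (key n).1) lim1) ?_
    filter_upwards [lim1, ae_all_iff.2 bd1] with x hx hx'
    exact le_of_tendsto hx.norm (Eventually.of_forall hx')
  · refine hd2.mono' (aestronglyMeasurable_of_tendsto_ae _ (fun n => (key n).2.1) lim2) ?_
    filter_upwards [lim2, ae_all_iff.2 bd2] with x hx hx'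
    exact le_of_tendsto hx.norm (Eventually.of_forall hx')
  · refine tendsto_nhds_unique T1 ?_
    refine T2.neg.congr fun n => ?_
    rw [(key n).2.2]

lemma MemH1.integrable_rpow_mul_norm_sq {θ : ℝ} (hN : 1 ≤ N) {u : Euc N → ℝ} {h : Euc N → Euc N}
    (hH : MemH1 univ θ u h) : Integrable fun x => ‖x‖ ^ θ * ‖h x‖ ^ 2 := by
  have h1 := hH.memLp_grad
  rw [Measure.restrict_univ] at h1
  refine (((memLp_two_iff_integrable_sq_norm h1.1).1 h1)).congr ?_
  filter_upwards [ae_ne_zero hN] with x hx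
  rw [norm_smul, mul_pow, Real.norm_of_nonneg (by positivity), ← Real.rpow_natCast (‖x‖ ^ (θ / 2)),
    ← Real.rpow_mul (norm_nonneg _)]
  norm_num

/-- The Hardy inequality in the weighted space. -/
lemma MemH1c.hardy {θ : ℝ} (hN : 1 ≤ N) (hθ : 2 < N + θ) {u : Euc N → ℝ}
    {h : Euc N → Euc N} (hc : MemH1c univ θ u h) (hu : MemLinftyLoc univ u) :
    Integrable (fun x => ‖x‖ ^ (θ - 2) * u x ^ 2) ∧
    (N + θ - 2) ^ 2 / 4 * ∫ x, ‖x‖ ^ (θ - 2) * u x ^ 2 ≤ ∫ x, ‖x‖ ^ θ * ‖h x‖ ^ 2 := by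
  have hder : ∀ r : ℝ, 0 < r →
      HasDerivAt (fun r : ℝ => r ^ (θ - 2)) ((θ - 2) * r ^ (θ - 2 - 1)) r := fun r hr =>
    Real.hasDerivAt_rpow_const (Or.inl hr.ne')
  have hrr : ∀ r : ℝ, 0 < r → N * r ^ (θ - 2) + r * ((θ - 2) * r ^ (θ - 2 - 1))
      = (N + θ - 2) * r ^ (θ - 2) := fun r hr => by
    rw [Real.rpow_sub_one hr.ne']
    field_simp
    ring
  -- The field |x|^{θ-2} x has divergence (N+θ-2)|x|^{θ-2}.
  obtain ⟨i1, i2, e⟩ := hc.integral_radial hN hθ hu (F := fun t => t ^ 2) (contDiff_id.pow 2)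
    (by simp) hder
    (continuousOn_const.mul (continuousOn_id.rpow_const fun r hr => Or.inl (ne_of_gt hr)))
    (fun R => ⟨N + θ - 2 + 1, fun r hr _ => by
      have hp : 0 < r ^ (θ - 2) := Real.rpow_pos_of_pos hr _
      rw [hrr r hr, abs_of_pos hp, abs_of_pos (mul_pos (by linarith) hp)]
      constructor <;> nlinarith⟩)
  have i3 := hc.1.integrable_rpow_mul_norm_sq hN
  have hc0 : 0 < (N : ℝ) + θ - 2 := by linarith
  set c : ℝ := N + θ - 2 with hcdef
  have hae : ∀ᵐ x : Euc N, u x ^ 2 * (N * ‖x‖ ^ (θ - 2) + ‖x‖ * ((θ - 2) * ‖x‖ ^ (θ - 2 - 1)))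
      = c * (‖x‖ ^ (θ - 2) * u x ^ 2) := by
    filter_upwards [ae_ne_zero hN] with x hx
    rw [hrr _ (norm_pos_iff.2 hx)]
    ring
  have i4 : Integrable fun x => ‖x‖ ^ (θ - 2) * u x ^ 2 := by
    refine ((i1.congr hae).const_mul c⁻¹).congr (Eventually.of_forall fun x => ?_)
    simp only
    rw [← mul_assoc, inv_mul_cancel₀ hc0.ne', one_mul]
  refine ⟨i4, ?_⟩
  rw [integral_congr_ae hae, integral_const_mul, ← integral_neg] at e
  have hle : ∫ x, -(deriv (fun t : ℝ => t ^ 2) (u x) * (‖x‖ ^ (θ - 2) * inner ℝ (h x) x))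
      ≤ ∫ x, (c / 2 * (‖x‖ ^ (θ - 2) * u x ^ 2) + 2 / c * (‖x‖ ^ θ * ‖h x‖ ^ 2)) := by
    refine integral_mono_ae i2.neg ((i4.const_mul _).add (i3.const_mul _)) ?_
    filter_upwards [ae_ne_zero hN] with x hx
    have hxp : 0 < ‖x‖ := norm_pos_iff.2 hx
    have e1 : ‖x‖ ^ θ = ‖x‖ ^ (θ - 2) * ‖x‖ ^ 2 := by
      rw [← Real.rpow_natCast, ← Real.rpow_add hxp]
      norm_num
    have hp : 0 < ‖x‖ ^ (θ - 2) := Real.rpow_pos_of_pos hxp _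
    have h1 := abs_real_inner_le_norm (h x) x
    have h2 : deriv (fun t : ℝ => t ^ 2) (u x) = 2 * u x := by simp
    simp only [h2, e1]
    have h3 : inner ℝ (h x) x ^ 2 ≤ (‖h x‖ * ‖x‖) ^ 2 := by
      rw [← sq_abs]
      exact pow_le_pow_left₀ (abs_nonneg _) h1 2
    -- Young's inequality with the weight that absorbs exactly half of the left side; this choice
    -- gives the constant c²/4.
    have h4 : -(2 * u x * inner ℝ (h x) x) ≤ c / 2 * u x ^ 2 + 2 / c * inner ℝ (h x) x ^ 2 := by
      have h5 : 0 ≤ (c * u x + 2 * inner ℝ (h x) x) ^ 2 / (2 * c) := by positivity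
      have h6 : (c * u x + 2 * inner ℝ (h x) x) ^ 2 / (2 * c)
        = c / 2 * u x ^ 2 + 2 / c * inner ℝ (h x) x ^ 2 + 2 * u x * inner ℝ (h x) x := by
        field_simp
        ring
      linarith
    calc -(2 * u x * (‖x‖ ^ (θ - 2) * inner ℝ (h x) x))
        = ‖x‖ ^ (θ - 2) * -(2 * u x * inner ℝ (h x) x) := by ring
      _ ≤ ‖x‖ ^ (θ - 2) * (c / 2 * u x ^ 2 + 2 / c * (‖h x‖ * ‖x‖) ^ 2) := by
          refine mul_le_mul_of_nonneg_left (h4.trans ?_) hp.le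
          have : 0 ≤ 2 / c := by positivity
          gcongr
      _ = _ := by ring
  rw [← e, integral_add (i4.const_mul _) (i3.const_mul _), integral_const_mul,
    integral_const_mul] at hle
  have h7 : c / 2 * ∫ x, ‖x‖ ^ (θ - 2) * u x ^ 2 ≤ 2 / c * ∫ x, ‖x‖ ^ θ * ‖h x‖ ^ 2 := by
    linarith
  have h8 := mul_le_mul_of_nonneg_left h7 (show 0 ≤ c / 2 by positivity)
  have h9 : c / 2 * (2 / c * ∫ x, ‖x‖ ^ θ * ‖h x‖ ^ 2) = ∫ x, ‖x‖ ^ θ * ‖h x‖ ^ 2 := by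
    field_simp
  rw [h9] at h8
  linarith

/-! ### The singular initial value problem with a bounded Lipschitz nonlinearity -/

section RadialProfile

/-- Existence for the integral equation
`V(q) = κ - c ∫₀^q ∫₀¹ t^m f(V(st)) dt ds` with a bounded Lipschitz nonlinearity. -/
lemma exists_integral_equation {f : ℝ → ℝ} (hf : Continuous f) {L A : ℝ} (hL : 0 ≤ L)
    (hLip : ∀ a b, |f a - f b| ≤ L * |a - b|) (hA : ∀ a, |f a| ≤ A) {m c : ℝ} (hm : 0 ≤ m)
    (hc : 0 ≤ c) (κ : ℝ) :
    ∃ V : ℝ → ℝ, Continuous V ∧ ∀ q, 0 ≤ q →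
      V q = κ - c * ∫ s in (0 : ℝ)..q, ∫ t in (0 : ℝ)..1, t ^ m * f (V (s * t)) := by
  -- The unknown is written V = exp(M|q|) u with u bounded. In this weighted norm the integral
  -- operator has Lipschitz constant cL/M < 1, so one contraction gives the solution on the whole
  -- half-line.
  set M : ℝ := c * L + 1 with hM
  have hM0 : 0 < M := by positivity
  have hA0 : 0 ≤ A := (abs_nonneg _).trans (hA 0)
  let I : (ℝ → ℝ) → ℝ → ℝ → ℝ := fun u s t => t ^ m * f (Real.exp (M * |s * t|) * u (s * t))
  have hI : ∀ u : ℝ → ℝ, Continuous u → Continuous fun z : ℝ × ℝ => I u z.1 z.2 := fun u hu =>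
    ((Real.continuous_rpow_const hm).comp continuous_snd).mul (hf.comp (by fun_prop))
  have hI2 : ∀ u : ℝ → ℝ, Continuous u → ∀ s, Continuous fun t => I u s t := fun u hu s =>
    (hI u hu).comp (Continuous.prodMk_right s)
  let J : (ℝ → ℝ) → ℝ → ℝ := fun u s => ∫ t in (0 : ℝ)..1, I u s t
  have hJ : ∀ u : ℝ → ℝ, Continuous u → Continuous (J u) := fun u hu =>
    intervalIntegral.continuous_parametric_intervalIntegral_of_continuous' (hI u hu) 0 1
  have hJint : ∀ u : ℝ → ℝ, Continuous u → ∀ a b, IntervalIntegrable (J u) volume a b :=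
    fun u hu a b => (hJ u hu).intervalIntegrable a b
  have hpow : ∀ t ∈ uIoc (0 : ℝ) 1, |t ^ m| ≤ 1 := fun t ht => by
    rw [uIoc_of_le zero_le_one] at ht
    rw [abs_of_nonneg (Real.rpow_nonneg ht.1.le _)]
    exact Real.rpow_le_one ht.1.le ht.2 hm
  have hJA : ∀ u s, |J u s| ≤ A := fun u s => by
    have := intervalIntegral.norm_integral_le_of_norm_le_const (a := 0) (b := 1)
      (f := fun t => I u s t) (C := A) fun t ht => by
        rw [norm_mul]
        calc _ ≤ 1 * A := mul_le_mul (hpow t ht) (hA _) (abs_nonneg _) zero_le_one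
          _ = A := one_mul A
    simpa using this
  -- Using |q| extends the operator to the whole line, so that it acts on bounded continuous
  -- functions there; only q ≥ 0 matters in the end.
  let T : (ℝ → ℝ) → ℝ → ℝ := fun u q =>
    Real.exp (-(M * |q|)) * (κ - c * ∫ s in (0 : ℝ)..|q|, J u s)
  have hTc : ∀ u : ℝ → ℝ, Continuous u → Continuous (T u) := fun u hu => by
    have h1 : Continuous fun q => ∫ s in (0 : ℝ)..q, J u s :=
      intervalIntegral.continuous_primitive (hJint u hu) 0
    exact (by fun_prop : Continuous fun q : ℝ => Real.exp (-(M * |q|))).mul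
      (continuous_const.sub (continuous_const.mul (h1.comp continuous_abs)))
  have hTb : ∀ u q, |T u q| ≤ |κ| + c * A / M := fun u q => by
    have h1 : |∫ s in (0 : ℝ)..|q|, J u s| ≤ A * |q| := by
      have := intervalIntegral.norm_integral_le_of_norm_le_const (a := 0) (b := |q|)
        (f := J u) (C := A) fun t _ => hJA u t
      simpa using this
    have h2 : M * |q| ≤ Real.exp (M * |q|) := by linarith [Real.add_one_le_exp (M * |q|)]
    have h3 : Real.exp (-(M * |q|)) * Real.exp (M * |q|) = 1 := by
      rw [← Real.exp_add]
      simp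
    have h4 : Real.exp (-(M * |q|)) ≤ 1 := Real.exp_le_one_iff.2 (by
      have : 0 ≤ M * |q| := by positivity
      linarith)
    have h5 : Real.exp (-(M * |q|)) * |q| ≤ 1 / M := by
      rw [le_div_iff₀ hM0]
      have := mul_le_mul_of_nonneg_left h2 (Real.exp_pos (-(M * |q|))).le
      linarith
    simp only [T]
    rw [abs_mul, abs_of_pos (Real.exp_pos _)]
    calc Real.exp (-(M * |q|)) * |κ - c * ∫ s in (0 : ℝ)..|q|, J u s|
        ≤ Real.exp (-(M * |q|)) * (|κ| + c * (A * |q|)) := by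
          refine mul_le_mul_of_nonneg_left ((abs_sub _ _).trans ?_) (Real.exp_pos _).le
          rw [abs_mul, abs_of_nonneg hc]
          gcongr
      _ = Real.exp (-(M * |q|)) * |κ| + c * A * (Real.exp (-(M * |q|)) * |q|) := by ring
      _ ≤ 1 * |κ| + c * A * (1 / M) := by gcongr
      _ = _ := by ring
  let Φ : BoundedContinuousFunction ℝ ℝ → BoundedContinuousFunction ℝ ℝ := fun u =>
    BoundedContinuousFunction.ofNormedAddCommGroup (T u) (hTc u u.continuous) _ (hTb u)
  have hexpint : ∀ Q : ℝ, ∫ s in (0 : ℝ)..Q, Real.exp (M * s) = (Real.exp (M * Q) - 1) / M :=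
    fun Q => by
    rw [intervalIntegral.integral_comp_mul_left _ hM0.ne', integral_exp]
    simp [div_eq_inv_mul]
  have hcLM : 0 ≤ c * L / M := by positivity
  have hΦ : ContractingWith (c * L / M).toNNReal Φ := by
    refine ⟨?_, LipschitzWith.of_dist_le_mul fun u w => ?_⟩
    · rw [Real.toNNReal_lt_one, div_lt_one hM0]
      linarith
    · set d := dist u w with hd
      have hd0 : 0 ≤ d := dist_nonneg
      have huw : ∀ x, |u x - w x| ≤ d := fun x => by
        rw [← Real.dist_eq]
        exact BoundedContinuousFunction.dist_coe_le_dist x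
      rw [BoundedContinuousFunction.dist_le (mul_nonneg (NNReal.coe_nonneg _) hd0)]
      intro q
      rw [Real.coe_toNNReal _ hcLM]
      change |T u q - T w q| ≤ c * L / M * d
      have hJd : ∀ s, 0 ≤ s → |J u s - J w s| ≤ L * d * Real.exp (M * s) := fun s hs => by
        have e : J u s - J w s = ∫ t in (0 : ℝ)..1, (I u s t - I w s t) :=
          (intervalIntegral.integral_sub ((hI2 u u.continuous s).intervalIntegrable _ _)
            ((hI2 w w.continuous s).intervalIntegrable _ _)).symm
        rw [e]
        have := intervalIntegral.norm_integral_le_of_norm_le_const (a := 0) (b := 1)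
          (f := fun t => I u s t - I w s t) (C := L * d * Real.exp (M * s)) fun t ht => by
            have ht' := ht
            rw [uIoc_of_le zero_le_one] at ht'
            simp only [I, ← mul_sub]
            rw [norm_mul]
            have h1 : |s * t| ≤ s := by
              rw [abs_of_nonneg (mul_nonneg hs ht'.1.le)]
              exact mul_le_of_le_one_right hs ht'.2
            calc _ ≤ 1 * (L * |Real.exp (M * |s * t|) * u (s * t)
                    - Real.exp (M * |s * t|) * w (s * t)|) :=
                  mul_le_mul (hpow t ht) (hLip _ _) (abs_nonneg _) zero_le_one
              _ = L * (Real.exp (M * |s * t|) * |u (s * t) - w (s * t)|) := by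
                  rw [← mul_sub, abs_mul, abs_of_pos (Real.exp_pos _), one_mul]
              _ ≤ L * (Real.exp (M * s) * d) := by
                  gcongr
                  exact huw _
              _ = _ := by ring
        simpa using this
      have hint : |(∫ s in (0 : ℝ)..|q|, J u s) - ∫ s in (0 : ℝ)..|q|, J w s|
          ≤ L * d * (Real.exp (M * |q|) / M) := by
        rw [← intervalIntegral.integral_sub (hJint u u.continuous _ _)
          (hJint w w.continuous _ _)]
        have := intervalIntegral.norm_integral_le_of_norm_le (μ := volume) (a := 0) (b := |q|)
          (f := fun s => J u s - J w s) (g := fun s => L * d * Real.exp (M * s)) (abs_nonneg q)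
          (Eventually.of_forall fun s hs => hJd s hs.1.le)
          ((by fun_prop : Continuous fun s => L * d * Real.exp (M * s)).intervalIntegrable _ _)
        refine this.trans ?_
        rw [intervalIntegral.integral_const_mul, hexpint]
        gcongr
        linarith
      have e : T u q - T w q = -(Real.exp (-(M * |q|)) * c
          * ((∫ s in (0 : ℝ)..|q|, J u s) - ∫ s in (0 : ℝ)..|q|, J w s)) := by
        simp only [T]
        ring
      have h3 : Real.exp (-(M * |q|)) * Real.exp (M * |q|) = 1 := by
        rw [← Real.exp_add]
        simp
      rw [e, abs_neg, abs_mul, abs_of_nonneg (mul_nonneg (Real.exp_pos _).le hc)]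
      calc _ ≤ Real.exp (-(M * |q|)) * c * (L * d * (Real.exp (M * |q|) / M)) := by gcongr
        _ = (Real.exp (-(M * |q|)) * Real.exp (M * |q|)) * (c * L / M * d) := by ring
        _ = _ := by rw [h3, one_mul]
  obtain ⟨u, hu⟩ : ∃ u, Φ u = u := ⟨_, hΦ.fixedPoint_isFixedPt⟩
  refine ⟨fun q => Real.exp (M * |q|) * u q, by fun_prop, fun q hq => ?_⟩
  have h1 : T u q = u q := congrFun (congrArg DFunLike.coe hu) q
  have h3 : Real.exp (M * |q|) * Real.exp (-(M * |q|)) = 1 := by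
    rw [← Real.exp_add]
    simp
  simp only
  rw [← h1]
  simp only [T]
  rw [← mul_assoc, h3, one_mul, abs_of_nonneg hq]

/-- Existence for the singular initial value problem `q V' = P`, `q P' = -m P - c q f(V)`,
`V(0) = κ`, with a bounded Lipschitz nonlinearity `f ≥ 0`. -/
lemma exists_singular_ivp {f : ℝ → ℝ} (hf : Continuous f) {L A : ℝ} (hL : 0 ≤ L)
    (hLip : ∀ a b, |f a - f b| ≤ L * |a - b|) (hf0 : ∀ a, 0 ≤ f a) (hA : ∀ a, f a ≤ A) {m c : ℝ}
    (hm : 0 ≤ m) (hc : 0 ≤ c) (κ : ℝ) :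
    ∃ V P : ℝ → ℝ, Continuous V ∧ V 0 = κ ∧
      (∀ q, 0 < q → HasDerivAt V (P q / q) q) ∧
      (∀ q, 0 < q → HasDerivAt P (-(m * P q) / q - c * f (V q)) q) ∧
      (∀ q, 0 < q → P q ≤ 0 ∧ -(c * A * q) ≤ P q) := by
  obtain ⟨V, hV, hVe⟩ := exists_integral_equation hf hL hLip
    (fun a => by rw [abs_of_nonneg (hf0 a)]; exact hA a) hm hc κ
  let I : ℝ → ℝ := fun s => ∫ t in (0 : ℝ)..1, t ^ m * f (V (s * t))
  let G : ℝ → ℝ := fun s => s ^ m * f (V s)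
  have hG : Continuous G := (Real.continuous_rpow_const hm).mul (hf.comp hV)
  have hI : Continuous I :=
    intervalIntegral.continuous_parametric_intervalIntegral_of_continuous'
      (((Real.continuous_rpow_const hm).comp continuous_snd).mul (hf.comp (hV.comp (by fun_prop))))
      0 1
  have hI0 : ∀ s, 0 ≤ I s := fun s => intervalIntegral.integral_nonneg zero_le_one fun t ht =>
    mul_nonneg (Real.rpow_nonneg ht.1 _) (hf0 _)
  have hIA : ∀ s, I s ≤ A := fun s => by
    have : I s ≤ ∫ _ in (0 : ℝ)..1, A := by
      refine intervalIntegral.integral_mono_on zero_le_one (Continuous.intervalIntegrable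
        ((Real.continuous_rpow_const hm).mul (hf.comp (hV.comp (by fun_prop)))) _ _)
        (by simp) fun t ht => ?_
      calc _ ≤ 1 * A := mul_le_mul (Real.rpow_le_one ht.1 ht.2 hm) (hA _) (hf0 _) zero_le_one
        _ = A := one_mul A
    simpa using this
  -- The rescaled integral `I` is continuous at 0, which suits the equation for V. The substitution
  -- s = q t turns q `I` q into q^{-m} ∫ G, whose product rule yields the equation for P.
  have hIG : ∀ q, 0 < q → q * I q = q ^ (-m) * ∫ s in (0 : ℝ)..q, G s := fun q hq => by
    have h1 := intervalIntegral.integral_comp_mul_left (a := 0) (b := 1) G hq.ne'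
    have h2 : ∫ t in (0 : ℝ)..1, G (q * t) = q ^ m * I q := by
      rw [← intervalIntegral.integral_const_mul]
      refine intervalIntegral.integral_congr fun t ht => ?_
      rw [uIcc_of_le zero_le_one] at ht
      simp only [G]
      rw [Real.mul_rpow hq.le ht.1]
      ring
    rw [h2, mul_zero, mul_one, smul_eq_mul] at h1
    have h3 : q ^ (-m) * q ^ m = 1 := by rw [← Real.rpow_add hq]; simp
    have h4 : ∫ s in (0 : ℝ)..q, G s = q * (q ^ m * I q) := by
      rw [h1]
      field_simp
    rw [h4]
    linear_combination -(q * I q) * h3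
  refine ⟨V, fun q => -(c * (q * I q)), hV, ?_, fun q hq => ?_, fun q hq => ?_, fun q hq => ?_⟩
  · have := hVe 0 le_rfl
    simpa using this
  · have h1 : HasDerivAt (fun q => κ - c * ∫ s in (0 : ℝ)..q, I s) (-(c * I q)) q :=
      ((intervalIntegral.integral_hasDerivAt_right (hI.intervalIntegrable _ _)
        (hI.stronglyMeasurableAtFilter _ _) hI.continuousAt).const_mul c).const_sub κ
    have h2 : -(c * (q * I q)) / q = -(c * I q) := by field_simp
    rw [h2]
    refine h1.congr_of_eventuallyEq ?_
    filter_upwards [Ioi_mem_nhds hq] with y hy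
    exact hVe y (le_of_lt hy)
  · have h1 : HasDerivAt (fun q => ∫ s in (0 : ℝ)..q, G s) (G q) q :=
      intervalIntegral.integral_hasDerivAt_right (hG.intervalIntegrable _ _)
        (hG.stronglyMeasurableAtFilter _ _) hG.continuousAt
    have h2 : HasDerivAt (fun q : ℝ => q ^ (-m)) (-m * q ^ (-m - 1)) q :=
      Real.hasDerivAt_rpow_const (Or.inl hq.ne')
    have h3 := ((h2.mul h1).const_mul c).neg
    have h4 : -(c * (-m * q ^ (-m - 1) * (∫ s in (0 : ℝ)..q, G s) + q ^ (-m) * G q))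
        = -(m * -(c * (q * I q))) / q - c * f (V q) := by
      have h5 : q ^ (-m) * q ^ m = 1 := by rw [← Real.rpow_add hq]; simp
      rw [hIG q hq, Real.rpow_sub_one hq.ne']
      simp only [G]
      field_simp
      linear_combination -(c * q * f (V q)) * h5
    rw [← h4]
    refine h3.congr_of_eventuallyEq ?_
    filter_upwards [Ioi_mem_nhds hq] with y hy
    simp only [Pi.neg_apply, Pi.mul_apply]
    rw [hIG y hy]
  · constructor
    · have : 0 ≤ c * (q * I q) := mul_nonneg hc (mul_nonneg hq.le (hI0 q))
      linarith
    · have : c * (q * I q) ≤ c * (q * A) := by gcongr; exact hIA q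
      linarith

end RadialProfile

/-! ### The Emden–Fowler trap and the global positive profile -/

section RadialProfile

lemma abs_rpow_sub_rpow_le {p κ : ℝ} (hp : 1 ≤ p) {a b : ℝ} (ha : a ∈ Icc 0 κ)
    (hb : b ∈ Icc 0 κ) : |a ^ p - b ^ p| ≤ p * κ ^ (p - 1) * |a - b| := by
  refine Convex.norm_image_sub_le_of_norm_hasDerivWithin_le (f := fun x : ℝ => x ^ p)
    (f' := fun x => p * x ^ (p - 1)) (s := Icc 0 κ) (fun x _ =>
      (Real.hasDerivAt_rpow_const (Or.inr hp)).hasDerivWithinAt) (fun x hx => ?_)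
    (convex_Icc _ _) hb ha
  rw [Real.norm_of_nonneg (mul_nonneg (by linarith) (Real.rpow_nonneg hx.1 _))]
  gcongr
  · exact hx.1
  · exact hx.2

/-- The power `t^p` with `t` clamped to `[0, κ]`. -/
def clampedPow (p κ t : ℝ) : ℝ := (max 0 (min t κ)) ^ p

lemma clampedPow_of_mem {p κ t : ℝ} (ht : t ∈ Icc 0 κ) : clampedPow p κ t = t ^ p := by
  rw [clampedPow, min_eq_left ht.2, max_eq_right ht.1]

lemma clamp_mem {κ : ℝ} (hκ : 0 ≤ κ) (t : ℝ) : max 0 (min t κ) ∈ Icc 0 κ :=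
  ⟨le_max_left _ _, max_le hκ (min_le_right _ _)⟩

lemma abs_clampedPow_sub_le {p κ : ℝ} (hp : 1 ≤ p) (hκ : 0 ≤ κ) (a b : ℝ) :
    |clampedPow p κ a - clampedPow p κ b| ≤ p * κ ^ (p - 1) * |a - b| := by
  refine (abs_rpow_sub_rpow_le hp (clamp_mem hκ a) (clamp_mem hκ b)).trans ?_
  refine mul_le_mul_of_nonneg_left ?_ (mul_nonneg (by linarith) (Real.rpow_nonneg hκ _))
  calc |max 0 (min a κ) - max 0 (min b κ)| ≤ max |0 - 0| |min a κ - min b κ| :=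
        abs_max_sub_max_le_max _ _ _ _
    _ = |min a κ - min b κ| := by simp
    _ ≤ max |a - b| |κ - κ| := abs_min_sub_min_le_max _ _ _ _
    _ = |a - b| := by simp

lemma continuous_clampedPow {p κ : ℝ} (hp : 0 ≤ p) : Continuous (clampedPow p κ) :=
  (Real.continuous_rpow_const hp).comp (by fun_prop)

/-- Initial data are read as limits at 0+, the equation being singular at 0. The lemma is applied to
functions with an integrating factor q^λ, λ > 0, which forces the limit 0. -/
lemma nonneg_of_hasDerivAt_nonneg_of_tendsto {g g' : ℝ → ℝ} {Q : ℝ}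
    (hg : ∀ q ∈ Ioo 0 Q, HasDerivAt g (g' q) q) (hg' : ∀ q ∈ Ioo 0 Q, 0 ≤ g' q)
    (hlim : Tendsto g (𝓝[>] 0) (𝓝 0)) {q : ℝ} (hq : q ∈ Ioo 0 Q) : 0 ≤ g q := by
  have hmono : MonotoneOn g (Ioo 0 Q) := by
    refine monotoneOn_of_deriv_nonneg (convex_Ioo _ _)
      (fun x hx => (hg x hx).continuousAt.continuousWithinAt) ?_ ?_
    · rw [interior_Ioo]
      exact fun x hx => (hg x hx).differentiableAt.differentiableWithinAt
    · rw [interior_Ioo]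
      exact fun x hx => (hg x hx).deriv ▸ hg' x hx
  refine le_of_tendsto hlim ?_
  filter_upwards [Ioo_mem_nhdsGT hq.1] with s hs
  exact hmono ⟨hs.1, hs.2.trans hq.2⟩ hq hs.2.le

lemma tendsto_rpow_nhdsGT_zero {a : ℝ} (ha : 0 < a) :
    Tendsto (fun q : ℝ => q ^ a) (𝓝[>] 0) (𝓝 0) := by
  have h := (Real.continuous_rpow_const ha.le).tendsto 0
  rw [Real.zero_rpow ha.ne'] at h
  exact h.mono_left nhdsWithin_le_nhds

/-- Bernoulli's inequality for w/β; this is the convexity that traps the profile. -/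
lemma tangent_line_rpow_le {p β w : ℝ} (hp : 1 ≤ p) (hβ : 0 < β) (hw : 0 ≤ w) :
    β ^ p + p * β ^ (p - 1) * (w - β) ≤ w ^ p := by
  have h := one_add_mul_self_le_rpow_one_add (s := w / β - 1)
    (by linarith [div_nonneg hw hβ.le]) hp
  rw [add_sub_cancel, Real.div_rpow hw hβ.le, le_div_iff₀ (Real.rpow_pos_of_pos hβ _)] at h
  rw [Real.rpow_sub_one hβ.ne']
  calc _ = (1 + p * (w / β - 1)) * β ^ p := by field_simp
    _ ≤ w ^ p := h

/-- While the profile is positive, its Emden–Fowler transform `w = q^k V` stays below the constant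
solution and is nondecreasing. -/
lemma emdenFowler_trapped {m p c κ β k Q : ℝ} (hp : 1 < p) (hc : 0 < c)
    (hk : k * (p - 1) = 1) (hmk : 2 * k < m) (hcond : 4 * (m - k) ≤ (m - 2 * k) ^ 2)
    (hβ : 0 < β) (hβp : c * β ^ (p - 1) = k * (m - k)) {V P : ℝ → ℝ}
    (hV : Tendsto V (𝓝[>] 0) (𝓝 κ)) (hP : Tendsto P (𝓝[>] 0) (𝓝 0))
    (hVpos : ∀ q ∈ Ioo 0 Q, 0 < V q)
    (hVd : ∀ q ∈ Ioo 0 Q, HasDerivAt V (P q / q) q)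
    (hPd : ∀ q ∈ Ioo 0 Q, HasDerivAt P (-(m * P q) / q - c * V q ^ p) q) :
    (∀ q ∈ Ioo 0 Q, q ^ k * V q ≤ β) ∧ MonotoneOn (fun q => q ^ k * V q) (Ioo 0 Q) := by
  have hp1 : 0 < p - 1 := by linarith
  have hk0 : 0 < k := by
    by_contra h
    nlinarith [not_lt.1 h]
  set a := m - 2 * k with ha
  have ha0 : 0 < a := by linarith
  have hmk' : 0 < m - k := by linarith
  let w : ℝ → ℝ := fun q => q ^ k * V q
  -- This is q w', the derivative of w in log q.
  let w₁ : ℝ → ℝ := fun q => q ^ k * (k * V q + P q)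
  have hw0 : ∀ q ∈ Ioo 0 Q, 0 < w q := fun q hq =>
    mul_pos (Real.rpow_pos_of_pos hq.1 _) (hVpos q hq)
  have hpow : ∀ q : ℝ, 0 < q → ∀ e : ℝ, HasDerivAt (fun q : ℝ => q ^ e) (e * q ^ e / q) q :=
    fun q hq e => by
    have := Real.hasDerivAt_rpow_const (x := q) (p := e) (Or.inl hq.ne')
    rwa [Real.rpow_sub_one hq.ne', ← mul_div_assoc] at this
  have hwd : ∀ q ∈ Ioo 0 Q, HasDerivAt w (w₁ q / q) q := fun q hq => by
    have h := (hpow q hq.1 k).mul (hVd q hq)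
    have e : k * q ^ k / q * V q + q ^ k * (P q / q) = w₁ q / q := by
      simp only [w₁]
      ring
    rw [e] at h
    exact h
  have hwp : ∀ q ∈ Ioo 0 Q, q ^ k * (q * V q ^ p) = w q ^ p := fun q hq => by
    simp only [w]
    rw [Real.mul_rpow (Real.rpow_nonneg hq.1.le _) (hVpos q hq).le, ← Real.rpow_mul hq.1.le]
    have : k * p = k + 1 := by linarith
    rw [this, Real.rpow_add_one hq.1.ne']
    ring
  have hw₁d : ∀ q ∈ Ioo 0 Q, HasDerivAt w₁
      ((-(a * w₁ q) + k * (m - k) * w q - c * w q ^ p) / q) q := fun q hq => by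
    have h := (hpow q hq.1 k).mul (((hVd q hq).const_mul k).add (hPd q hq))
    have e : k * q ^ k / q * (k * V q + P q) + q ^ k * (k * (P q / q) +
        (-(m * P q) / q - c * V q ^ p))
        = (-(a * w₁ q) + k * (m - k) * w q - c * w q ^ p) / q := by
      rw [← hwp q hq]
      simp only [w₁, w, ha]
      have := hq.1.ne'
      field_simp
      ring
    exact h.congr_deriv e
  have hw_lim : Tendsto w (𝓝[>] 0) (𝓝 0) := by
    have := (tendsto_rpow_nhdsGT_zero hk0).mul hV
    rwa [zero_mul] at this
  have hw₁_lim : Tendsto w₁ (𝓝[>] 0) (𝓝 0) := by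
    have := (tendsto_rpow_nhdsGT_zero hk0).mul ((hV.const_mul k).add hP)
    rwa [zero_mul] at this
  -- The linearisation at β in log q is z'' + a z' + (m-k) z, because (p-1) k (m-k) = m-k. `hcond`
  -- makes its roots -l₁ and -l₂ real, so it factors into two first-order operators.
  set Δ := Real.sqrt (a ^ 2 - 4 * (m - k)) with hΔ
  have hΔ2 : Δ ^ 2 = a ^ 2 - 4 * (m - k) := Real.sq_sqrt (by linarith)
  have hΔ0 : 0 ≤ Δ := Real.sqrt_nonneg _
  have hΔa : Δ < a := by nlinarith
  set l₁ := (a + Δ) / 2 with hl₁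
  set l₂ := (a - Δ) / 2 with hl₂
  have hl₁0 : 0 < l₁ := by linarith
  have hl₂0 : 0 < l₂ := by linarith
  have hlp : l₁ * l₂ = m - k := by
    rw [hl₁, hl₂]
    linear_combination -hΔ2 / 4
  have htan : ∀ q ∈ Ioo 0 Q, k * (m - k) * (β + p * (w q - β)) ≤ c * w q ^ p := fun q hq => by
    have h := mul_le_mul_of_nonneg_left (tangent_line_rpow_le hp.le hβ (hw0 q hq).le) hc.le
    refine le_trans (le_of_eq ?_) h
    rw [← hβp, Real.rpow_sub_one hβ.ne']
    field_simp
  -- With z = β - w, the quantity y = q z' + l₂ z satisfies q y' + l₁ y ≥ 0 by the tangent line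
  -- inequality; q^{l₁} is the integrating factor. In `hz` the factor q^{l₂} turns y ≥ 0 into z ≥ 0.
  have hy : ∀ q ∈ Ioo 0 Q, 0 ≤ -w₁ q + l₂ * (β - w q) := by
    have main : ∀ q ∈ Ioo 0 Q, 0 ≤ q ^ l₁ * (-w₁ q + l₂ * (β - w q)) := by
      intro q hq
      refine nonneg_of_hasDerivAt_nonneg_of_tendsto (Q := Q) (g := fun q =>
        q ^ l₁ * (-w₁ q + l₂ * (β - w q))) (g' := fun q => q ^ l₁ / q *
          (c * w q ^ p - k * (m - k) * (β + p * (w q - β)))) (fun q hq => ?_) (fun q hq => ?_) ?_ hq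
      · have h := (hpow q hq.1 l₁).mul ((hw₁d q hq).neg.add (((hwd q hq).const_sub β).const_mul l₂))
        refine h.congr_deriv ?_
        simp only [Pi.add_apply, Pi.neg_apply]
        have := hq.1.ne'
        field_simp
        have h2 : (p - 1) * (k * (m - k)) = l₁ * l₂ := by
          rw [hlp]
          linear_combination (m - k) * hk
        linear_combination -(q ^ l₁ * (β - w q)) * h2
      · exact mul_nonneg (div_nonneg (Real.rpow_nonneg hq.1.le _) hq.1.le)
          (sub_nonneg.2 (htan q hq))
      · have := (tendsto_rpow_nhdsGT_zero hl₁0).mul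
          (hw₁_lim.neg.add ((hw_lim.const_sub β).const_mul l₂))
        rwa [zero_mul] at this
    exact fun q hq => nonneg_of_mul_nonneg_right (main q hq) (Real.rpow_pos_of_pos hq.1 _)
  have hz : ∀ q ∈ Ioo 0 Q, w q ≤ β := by
    have main : ∀ q ∈ Ioo 0 Q, 0 ≤ q ^ l₂ * (β - w q) := by
      intro q hq
      refine nonneg_of_hasDerivAt_nonneg_of_tendsto (Q := Q) (g := fun q => q ^ l₂ * (β - w q))
        (g' := fun q => q ^ l₂ / q * (-w₁ q + l₂ * (β - w q))) (fun q hq => ?_)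
        (fun q hq => mul_nonneg (div_nonneg (Real.rpow_nonneg hq.1.le _) hq.1.le) (hy q hq)) ?_ hq
      · have h := (hpow q hq.1 l₂).mul ((hwd q hq).const_sub β)
        refine h.congr_deriv ?_
        ring
      · have := (tendsto_rpow_nhdsGT_zero hl₂0).mul (hw_lim.const_sub β)
        rwa [zero_mul] at this
    exact fun q hq => sub_nonneg.1 <|
      nonneg_of_mul_nonneg_right (main q hq) (Real.rpow_pos_of_pos hq.1 _)
  -- Since w ≤ β, the reaction term k(m-k) w - c w^p is nonnegative, hence so is the derivative of
  -- q^a w₁.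
  have hx : ∀ q ∈ Ioo 0 Q, 0 ≤ w₁ q := by
    have main : ∀ q ∈ Ioo 0 Q, 0 ≤ q ^ a * w₁ q := by
      intro q hq
      refine nonneg_of_hasDerivAt_nonneg_of_tendsto (Q := Q) (g := fun q => q ^ a * w₁ q)
        (g' := fun q => q ^ a / q * (k * (m - k) * w q - c * w q ^ p)) (fun q hq => ?_)
        (fun q hq => ?_) ?_ hq
      · have h := (hpow q hq.1 a).mul (hw₁d q hq)
        refine h.congr_deriv ?_
        ring
      · refine mul_nonneg (div_nonneg (Real.rpow_nonneg hq.1.le _) hq.1.le) ?_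
        have h1 : w q ^ p = w q ^ (p - 1) * w q := by
          rw [Real.rpow_sub_one (hw0 q hq).ne']
          field_simp [(hw0 q hq).ne']
        have h2 : w q ^ (p - 1) ≤ β ^ (p - 1) :=
          Real.rpow_le_rpow (hw0 q hq).le (hz q hq) hp1.le
        rw [h1, ← hβp]
        have h3 := mul_le_mul_of_nonneg_right (mul_le_mul_of_nonneg_left h2 hc.le) (hw0 q hq).le
        linarith
      · have := (tendsto_rpow_nhdsGT_zero ha0).mul hw₁_lim
        rwa [zero_mul] at this
    exact fun q hq => nonneg_of_mul_nonneg_right (main q hq) (Real.rpow_pos_of_pos hq.1 _)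
  refine ⟨hz, ?_⟩
  refine monotoneOn_of_deriv_nonneg (convex_Ioo _ _)
    (fun x hx => (hwd x hx).continuousAt.continuousWithinAt) ?_ ?_
  · rw [interior_Ioo]
    exact fun x hx => (hwd x hx).differentiableAt.differentiableWithinAt
  · rw [interior_Ioo]
    exact fun q hq => (hwd q hq).deriv ▸ div_nonneg (hx q hq) hq.1.le

/-- Existence of the positive radial profile in the variable `q = r^{2+τ}`, together with the bound
by the singular solution. -/
theorem exists_radial_profile {m p c κ k : ℝ} (hp : 1 < p) (hc : 0 < c) (hκ : 0 < κ)
    (hk : k * (p - 1) = 1) (hmk : 2 * k < m) (hcond : 4 * (m - k) ≤ (m - 2 * k) ^ 2) :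
    ∃ V P : ℝ → ℝ, Continuous V ∧ V 0 = κ ∧ (∀ q, 0 ≤ q → 0 < V q ∧ V q ≤ κ) ∧
      (∀ q, 0 < q → HasDerivAt V (P q / q) q) ∧
      (∀ q, 0 < q → HasDerivAt P (-(m * P q) / q - c * V q ^ p) q) ∧
      (∀ q, 0 < q → |P q| ≤ c * κ ^ p * q) ∧
      (∀ q, 0 < q → c * (q * V q ^ (p - 1)) ≤ k * (m - k)) := by
  have hp1 : 0 < p - 1 := by linarith
  have hk0 : 0 < k := by
    by_contra h
    nlinarith [not_lt.1 h]
  have hmk' : 0 < m - k := by linarith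
  -- The power is clamped to [0, κ] so that it is bounded and Lipschitz. P ≤ 0 gives V ≤ κ, and
  -- positivity is shown below, so the clamp is never active.
  obtain ⟨V, P, hVc, hV0, hVd, hPd, hPb⟩ := exists_singular_ivp
    (continuous_clampedPow (κ := κ) (by linarith : 0 ≤ p))
    (mul_nonneg (by linarith : 0 ≤ p) (Real.rpow_nonneg hκ.le (p - 1)))
    (abs_clampedPow_sub_le hp.le hκ.le) (fun a => Real.rpow_nonneg (le_max_left _ _) _)
    (fun a => Real.rpow_le_rpow (le_max_left _ _) (clamp_mem hκ.le a).2 (by linarith))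
    (by linarith : 0 ≤ m) hc.le κ
  have hVanti : AntitoneOn V (Ici 0) := by
    refine antitoneOn_of_deriv_nonpos (convex_Ici _) hVc.continuousOn ?_ ?_
    · rw [interior_Ici]
      exact fun x hx => (hVd x hx).differentiableAt.differentiableWithinAt
    · rw [interior_Ici]
      exact fun x hx => (hVd x hx).deriv ▸ div_nonpos_of_nonpos_of_nonneg (hPb x hx).1 (le_of_lt hx)
  have hVκ : ∀ q, 0 ≤ q → V q ≤ κ := fun q hq =>
    hV0 ▸ hVanti (by simp) (mem_Ici.2 hq) hq
  have hVlim : Tendsto V (𝓝[>] 0) (𝓝 κ) := hV0 ▸ (hVc.tendsto 0).mono_left nhdsWithin_le_nhds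
  have hPabs : ∀ q, 0 < q → |P q| ≤ c * κ ^ p * q := fun q hq => by
    have := hPb q hq
    rw [abs_of_nonpos this.1]
    linarith
  have hPlim : Tendsto P (𝓝[>] 0) (𝓝 0) := by
    have h1 : Tendsto (fun q : ℝ => c * κ ^ p * q) (𝓝[>] 0) (𝓝 0) := by
      have : Continuous fun q : ℝ => c * κ ^ p * q := by fun_prop
      simpa using (this.tendsto 0).mono_left nhdsWithin_le_nhds
    refine squeeze_zero_norm' ?_ h1
    filter_upwards [self_mem_nhdsWithin] with q hq using hPabs q hq
  -- The rest point, that is, the constant w corresponding to the singular solution.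
  set β := (k * (m - k) / c) ^ k with hβ
  have hb0 : 0 < k * (m - k) / c := by positivity
  have hβ0 : 0 < β := Real.rpow_pos_of_pos hb0 _
  have hβp : c * β ^ (p - 1) = k * (m - k) := by
    rw [hβ, ← Real.rpow_mul hb0.le, hk, Real.rpow_one]
    field_simp
  have trap : ∀ Q, (∀ q ∈ Ioo 0 Q, 0 < V q) →
      (∀ q ∈ Ioo 0 Q, q ^ k * V q ≤ β) ∧ MonotoneOn (fun q => q ^ k * V q) (Ioo 0 Q) :=
    fun Q hQ => emdenFowler_trapped hp hc hk hmk hcond hβ0 hβp hVlim hPlim hQ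
      (fun q hq => hVd q hq.1) (fun q hq => by
        have := hPd q hq.1
        rwa [clampedPow_of_mem ⟨(hQ q hq).le, hVκ q hq.1.le⟩] at this)
  have hpos : ∀ q, 0 ≤ q → 0 < V q := by
    by_contra! hcon
    obtain ⟨q₀, hq₀, hVq₀⟩ := hcon
    set Z : Set ℝ := {q | 0 ≤ q ∧ V q ≤ 0} with hZ
    have hZc : IsClosed Z := (isClosed_le continuous_const continuous_id).inter
      (isClosed_le hVc continuous_const)
    have hZne : Z.Nonempty := ⟨q₀, hq₀, hVq₀⟩
    have hZb : BddBelow Z := ⟨0, fun q hq => hq.1⟩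
    -- At a first zero Q the nondecreasing function q^k V would have to be both 0 and at least its
    -- positive value at Q/2.
    set Q := sInf Z with hQ
    have hQZ : Q ∈ Z := hZc.csInf_mem hZne hZb
    have hQ0 : 0 < Q := by
      rcases hQZ.1.eq_or_lt with h | h
      · have := hQZ.2
        rw [← h, hV0] at this
        linarith
      · exact h
    have hlt : ∀ q ∈ Ioo 0 Q, 0 < V q := fun q hq => by
      by_contra h
      exact absurd (csInf_le hZb (show q ∈ Z from ⟨hq.1.le, not_lt.1 h⟩)) (not_le.2 hq.2)
    have hmono := (trap Q hlt).2
    have hhalf : Q / 2 ∈ Ioo 0 Q := ⟨by linarith, by linarith⟩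
    have hlim : Tendsto (fun q => q ^ k * V q) (𝓝[<] Q) (𝓝 (Q ^ k * V Q)) :=
      (((Real.continuous_rpow_const hk0.le).mul hVc).tendsto Q).mono_left nhdsWithin_le_nhds
    have hge : (Q / 2) ^ k * V (Q / 2) ≤ Q ^ k * V Q := by
      refine ge_of_tendsto hlim ?_
      filter_upwards [Ioo_mem_nhdsLT hhalf.2] with q hq
      exact hmono hhalf ⟨hhalf.1.trans hq.1, hq.2⟩ hq.1.le
    have h1 : 0 < (Q / 2) ^ k * V (Q / 2) :=
      mul_pos (Real.rpow_pos_of_pos hhalf.1 _) (hlt _ hhalf)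
    have h2 : Q ^ k * V Q ≤ 0 :=
      mul_nonpos_of_nonneg_of_nonpos (Real.rpow_nonneg hQ0.le _) hQZ.2
    linarith
  refine ⟨V, P, hVc, hV0, fun q hq => ⟨hpos q hq, hVκ q hq⟩, hVd, fun q hq => ?_, hPabs, fun q hq => ?_⟩
  · have := hPd q hq
    rwa [clampedPow_of_mem ⟨(hpos q hq.le).le, hVκ q hq.le⟩] at this
  · have h1 := (trap (q + 1) fun x hx => hpos x hx.1.le).1 q ⟨hq, by linarith⟩
    have h2 := Real.rpow_le_rpow
      (mul_nonneg (Real.rpow_nonneg hq.le k) (hpos q hq.le).le) h1 hp1.le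
    rw [Real.mul_rpow (Real.rpow_nonneg hq.le _) (hpos q hq.le).le, ← Real.rpow_mul hq.le, hk,
      Real.rpow_one] at h2
    rw [← hβp]
    exact mul_le_mul_of_nonneg_left h2 hc.le

end RadialProfile

/-! ### The stable positive radial solutions -/

/-- A function that is continuously differentiable away from the origin has its classical gradient
as weak gradient. -/
lemma hasWeakGradient_of_hasFDerivAt {u : Euc N → ℝ} {g : Euc N → Euc N} (hu : Continuous u)
    (hg : ContinuousOn g {0}ᶜ) (hd : ∀ x ≠ 0, HasFDerivAt u (innerSL ℝ (g x)) x) :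
    HasWeakGradient univ u g := by
  have hg' : ContinuousOn g (univ \ {0}) := by rwa [← compl_eq_univ_sdiff]
  refine ⟨hu.locallyIntegrable.locallyIntegrableOn _, ?_, fun η hη hηc hηs e => ?_⟩
  · exact hg'.locallyIntegrableOn (by
      rw [← compl_eq_univ_sdiff]
      exact measurableSet_singleton _ |>.compl)
  have hne : ∀ x ∈ tsupport η, x ≠ 0 := fun x hx => (hηs hx).2
  have hη' : Continuous fun x => fderiv ℝ η x e :=
    (hη.continuous_fderiv (by simp)).clm_apply continuous_const
  have i1 : Integrable fun x => inner ℝ (g x) e * η x := by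
    have h1 : IntegrableOn (fun x => inner ℝ (g x) e) (tsupport η) :=
      ((hg'.mono hηs).inner continuousOn_const).integrableOn_compact hηc
    simpa only [mul_comm] using
      integrable_mul_of_continuous_of_hasCompactSupport hη.continuous hηc h1
  have e1 : ∀ x, fderiv ℝ u x e * η x = inner ℝ (g x) e * η x := fun x => by
    by_cases hx : x ∈ tsupport η
    · rw [(hd x (hne x hx)).fderiv]
      simp
    · simp [image_eq_zero_of_notMem_tsupport hx]
  have key := integral_mul_fderiv_eq_neg_fderiv_mul_of_integrable (μ := volume) (v := e)
    (f := u) (g := η) (by simpa only [e1] using i1)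
    ((hu.mul hη').integrable_of_hasCompactSupport (hηc.fderiv_apply ℝ e).mul_left)
    ((hu.mul hη.continuous).integrable_of_hasCompactSupport hηc.mul_left)
    (fun x hx => (hd x (hne x hx)).differentiableAt)
    (fun x _ => hη.differentiable (by simp) x)
  simpa only [e1] using key

lemma aestronglyMeasurable_of_continuousOn_compl_zero (hN : 1 ≤ N) {g : Euc N → Euc N}
    (hg : ContinuousOn g {0}ᶜ) : AEStronglyMeasurable g volume := by
  have h := hg.aestronglyMeasurable (μ := volume) (measurableSet_singleton (0 : Euc N)).compl
  rwa [Measure.restrict_eq_self_of_ae_mem] at h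
  exact ae_ne_zero hN

/-- Above the Joseph–Lundgren type threshold, expressed through `m = (N + θ - 2) / (2 + l - θ)` and
`k = 1 / (p - 1)`, there are stable positive radial solutions with any prescribed central value. -/
theorem exists_stable_radial_solution {θ l p m k κ : ℝ} (hN : 1 ≤ N) (hθ : 2 < N + θ)
    (hσ : 0 < 2 + l - θ) (hp : 1 < p) (hκ : 0 < κ) (hm : m * (2 + l - θ) = N + θ - 2)
    (hk : k * (p - 1) = 1) (hmk : 2 * k < m) (hcond : 4 * (m - k) ≤ (m - 2 * k) ^ 2) :
    ∃ v : Euc N → ℝ, IsStableSolution univ θ l p v ∧ Continuous v ∧ v 0 = κ ∧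
      (∀ x, 0 < v x) ∧ ∀ x y, ‖x‖ = ‖y‖ → v x = v y := by
  set σ := 2 + l - θ with hσdef
  have hc : (0 : ℝ) < 1 / σ ^ 2 := by positivity
  obtain ⟨V, P, hVc, hV0, hVpos, hVd, hPd, hPb, hVb⟩ :=
    exists_radial_profile hp hc hκ hk hmk hcond
  have hp1 : 0 < p - 1 := by linarith
  have hq : ∀ r : ℝ, 0 < r → 0 < r ^ σ := fun r hr => Real.rpow_pos_of_pos hr σ
  have hqc : Continuous fun x : Euc N => ‖x‖ ^ σ :=
    (Real.continuous_rpow_const hσ.le).comp continuous_norm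
  have hPc : ContinuousOn P (Ioi 0) := fun q hq => (hPd q hq).continuousAt.continuousWithinAt
  have hqd : ∀ r : ℝ, 0 < r → HasDerivAt (fun r : ℝ => r ^ σ) (σ * r ^ σ / r) r := fun r hr => by
    have := Real.hasDerivAt_rpow_const (x := r) (p := σ) (Or.inl hr.ne')
    rwa [Real.rpow_sub_one hr.ne', ← mul_div_assoc] at this
  let v : Euc N → ℝ := fun x => V (‖x‖ ^ σ)
  let g : Euc N → Euc N := fun x => (σ * P (‖x‖ ^ σ) / ‖x‖ ^ 2) • x
  have hv : Continuous v := hVc.comp hqc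
  have hvpos : ∀ x, 0 < v x := fun x => (hVpos _ (Real.rpow_nonneg (norm_nonneg x) _)).1
  have hgc : ContinuousOn g {0}ᶜ := by
    have h1 : ContinuousOn (fun x : Euc N => P (‖x‖ ^ σ)) {0}ᶜ :=
      hPc.comp hqc.continuousOn fun x hx => hq _ (norm_pos_iff.2 hx)
    exact ((continuousOn_const.mul h1).div (by fun_prop) fun x hx =>
      pow_ne_zero 2 (norm_ne_zero_iff.2 hx)).smul continuousOn_id
  have hgd : ∀ x ≠ 0, HasFDerivAt v (innerSL ℝ (g x)) x := fun x hx => by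
    have hxp : 0 < ‖x‖ := norm_pos_iff.2 hx
    have h1 : HasDerivAt (fun r => V (r ^ σ)) (P (‖x‖ ^ σ) / ‖x‖ ^ σ * (σ * ‖x‖ ^ σ / ‖x‖)) ‖x‖ :=
      (hVd _ (hq _ hxp)).comp ‖x‖ (hqd _ hxp)
    have h2 : HasFDerivAt v ((P (‖x‖ ^ σ) / ‖x‖ ^ σ * (σ * ‖x‖ ^ σ / ‖x‖)) •
        (‖x‖⁻¹ • innerSL ℝ x)) x := h1.comp_hasFDerivAt x (hasFDerivAt_norm_apply hx)
    refine h2.congr_fderiv ?_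
    ext y
    simp only [g, map_smul, smul_apply, smul_eq_mul]
    have := (hq _ hxp).ne'
    field_simp
  have hweak := hasWeakGradient_of_hasFDerivAt hv hgc hgd
  have hgm := aestronglyMeasurable_of_continuousOn_compl_zero hN hgc
  have hloc : MemH1Loc univ θ v g := by
    refine ⟨hweak, fun K hK _ => ?_, fun K hK _ => ?_⟩
    · exact (memLinftyLoc_of_continuous hv K hK (subset_univ _)).mul
        (memLp_norm_rpow hN (by linarith) hK)
    · have hb : MemLp (fun x : Euc N => ‖x‖ ^ (σ - 1 + θ / 2)) 2 (volume.restrict K) :=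
        memLp_norm_rpow hN (by linarith) hK
      refine hb.of_le_mul (c := σ * (1 / σ ^ 2 * κ ^ p))
        (((measurable_norm.pow_const (θ / 2)).aestronglyMeasurable.smul hgm).restrict) ?_
      refine ae_restrict_of_ae ?_
      filter_upwards [ae_ne_zero hN] with x hx
      have hxp : 0 < ‖x‖ := norm_pos_iff.2 hx
      have hP := hPb _ (hq _ hxp)
      have e1 : ‖x‖ ^ (σ - 1 + θ / 2) = ‖x‖ ^ σ / ‖x‖ * ‖x‖ ^ (θ / 2) := by
        rw [Real.rpow_add hxp, Real.rpow_sub_one hxp.ne']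
      have hpt : 0 ≤ ‖x‖ ^ (θ / 2) := Real.rpow_nonneg hxp.le _
      simp only [g]
      rw [norm_smul, norm_smul, norm_div, norm_mul, norm_pow, norm_norm, Real.norm_of_nonneg hpt,
        Real.norm_of_nonneg hσ.le, Real.norm_eq_abs (P _), e1, Real.norm_of_nonneg (by positivity)]
      calc ‖x‖ ^ (θ / 2) * (σ * |P (‖x‖ ^ σ)| / ‖x‖ ^ 2 * ‖x‖)
          = σ * ‖x‖ ^ (θ / 2) / ‖x‖ * |P (‖x‖ ^ σ)| := by field_simp
        _ ≤ σ * ‖x‖ ^ (θ / 2) / ‖x‖ * (1 / σ ^ 2 * κ ^ p * ‖x‖ ^ σ) :=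
            mul_le_mul_of_nonneg_left hP (by positivity)
        _ = _ := by ring
  have hvl : MemLinftyLoc univ v := memLinftyLoc_of_continuous hv
  have hrl : ∀ r : ℝ, 0 < r → r ^ l = r ^ (θ - 2) * r ^ σ := fun r hr => by
    rw [← Real.rpow_add hr]
    congr 1
    rw [hσdef]
    ring
  -- Chosen so that b(|x|) x = |x|^θ ∇v off the origin; `hdiv` is then the differential equation,
  -- and `hm` is what makes the terms in P cancel.
  let b : ℝ → ℝ := fun r => σ * (r ^ (θ - 2) * P (r ^ σ))
  let b' : ℝ → ℝ := fun r => σ * (((θ - 2) * r ^ (θ - 2) / r) * P (r ^ σ) + r ^ (θ - 2) *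
    ((-(m * P (r ^ σ)) / r ^ σ - 1 / σ ^ 2 * V (r ^ σ) ^ p) * (σ * r ^ σ / r)))
  have hb : ∀ r, 0 < r → HasDerivAt b (b' r) r := fun r hr => by
    have h1 : HasDerivAt (fun r : ℝ => r ^ (θ - 2)) ((θ - 2) * r ^ (θ - 2) / r) r := by
      have := Real.hasDerivAt_rpow_const (x := r) (p := θ - 2) (Or.inl hr.ne')
      rwa [Real.rpow_sub_one hr.ne', ← mul_div_assoc] at this
    exact (h1.mul ((hPd _ (hq r hr)).comp r (hqd r hr))).const_mul σ
  have hb' : ContinuousOn b' (Ioi 0) := by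
    have c0 : ∀ a : ℝ, ContinuousOn (fun r : ℝ => r ^ a) (Ioi 0) := fun a =>
      continuousOn_id.rpow_const fun r hr => Or.inl (ne_of_gt hr)
    have c1 : ContinuousOn (fun r : ℝ => P (r ^ σ)) (Ioi 0) :=
      hPc.comp (c0 σ) fun r hr => hq r hr
    have c2 : ContinuousOn (fun r : ℝ => V (r ^ σ) ^ p) (Ioi 0) :=
      ((Real.continuous_rpow_const (by linarith)).comp hVc).comp_continuousOn (c0 σ)
    have c3 : ∀ r ∈ Ioi (0 : ℝ), r ≠ 0 := fun r hr => ne_of_gt hr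
    have c4 : ∀ r ∈ Ioi (0 : ℝ), r ^ σ ≠ 0 := fun r hr => (hq r hr).ne'
    exact continuousOn_const.mul ((((continuousOn_const.mul (c0 _)).div continuousOn_id c3).mul
      c1).add ((c0 _).mul ((((continuousOn_const.mul c1).neg.div (c0 σ) c4).sub
        (continuousOn_const.mul c2)).mul ((continuousOn_const.mul (c0 σ)).div continuousOn_id c3))))
  have hdiv : ∀ r, 0 < r → N * b r + r * b' r = -(r ^ l * V (r ^ σ) ^ p) := fun r hr => by
    rw [hrl r hr]
    simp only [b, b']
    have h1 := (hq r hr).ne'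
    field_simp
    linear_combination (-(σ * P (r ^ σ))) * hm
  have hbound : ∀ R, ∃ C, ∀ r, 0 < r → r ≤ R →
      |b r| ≤ C * r ^ (θ - 2) ∧ |N * b r + r * b' r| ≤ C * r ^ (θ - 2) := fun R => by
    refine ⟨(σ * (1 / σ ^ 2 * κ ^ p) + κ ^ p) * R ^ σ, fun r hr hrR => ?_⟩
    have hrσ : r ^ σ ≤ R ^ σ := Real.rpow_le_rpow hr.le hrR hσ.le
    have hrθ : 0 < r ^ (θ - 2) := Real.rpow_pos_of_pos hr _
    have hRσ : 0 < R ^ σ := (hq r hr).trans_le hrσ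
    have hκp : 0 < κ ^ p := Real.rpow_pos_of_pos hκ _
    have hVr := hVpos _ (hq r hr).le
    constructor
    · simp only [b]
      rw [abs_mul, abs_mul, abs_of_pos hσ, abs_of_pos hrθ]
      calc σ * (r ^ (θ - 2) * |P (r ^ σ)|) ≤ σ * (r ^ (θ - 2) * (1 / σ ^ 2 * κ ^ p * R ^ σ)) := by
            gcongr
            exact (hPb _ (hq r hr)).trans (by gcongr)
        _ = (σ * (1 / σ ^ 2 * κ ^ p)) * R ^ σ * r ^ (θ - 2) := by ring
        _ ≤ _ := by
            gcongr
            linarith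
    · rw [hdiv r hr, hrl r hr, abs_neg, abs_of_nonneg (mul_nonneg (mul_pos hrθ (hq r hr)).le
        (Real.rpow_nonneg hVr.1.le _))]
      calc r ^ (θ - 2) * r ^ σ * V (r ^ σ) ^ p ≤ r ^ (θ - 2) * R ^ σ * κ ^ p := by
            gcongr
            · exact Real.rpow_nonneg hVr.1.le _
            · exact hVr.1.le
            · exact hVr.2
        _ = κ ^ p * R ^ σ * r ^ (θ - 2) := by ring
        _ ≤ _ := by
            gcongr
            have : 0 < σ * (1 / σ ^ 2 * κ ^ p) := by positivity
            linarith
  have hsol : IsSolution univ θ l p v := by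
    refine ⟨hvl, g, hloc, fun φ h hφ hφb => ?_⟩
    obtain ⟨i1, i2, e⟩ := hφ.integral_radial hN hθ hφb (F := id) contDiff_id rfl hb hb' hbound
    have hae : ∀ᵐ x : Euc N, id (φ x) * (N * b ‖x‖ + ‖x‖ * b' ‖x‖)
        + deriv id (φ x) * (b ‖x‖ * inner ℝ (h x) x)
        = ‖x‖ ^ θ * inner ℝ (g x) (h x) - ‖x‖ ^ l * (|v x| ^ (p - 1) * v x) * φ x := by
      filter_upwards [ae_ne_zero hN] with x hx
      have hxp : 0 < ‖x‖ := norm_pos_iff.2 hx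
      have e1 : |v x| ^ (p - 1) * v x = V (‖x‖ ^ σ) ^ p := by
        rw [abs_of_pos (hvpos x), ← Real.rpow_add_one (hvpos x).ne', sub_add_cancel]
      have e2 : ‖x‖ ^ θ = ‖x‖ ^ (θ - 2) * ‖x‖ ^ 2 := by
        rw [← Real.rpow_natCast, ← Real.rpow_add hxp]
        norm_num
      rw [hdiv _ hxp, e1, e2, deriv_id]
      simp only [g, b, real_inner_smul_left, id]
      rw [real_inner_comm (h x) x]
      field_simp
      ring
    rw [IntegrableOn, Measure.restrict_univ]
    refine ⟨(i1.add i2).congr hae, ?_⟩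
    rw [← integral_congr_ae hae, integral_add i1 i2, e]
    ring
  refine ⟨v, ⟨hsol, fun ψ h hψ hψb => ?_⟩, hv, ?_, hvpos, fun x y hxy => by simp only [v, hxy]⟩
  · obtain ⟨i1, hardy⟩ := hψ.hardy hN hθ hψb
    have i2 := hψ.1.integrable_rpow_mul_norm_sq hN
    have hle : ∀ᵐ x : Euc N, p * ‖x‖ ^ l * |v x| ^ (p - 1) * ψ x ^ 2
        ≤ (N + θ - 2) ^ 2 / 4 * (‖x‖ ^ (θ - 2) * ψ x ^ 2) := by
      filter_upwards [ae_ne_zero hN] with x hx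
      have hxp : 0 < ‖x‖ := norm_pos_iff.2 hx
      have h1 := hVb _ (hq _ hxp)
      rw [abs_of_pos (hvpos x), hrl _ hxp, ← hm]
      have h2 : ‖x‖ ^ σ * V (‖x‖ ^ σ) ^ (p - 1) ≤ σ ^ 2 * (k * (m - k)) := by
        rw [one_div, inv_mul_le_iff₀ (by positivity)] at h1
        exact h1
      -- As p k = k + 1, this is (k+1)(m-k) ≤ m²/4, which rearranges to `hcond`. The right side is
      -- the Hardy constant (N+θ-2)²/4.
      have h3 : p * (σ ^ 2 * (k * (m - k))) ≤ (m * σ) ^ 2 / 4 := by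
        have h4 : p * k = k + 1 := by linarith
        have h5 : 0 ≤ σ ^ 2 * ((m - 2 * k) ^ 2 - 4 * (m - k)) := by
          have := sub_nonneg.2 hcond
          positivity
        have h6 : p * (σ ^ 2 * (k * (m - k))) = σ ^ 2 * ((k + 1) * (m - k)) := by
          rw [← h4]
          ring
        rw [h6]
        linarith
      have h7 : 0 ≤ ‖x‖ ^ (θ - 2) * ψ x ^ 2 := by positivity
      calc p * (‖x‖ ^ (θ - 2) * ‖x‖ ^ σ) * v x ^ (p - 1) * ψ x ^ 2
          = p * (‖x‖ ^ σ * V (‖x‖ ^ σ) ^ (p - 1)) * (‖x‖ ^ (θ - 2) * ψ x ^ 2) := by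
            simp only [v]
            ring
        _ ≤ _ := mul_le_mul_of_nonneg_right
            ((mul_le_mul_of_nonneg_left h2 (by linarith)).trans h3) h7
    have i3 : Integrable fun x => p * ‖x‖ ^ l * |v x| ^ (p - 1) * ψ x ^ 2 := by
      refine (i1.const_mul ((N + θ - 2) ^ 2 / 4)).mono' ?_ ?_
      · have m1 : Measurable fun x : Euc N => p * ‖x‖ ^ l * |v x| ^ (p - 1) :=
          (measurable_const.mul (measurable_norm.pow_const l)).mul
            (hv.abs.measurable.pow_const (p - 1))
        exact m1.aestronglyMeasurable.mul (hψb.aestronglyMeasurable.pow 2)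
      · filter_upwards [hle] with x hx
        rwa [Real.norm_of_nonneg (by positivity)]
    rw [IntegrableOn, Measure.restrict_univ]
    refine ⟨i2.sub i3, ?_⟩
    rw [integral_sub i2 i3, sub_nonneg]
    refine le_trans (integral_mono_ae i3 (i1.const_mul _) hle) ?_
    rwa [integral_const_mul]
  · simp only [v, norm_zero, Real.zero_rpow hσ.ne', hV0]

/-! ### Odd powers as test functions and Farina's integral estimate -/

section OddPower

/-- The odd power `t ↦ |t|^s t`. -/
def oddPow (s t : ℝ) : ℝ := |t| ^ s * t

lemma hasDerivAt_oddPow {s : ℝ} (hs : 0 ≤ s) (t : ℝ) :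
    HasDerivAt (oddPow s) ((s + 1) * |t| ^ s) t := by
  rcases hs.eq_or_lt with rfl | hs
  · have : oddPow 0 = id := by
      ext t
      simp [oddPow]
    rw [this]
    simpa using hasDerivAt_id t
  rcases lt_trichotomy t 0 with ht | rfl | ht
  · have h1 : HasDerivAt (fun x : ℝ => -(-x) ^ (s + 1)) (-((s + 1) * (-t) ^ (s + 1 - 1) * -1)) t :=
      ((Real.hasDerivAt_rpow_const (Or.inl (by linarith))).comp t (hasDerivAt_neg t)).neg
    refine (h1.congr_deriv ?_).congr_of_eventuallyEq ?_
    · rw [abs_of_neg ht, add_sub_cancel_right]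
      ring
    · filter_upwards [Iio_mem_nhds ht] with x hx
      have hx' : x < 0 := hx
      rw [oddPow, abs_of_neg hx', Real.rpow_add_one (by linarith)]
      ring
  · rw [hasDerivAt_iff_tendsto_slope_zero, abs_zero, Real.zero_rpow hs.ne', mul_zero]
    have h1 : Tendsto (fun x : ℝ => |x| ^ s) (𝓝[≠] 0) (𝓝 0) := by
      have : Continuous fun x : ℝ => |x| ^ s :=
        (Real.continuous_rpow_const hs.le).comp continuous_abs
      have h2 := this.tendsto 0
      rw [abs_zero, Real.zero_rpow hs.ne'] at h2
      exact h2.mono_left nhdsWithin_le_nhds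
    refine h1.congr' ?_
    filter_upwards [self_mem_nhdsWithin] with x hx
    have hx0 : x ≠ 0 := hx
    simp only [oddPow, zero_add, smul_eq_mul, mul_zero, sub_zero]
    field_simp
  · have h1 : HasDerivAt (fun x : ℝ => x ^ (s + 1)) ((s + 1) * t ^ (s + 1 - 1)) t :=
      Real.hasDerivAt_rpow_const (Or.inl ht.ne')
    refine (h1.congr_deriv ?_).congr_of_eventuallyEq ?_
    · rw [abs_of_pos ht, add_sub_cancel_right]
    · filter_upwards [Ioi_mem_nhds ht] with x hx
      have hx' : 0 < x := hx
      rw [oddPow, abs_of_pos hx', Real.rpow_add_one hx'.ne']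

lemma deriv_oddPow {s : ℝ} (hs : 0 ≤ s) (t : ℝ) : deriv (oddPow s) t = (s + 1) * |t| ^ s :=
  (hasDerivAt_oddPow hs t).deriv

/-- For s ≥ 0 the odd power is C¹ even at 0, so the chain rule applies to the locally bounded,
possibly sign-changing v without truncation. -/
lemma contDiff_oddPow {s : ℝ} (hs : 0 ≤ s) : ContDiff ℝ 1 (oddPow s) := by
  rw [contDiff_one_iff_deriv]
  refine ⟨fun t => (hasDerivAt_oddPow hs t).differentiableAt, ?_⟩
  rw [funext (deriv_oddPow hs)]
  exact continuous_const.mul ((Real.continuous_rpow_const hs).comp continuous_abs)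

end OddPower

/-- I is the nonlinear integral, J the energy, C the cross term and B the cutoff term. The equation
gives the identity, stability the inequality, and Young's inequality the bound on C. Eliminating J
leaves ε I ≤ 2(s+1)s C + (2s+1)B with ε > 0 exactly by `hp`, and C is absorbed. -/
lemma integral_estimate_algebra {s p : ℝ} (hs : 0 ≤ s) (hp : (s + 1) ^ 2 < p * (2 * s + 1)) :
    ∃ C₀, 0 < C₀ ∧ ∀ I J C B : ℝ, 0 ≤ I → 0 ≤ J → 0 ≤ B → (2 * s + 1) * J + 2 * C = I →
      p * I ≤ (s + 1) ^ 2 * J + 2 * (s + 1) * C + B →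
      (∀ δ, 0 < δ → |C| ≤ δ * J + B / (4 * δ)) → I ≤ C₀ * B := by
  set ε := p * (2 * s + 1) - (s + 1) ^ 2 with hε
  have hε0 : 0 < ε := by linarith
  -- Small enough for both absorptions: δ ≤ 1/4 to remove |C| from its own bound, and 4(s+1)s δ ≤
  -- ε/2 to hide the remainder in ε I.
  set δ := ε / (4 * ε + 8 * ((s + 1) * s) + 1) with hδ
  have hden : 0 < 4 * ε + 8 * ((s + 1) * s) + 1 := by positivity
  have hδ0 : 0 < δ := by positivity
  have hδ1 : δ ≤ 1 / 4 := by
    rw [hδ, div_le_iff₀ hden]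
    nlinarith [mul_nonneg (by linarith : 0 ≤ s + 1) hs]
  have hδ2 : 4 * ((s + 1) * s) * δ ≤ ε / 2 := by
    rw [hδ, ← mul_div_assoc, div_le_iff₀ hden]
    nlinarith [mul_nonneg (by linarith : 0 ≤ s + 1) hs]
  refine ⟨2 / ε * ((s + 1) * s / δ + (2 * s + 1)), by positivity,
    fun I J C B hI hJ hB h1 h2 h3 => ?_⟩
  have hJ' : J ≤ I + 2 * |C| := by nlinarith [neg_abs_le C, mul_nonneg hs hJ]
  have hC1 : |C| ≤ 2 * δ * I + B / (2 * δ) := by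
    have e : B / (2 * δ) = 2 * (B / (4 * δ)) := by
      field_simp
      norm_num
    have h4 := h3 δ hδ0
    have h5 : δ * J ≤ δ * I + 2 * δ * |C| := by nlinarith
    have h6 : 2 * δ * |C| ≤ 1 / 2 * |C| := by nlinarith [abs_nonneg C]
    linarith
  have h7 : ε * I ≤ 2 * ((s + 1) * s) * C + (2 * s + 1) * B := by
    have h8 := mul_le_mul_of_nonneg_left h2 (by linarith : 0 ≤ 2 * s + 1)
    have h9 : (2 * s + 1) * ((s + 1) ^ 2 * J + 2 * (s + 1) * C + B)
        = (s + 1) ^ 2 * I + 2 * ((s + 1) * s) * C + (2 * s + 1) * B := by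
      rw [← h1]
      ring
    rw [h9] at h8
    rw [hε]
    linarith
  have hss : 0 ≤ (s + 1) * s := by positivity
  have h10 : 2 * ((s + 1) * s) * C ≤ 2 * ((s + 1) * s) * (2 * δ * I + B / (2 * δ)) :=
    mul_le_mul_of_nonneg_left ((le_abs_self C).trans hC1) (by linarith)
  have h11 : 2 * ((s + 1) * s) * (2 * δ * I + B / (2 * δ))
      = 4 * ((s + 1) * s) * δ * I + (s + 1) * s / δ * B := by
    field_simp
    ring
  have h12 : 4 * ((s + 1) * s) * δ * I ≤ ε / 2 * I := mul_le_mul_of_nonneg_right hδ2 hI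
  have h13 : ε / 2 * I ≤ ((s + 1) * s / δ + (2 * s + 1)) * B := by linarith
  calc I = 2 / ε * (ε / 2 * I) := by field_simp
    _ ≤ 2 / ε * (((s + 1) * s / δ + (2 * s + 1)) * B) :=
        mul_le_mul_of_nonneg_left h13 (by positivity)
    _ = _ := by ring

lemma oddPow_sq {s : ℝ} (hs : 0 ≤ s) (t : ℝ) : oddPow s t ^ 2 = |t| ^ (2 * s + 2) := by
  rcases eq_or_ne t 0 with rfl | ht
  · simp [oddPow, Real.zero_rpow (by linarith : 2 * s + 2 ≠ 0)]
  · have h : 0 < |t| := abs_pos.2 ht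
    rw [oddPow, mul_pow, ← sq_abs t, Real.rpow_add h, mul_comm 2 s, Real.rpow_mul h.le]
    norm_num

lemma rpow_two_mul_abs {s : ℝ} (t : ℝ) : |t| ^ (2 * s) = (|t| ^ s) ^ 2 := by
  rw [mul_comm, Real.rpow_mul (abs_nonneg t)]
  norm_num

/-- The integral estimate for stable solutions: the powers `|v|^{p+γ}`, `γ = 2 s + 1`, are controlled
by `|v|^{γ+1}` on the region where the cutoff varies. -/
lemma IsStableSolution.integral_estimate {θ l p s : ℝ} (hN : 1 ≤ N) (hθ : -(N : ℝ) < θ)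
    (hs : 0 ≤ s) (hp : (s + 1) ^ 2 < p * (2 * s + 1)) :
    ∃ C₀, 0 < C₀ ∧ ∀ v : Euc N → ℝ, IsStableSolution univ θ l p v →
      ∀ φ : Euc N → ℝ, ContDiff ℝ ∞ φ → HasCompactSupport φ →
        Integrable (fun x => ‖x‖ ^ l * (|v x| ^ (p - 1) * |v x| ^ (2 * s + 2)) * φ x ^ 2) ∧
        Integrable (fun x => ‖x‖ ^ θ * |v x| ^ (2 * s + 2) * ‖gradient φ x‖ ^ 2) ∧
        ∫ x, ‖x‖ ^ l * (|v x| ^ (p - 1) * |v x| ^ (2 * s + 2)) * φ x ^ 2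
          ≤ C₀ * ∫ x, ‖x‖ ^ θ * |v x| ^ (2 * s + 2) * ‖gradient φ x‖ ^ 2 := by
  obtain ⟨C₀, hC₀, halg⟩ := integral_estimate_algebra hs hp
  refine ⟨C₀, hC₀, ?_⟩
  rintro v ⟨⟨hvb, g, hg, hsol⟩, hstab⟩ φ hφ hφc
  have hφ1 : ContDiff ℝ 1 φ := hφ.of_le (by simp)
  have hK : IsCompact (tsupport φ) := hφc
  have hs2 : 0 ≤ 2 * s := by linarith
  let w : Euc N → ℝ := fun x => |v x| ^ s
  let fi : Euc N → ℝ := fun x => ‖x‖ ^ l * (|v x| ^ (p - 1) * |v x| ^ (2 * s + 2)) * φ x ^ 2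
  let fb : Euc N → ℝ := fun x => ‖x‖ ^ θ * |v x| ^ (2 * s + 2) * ‖gradient φ x‖ ^ 2
  let fj : Euc N → ℝ := fun x => ‖x‖ ^ θ * (w x ^ 2 * φ x ^ 2 * ‖g x‖ ^ 2)
  let fc : Euc N → ℝ := fun x => ‖x‖ ^ θ * (w x ^ 2 * v x * φ x * inner ℝ (g x) (gradient φ x))
  have hgm : ∀ {K : Set (Euc N)}, IsCompact K →
      AEStronglyMeasurable (fun x => ‖x‖ ^ (θ / 2) • g x) (volume.restrict K) :=
    fun hK => (hg.memLp_grad _ hK (subset_univ _)).1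
  -- The two test functions: |v|^{2s} v φ² for the equation and |v|^s v φ for stability.
  have hT1 := hg.memH1c_comp_mul hN hθ hvb (contDiff_oddPow hs2) (hφ.pow 2)
    (hφc.mono fun x hx hx0 => hx (by simp [hx0]))
  have hT2 := hg.memH1c_comp_mul hN hθ hvb (contDiff_oddPow hs) hφ hφc
  obtain ⟨i1, e1⟩ := hsol _ _ hT1 ((hvb.comp (contDiff_oddPow hs2).continuous).mul
    (memLinftyLoc_of_continuous (hφ.continuous.pow 2)))
  obtain ⟨i2, e2⟩ := hstab _ _ hT2 ((hvb.comp (contDiff_oddPow hs).continuous).mul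
    (memLinftyLoc_of_continuous hφ.continuous))
  rw [IntegrableOn, Measure.restrict_univ] at i1 i2
  rw [Measure.restrict_univ] at e1 e2
  have hgrad2 : ∀ x, gradient (fun x => φ x ^ 2) x = (2 * φ x) • gradient φ x := fun x => by
    refine ext_inner_right ℝ fun y => ?_
    rw [inner_gradient_eq, real_inner_smul_left, inner_gradient_eq]
    have := ((hφ1.differentiable (by simp) x).hasFDerivAt.pow 2).fderiv
    rw [this]
    simp
  have p1 : ∀ x, ‖x‖ ^ θ * inner ℝ (g x) ((deriv (oddPow (2 * s)) (v x) * φ x ^ 2) • g x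
      + oddPow (2 * s) (v x) • gradient (fun x => φ x ^ 2) x)
      - ‖x‖ ^ l * (|v x| ^ (p - 1) * v x) * (oddPow (2 * s) (v x) * φ x ^ 2)
      = (2 * s + 1) * fj x + 2 * fc x - fi x := fun x => by
    rw [hgrad2, deriv_oddPow hs2]
    simp only [fj, fc, fi, w, inner_add_right, real_inner_smul_right, real_inner_self_eq_norm_sq,
      ← oddPow_sq hs]
    simp only [oddPow, rpow_two_mul_abs]
    ring
  have p2 : ∀ x, ‖x‖ ^ θ * ‖(deriv (oddPow s) (v x) * φ x) • g x
      + oddPow s (v x) • gradient φ x‖ ^ 2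
      - p * ‖x‖ ^ l * |v x| ^ (p - 1) * (oddPow s (v x) * φ x) ^ 2
      = (s + 1) ^ 2 * fj x + 2 * (s + 1) * fc x + fb x - p * fi x := fun x => by
    rw [deriv_oddPow hs, norm_add_sq_real]
    simp only [fj, fc, fi, fb, w, real_inner_smul_left, real_inner_smul_right, norm_smul,
      ← oddPow_sq hs, mul_pow, Real.norm_eq_abs, sq_abs]
    simp only [oddPow]
    ring
  simp only [p1] at i1 e1
  simp only [p2] at i2 e2
  have jb : Integrable fb := by
    have h1 : LocallyIntegrable fun x : Euc N => ‖x‖ ^ θ := locallyIntegrable_norm_rpow hN hθ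
    have h2 : MemLinftyLoc univ fun x => |v x| ^ (2 * s + 2) :=
      hvb.comp (F := fun t => |t| ^ (2 * s + 2))
        ((Real.continuous_rpow_const (by linarith)).comp continuous_abs)
    obtain ⟨M, hM0, hM⟩ := h2.exists_bound hK
    have h3 : IntegrableOn (fun x => ‖x‖ ^ θ * |v x| ^ (2 * s + 2)) (tsupport φ) :=
      (h1.integrableOn_isCompact hK).mul_bdd h2.aestronglyMeasurable.restrict hM
    have hgc : Continuous fun x => ‖gradient φ x‖ ^ 2 := (continuous_gradient hφ1).norm.pow 2
    have hgs : tsupport (fun x => ‖gradient φ x‖ ^ 2) ⊆ tsupport φ := by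
      refine closure_minimal (fun x hx => ?_) (isClosed_tsupport _)
      by_contra h
      refine hx ?_
      simp [gradient, fderiv_eq_zero_of_notMem_tsupport h]
    have h4 := integrable_mul_of_continuous_of_hasCompactSupport hgc
      (hK.of_isClosed_subset (isClosed_tsupport _) hgs) (h3.mono_set hgs)
    simpa only [fb, mul_comm] using h4
  have jj : Integrable fj := by
    have h1 : IntegrableOn (fun x => ‖‖x‖ ^ (θ / 2) • g x‖ ^ 2) (tsupport φ) :=
      (memLp_two_iff_integrable_sq_norm (hgm hK)).1 (hg.memLp_grad _ hK (subset_univ _))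
    have h2 : MemLinftyLoc univ fun x => w x ^ 2 :=
      hvb.comp (F := fun t => (|t| ^ s) ^ 2)
        (((Real.continuous_rpow_const hs).comp continuous_abs).pow 2)
    obtain ⟨M, hM0, hM⟩ := h2.exists_bound hK
    have h3 : IntegrableOn (fun x => ‖‖x‖ ^ (θ / 2) • g x‖ ^ 2 * w x ^ 2) (tsupport φ) :=
      h1.mul_bdd h2.aestronglyMeasurable.restrict hM
    have hts : tsupport (fun x => φ x ^ 2) ⊆ tsupport φ :=
      closure_mono fun x hx hx0 => hx (by simp [hx0])
    have h4 := integrable_mul_of_continuous_of_hasCompactSupport (hφ.continuous.pow 2)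
      (hK.of_isClosed_subset (isClosed_tsupport _) hts) (h3.mono_set hts)
    refine h4.congr (Eventually.of_forall fun x => ?_)
    simp only [fj, Pi.pow_apply]
    rw [norm_smul, mul_pow, Real.norm_of_nonneg (by positivity), ← Real.rpow_natCast
      (‖x‖ ^ (θ / 2)), ← Real.rpow_mul (norm_nonneg _)]
    norm_num
    ring
  have young : ∀ δ, 0 < δ → ∀ x, |fc x| ≤ δ * fj x + 1 / (4 * δ) * fb x := fun δ hδ x => by
    have h1 : |inner ℝ (g x) (gradient φ x)| ≤ ‖g x‖ * ‖gradient φ x‖ :=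
      abs_real_inner_le_norm _ _
    have hr : 0 ≤ ‖x‖ ^ θ := by positivity
    have hw : 0 ≤ w x := Real.rpow_nonneg (abs_nonneg _) _
    simp only [fc, fj, fb, ← oddPow_sq hs]
    rw [abs_mul, abs_of_nonneg hr, abs_mul, abs_mul, abs_mul, abs_of_nonneg (sq_nonneg (w x))]
    have e : oddPow s (v x) = w x * v x := rfl
    rw [e]
    have h2 : w x ^ 2 * |v x| * |φ x| * |inner ℝ (g x) (gradient φ x)|
        ≤ w x ^ 2 * |v x| * |φ x| * (‖g x‖ * ‖gradient φ x‖) := by gcongr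
    have h3 : w x ^ 2 * |v x| * |φ x| * (‖g x‖ * ‖gradient φ x‖)
        ≤ δ * (w x ^ 2 * φ x ^ 2 * ‖g x‖ ^ 2)
          + 1 / (4 * δ) * ((w x * v x) ^ 2 * ‖gradient φ x‖ ^ 2) := by
      have h5 : 0 ≤ (2 * δ * (w x * |φ x| * ‖g x‖) - w x * |v x| * ‖gradient φ x‖) ^ 2 / (4 * δ) :=
        by positivity
      have h6 : (2 * δ * (w x * |φ x| * ‖g x‖) - w x * |v x| * ‖gradient φ x‖) ^ 2 / (4 * δ)
          = δ * (w x ^ 2 * |φ x| ^ 2 * ‖g x‖ ^ 2)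
          + 1 / (4 * δ) * ((w x * |v x|) ^ 2 * ‖gradient φ x‖ ^ 2)
          - w x ^ 2 * |v x| * |φ x| * (‖g x‖ * ‖gradient φ x‖) := by
        field_simp
        ring
      have h7 : (w x * v x) ^ 2 = (w x * |v x|) ^ 2 := by rw [mul_pow, mul_pow, sq_abs]
      rw [h7, ← sq_abs (φ x)]
      linarith
    calc _ ≤ ‖x‖ ^ θ * (δ * (w x ^ 2 * φ x ^ 2 * ‖g x‖ ^ 2)
          + 1 / (4 * δ) * ((w x * v x) ^ 2 * ‖gradient φ x‖ ^ 2)) :=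
          mul_le_mul_of_nonneg_left (h2.trans h3) hr
      _ = _ := by ring
  have jc : Integrable fc := by
    -- The weak form's integrand is (2s+1) `fj` + 2 `fc` - `fi`; solving for `fc` gives its
    -- measurability.
    have hm : AEStronglyMeasurable fc volume := by
      have h1 := i1.1
      have h3 : AEStronglyMeasurable fi volume := by
        have m1 : AEStronglyMeasurable (fun x => |v x|) volume :=
          continuous_abs.comp_aestronglyMeasurable hvb.aestronglyMeasurable
        have m2 : ∀ a : ℝ, AEStronglyMeasurable (fun x => |v x| ^ a) volume := fun a =>
          (m1.aemeasurable.pow_const a).aestronglyMeasurable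
        exact ((measurable_norm.pow_const l).aestronglyMeasurable.mul ((m2 _).mul (m2 _))).mul
          (hφ.continuous.pow 2).aestronglyMeasurable
      have h4 := ((h1.add h3).sub (jj.1.const_mul (2 * s + 1))).const_mul (1 / 2)
      refine h4.congr (Eventually.of_forall fun x => ?_)
      simp only [Pi.add_apply, Pi.sub_apply]
      ring
    refine ((jj.const_mul 1).add (jb.const_mul (1 / (4 * 1)))).mono' hm
      (Eventually.of_forall fun x => young 1 one_pos x)
  have ji : Integrable fi := by
    refine (((jj.const_mul (2 * s + 1)).add (jc.const_mul 2)).sub i1).congr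
      (Eventually.of_forall fun x => ?_)
    simp only [Pi.add_apply, Pi.sub_apply]
    ring
  refine ⟨ji, jb, ?_⟩
  have nn : ∀ x, 0 ≤ fi x := fun x => by positivity
  refine halg (∫ x, fi x) (∫ x, fj x) (∫ x, fc x) (∫ x, fb x) (integral_nonneg nn)
    (integral_nonneg fun x => by positivity) (integral_nonneg fun x => by positivity) ?_ ?_ ?_
  · have h1 : ∫ x, ((2 * s + 1) * fj x + 2 * fc x - fi x)
        = (2 * s + 1) * (∫ x, fj x) + 2 * (∫ x, fc x) - ∫ x, fi x := by
      have k1 := integral_sub ((jj.const_mul (2 * s + 1)).add (jc.const_mul 2)) ji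
      have k2 := integral_add (jj.const_mul (2 * s + 1)) (jc.const_mul 2)
      simp only [Pi.add_apply, integral_const_mul] at k1 k2
      rw [k1, k2]
    linarith
  · have h1 : ∫ x, ((s + 1) ^ 2 * fj x + 2 * (s + 1) * fc x + fb x - p * fi x)
        = (s + 1) ^ 2 * (∫ x, fj x) + 2 * (s + 1) * (∫ x, fc x) + (∫ x, fb x)
          - p * ∫ x, fi x := by
      have k1 := integral_sub (((jj.const_mul ((s + 1) ^ 2)).add
        (jc.const_mul (2 * (s + 1)))).add jb) (ji.const_mul p)
      have k2 := integral_add ((jj.const_mul ((s + 1) ^ 2)).add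
        (jc.const_mul (2 * (s + 1)))) jb
      have k3 := integral_add (jj.const_mul ((s + 1) ^ 2)) (jc.const_mul (2 * (s + 1)))
      simp only [Pi.add_apply, integral_const_mul] at k1 k2 k3
      rw [k1, k2, k3]
    linarith
  · intro δ hδ
    calc |∫ x, fc x| ≤ ∫ x, |fc x| := abs_integral_le_integral_abs
      _ ≤ ∫ x, (δ * fj x + 1 / (4 * δ) * fb x) :=
          integral_mono jc.abs ((jj.const_mul δ).add (jb.const_mul _)) (young δ hδ)
      _ = δ * (∫ x, fj x) + 1 / (4 * δ) * ∫ x, fb x := by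
          rw [integral_add (jj.const_mul δ) (jb.const_mul _), integral_const_mul,
            integral_const_mul]
      _ = _ := by ring

/-! ### Cutoffs, scaling and the Liouville theorem -/

lemma rpow_le_of_mem_Icc {R r : ℝ} (hR : 0 < R) (h1 : R ≤ r) (h2 : r ≤ 2 * R) (a : ℝ) :
    r ^ a ≤ 2 ^ |a| * R ^ a := by
  have ht1 : 1 ≤ r / R := (one_le_div hR).2 h1
  have ht2 : r / R ≤ 2 := (div_le_iff₀ hR).2 h2
  have e : r ^ a = (r / R) ^ a * R ^ a := by
    rw [← Real.mul_rpow (by linarith) hR.le, div_mul_cancel₀ _ hR.ne']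
  rw [e]
  refine mul_le_mul_of_nonneg_right ?_ (Real.rpow_nonneg hR.le _)
  calc (r / R) ^ a ≤ (r / R) ^ |a| := Real.rpow_le_rpow_of_exponent_le ht1 (le_abs_self a)
    _ ≤ 2 ^ |a| := Real.rpow_le_rpow (by linarith) ht2 (abs_nonneg a)

/-- This is the upper bound for the exponent -a. The absolute value in the constant covers both
signs, so |x|^θ and |x|^l can be frozen at R on the annulus. -/
lemma le_rpow_of_mem_Icc {R r : ℝ} (hR : 0 < R) (h1 : R ≤ r) (h2 : r ≤ 2 * R) (a : ℝ) :
    (2 ^ |a|)⁻¹ * R ^ a ≤ r ^ a := by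
  have h := rpow_le_of_mem_Icc hR h1 h2 (-a)
  have hr : 0 < r := hR.trans_le h1
  rw [Real.rpow_neg hr.le, Real.rpow_neg hR.le, abs_neg] at h
  have hra : 0 < r ^ a := Real.rpow_pos_of_pos hr a
  have hRa : 0 < R ^ a := Real.rpow_pos_of_pos hR a
  have h2a : (0 : ℝ) < 2 ^ |a| := Real.rpow_pos_of_pos two_pos _
  rw [inv_mul_le_iff₀ h2a]
  rw [← div_eq_mul_inv, le_div_iff₀ hRa, inv_mul_le_iff₀ hra] at h
  linarith

/-- A Young type inequality absorbing `y^e` into `y^{q+e}`, with powers of a cutoff `χ`. -/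
lemma mul_rpow_le_half_add {Λ μ y χ e q : ℝ} (hΛ : 0 < Λ) (hμ : 0 < μ) (hy : 0 ≤ y) (hχ0 : 0 ≤ χ)
    (hχ1 : χ ≤ 1) (he : 0 < e) (hq : 0 < q) {n : ℕ} (hn : e / q ≤ n) :
    Λ * (y ^ e * χ ^ (2 * n)) ≤ 1 / 2 * (μ * (y ^ q * y ^ e) * χ ^ (2 * n + 2))
      + Λ * (2 * Λ / μ) ^ (e / q) := by
  have hye : 0 ≤ y ^ e := Real.rpow_nonneg hy _
  have hyq : 0 ≤ y ^ q := Real.rpow_nonneg hy _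
  have hrest : 0 ≤ Λ * (2 * Λ / μ) ^ (e / q) := by positivity
  have hfirst : 0 ≤ 1 / 2 * (μ * (y ^ q * y ^ e) * χ ^ (2 * n + 2)) := by positivity
  -- Either y^q χ² is large and half of the main term already dominates, or it is small and its
  -- power e/q bounds y^e χ^{2e/q}. The choice n ≥ e/q together with χ ≤ 1 compares this with
  -- χ^{2n}.
  rcases le_or_gt (2 * Λ) (μ * (y ^ q * χ ^ 2)) with h | h
  · have h1 : Λ * (y ^ e * χ ^ (2 * n)) ≤ 1 / 2 * (μ * (y ^ q * χ ^ 2)) * (y ^ e * χ ^ (2 * n)) :=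
      mul_le_mul_of_nonneg_right (by linarith) (by positivity)
    have h2 : 1 / 2 * (μ * (y ^ q * χ ^ 2)) * (y ^ e * χ ^ (2 * n))
        = 1 / 2 * (μ * (y ^ q * y ^ e) * χ ^ (2 * n + 2)) := by ring
    linarith
  · have hlt : y ^ q * χ ^ 2 ≤ 2 * Λ / μ := by
      rw [le_div_iff₀ hμ]
      linarith
    have h1 := Real.rpow_le_rpow (by positivity) hlt (show 0 ≤ e / q by positivity)
    have h2 : (y ^ q * χ ^ 2) ^ (e / q) = y ^ e * χ ^ (2 * (e / q)) := by
      rw [Real.mul_rpow hyq (sq_nonneg _), ← Real.rpow_mul hy, ← Real.rpow_natCast χ 2,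
        ← Real.rpow_mul hχ0]
      congr 2
      field_simp
    have h3 : χ ^ (2 * n) ≤ χ ^ (2 * (e / q)) := by
      have hpos : 0 < 2 * (e / q) := by positivity
      have hle : 2 * (e / q) ≤ ((2 * n : ℕ) : ℝ) := by
        push_cast
        linarith
      rw [← Real.rpow_natCast]
      rcases hχ0.eq_or_lt with rfl | hχ
      · rw [Real.zero_rpow hpos.ne', Real.zero_rpow (by linarith)]
      · exact Real.rpow_le_rpow_of_exponent_ge hχ hχ1 hle
    have h4 : Λ * (y ^ e * χ ^ (2 * n)) ≤ Λ * (2 * Λ / μ) ^ (e / q) := by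
      refine mul_le_mul_of_nonneg_left ?_ hΛ.le
      exact (mul_le_mul_of_nonneg_left h3 hye).trans (h2 ▸ h1)
    linarith

/-- A smooth cutoff equal to one on the ball of radius `R` and vanishing outside the ball of
radius `√2 R`. -/
def ballCutoff (R : ℝ) (x : Euc N) : ℝ := Real.smoothTransition (2 - ‖x‖ ^ 2 / R ^ 2)

lemma ballCutoff_contDiff (R : ℝ) : ContDiff ℝ ∞ (ballCutoff (N := N) R) :=
  Real.smoothTransition.contDiff.comp
    (contDiff_const.sub ((contDiff_norm_sq ℝ).div_const _))

lemma ballCutoff_eq_one {R : ℝ} (hR : 0 < R) {x : Euc N} (hx : ‖x‖ ≤ R) : ballCutoff R x = 1 := by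
  refine Real.smoothTransition.one_of_one_le ?_
  have : ‖x‖ ^ 2 / R ^ 2 ≤ 1 := by
    rw [div_le_one (by positivity)]
    gcongr
  linarith

lemma ballCutoff_eq_zero {R : ℝ} (hR : 0 < R) {x : Euc N} (hx : 2 * R ≤ ‖x‖) :
    ballCutoff R x = 0 := by
  refine Real.smoothTransition.zero_of_nonpos ?_
  have : 4 ≤ ‖x‖ ^ 2 / R ^ 2 := by
    rw [le_div_iff₀ (by positivity)]
    nlinarith
  linarith

lemma ballCutoff_hasCompactSupport {R : ℝ} (hR : 0 < R) :
    HasCompactSupport (ballCutoff (N := N) R) :=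
  HasCompactSupport.of_support_subset_isCompact (isCompact_closedBall 0 (2 * R)) fun x hx => by
    rw [mem_closedBall_zero_iff]
    by_contra h
    exact hx (ballCutoff_eq_zero hR (not_le.1 h).le)

/-- Differentiating the power n + 1 leaves a factor χ^{2n} after squaring, which the Young
inequality requires. The constant 16 is the square of 4 in 2|x|/R² ≤ 4/R. -/
lemma norm_gradient_ballCutoff_pow_sq_le {D : ℝ} (hD : ∀ x, |deriv Real.smoothTransition x| ≤ D)
    {R : ℝ} (hR : 0 < R) (n : ℕ) (x : Euc N) :
    ‖gradient (fun x => ballCutoff R x ^ (n + 1)) x‖ ^ 2 ≤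
      (if R ≤ ‖x‖ ∧ ‖x‖ ≤ 2 * R then 1 else 0) *
        (16 * (n + 1) ^ 2 * D ^ 2 / R ^ 2 * ballCutoff R x ^ (2 * n)) := by
  have hD0 : 0 ≤ D := (abs_nonneg _).trans (hD 0)
  set S' := deriv Real.smoothTransition (2 - ‖x‖ ^ 2 / R ^ 2) with hS'
  have h1 : HasFDerivAt (fun x : Euc N => 2 - ‖x‖ ^ 2 / R ^ 2)
      (-((R ^ 2)⁻¹ • ((2 : ℕ) • innerSL ℝ x))) x := by
    have h := ((hasStrictFDerivAt_norm_sq x).hasFDerivAt.const_mul (R ^ 2)⁻¹).const_sub 2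
    simpa only [div_eq_inv_mul] using h
  have h2 : HasFDerivAt (ballCutoff (N := N) R) (S' • -((R ^ 2)⁻¹ • ((2 : ℕ) • innerSL ℝ x))) x :=
    (hasDerivAt_smoothTransition _).comp_hasFDerivAt x h1
  have h3 := (h2.pow (n + 1)).fderiv
  have h4 : ‖gradient (fun x => ballCutoff R x ^ (n + 1)) x‖
      = (n + 1) * ballCutoff R x ^ n * (|S'| * (2 * ‖x‖ / R ^ 2)) := by
    rw [norm_gradient_eq]
    have hc : 0 ≤ ballCutoff R x := Real.smoothTransition.nonneg _
    have h5 : fderiv ℝ (fun x => ballCutoff R x ^ (n + 1)) x = _ := h3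
    have h6 : ‖(2 : ℕ) • innerSL ℝ x‖ = 2 * ‖x‖ := by
      rw [← Nat.cast_smul_eq_nsmul ℝ, norm_smul, innerSL_apply_norm]
      simp
    rw [h5, nsmul_eq_mul, norm_smul, norm_smul, norm_neg, norm_smul, h6]
    simp only [norm_mul, norm_pow, Real.norm_eq_abs, norm_inv, add_tsub_cancel_right,
      abs_of_nonneg hc, abs_of_pos hR]
    rw [Nat.abs_cast]
    push_cast
    ring
  rw [h4]
  split_ifs with hx
  · have h5 : |S'| * (2 * ‖x‖ / R ^ 2) ≤ D * (4 / R) := by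
      refine mul_le_mul (hD _) ?_ (by positivity) hD0
      rw [div_le_div_iff₀ (by positivity) hR]
      nlinarith [hx.2]
    calc ((n + 1) * ballCutoff R x ^ n * (|S'| * (2 * ‖x‖ / R ^ 2))) ^ 2
        ≤ ((n + 1) * ballCutoff R x ^ n * (D * (4 / R))) ^ 2 := by
          have hc : 0 ≤ ballCutoff R x := Real.smoothTransition.nonneg _
          gcongr
      _ = _ := by
          field_simp
          ring
  · have h5 : S' = 0 := by
      rcases lt_or_ge ‖x‖ R with h | h
      · refine deriv_smoothTransition_of_one_lt ?_
        have : ‖x‖ ^ 2 / R ^ 2 < 1 := by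
          rw [div_lt_one (by positivity)]
          gcongr
        linarith
      · have h' : 2 * R < ‖x‖ := by
          by_contra h'
          exact hx ⟨h, not_lt.1 h'⟩
        refine deriv_smoothTransition_of_neg ?_
        have : 4 ≤ ‖x‖ ^ 2 / R ^ 2 := by
          rw [le_div_iff₀ (by positivity)]
          nlinarith
        linarith
    simp [h5]

/-- Stable solutions vanish as soon as some exponent `e = γ + 1 = 2 s + 2` is admissible in the
integral estimate and large enough for the scaling. -/
theorem IsStableSolution.ae_eq_zero {θ l p s : ℝ} (hN : 1 ≤ N) (hθ : -(N : ℝ) < θ) (hp1 : 1 < p)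
    (hs : 0 ≤ s) (hp : (s + 1) ^ 2 < p * (2 * s + 1))
    (hscale : (N + θ - 2) * (p - 1) < (2 + l - θ) * (2 * s + 2)) {v : Euc N → ℝ}
    (hv : IsStableSolution univ θ l p v) : v =ᵐ[volume] 0 := by
  obtain ⟨C₀, hC₀, hest⟩ := IsStableSolution.integral_estimate (N := N) (l := l) hN hθ hs hp
  obtain ⟨D, hD0, hD⟩ := exists_bound_deriv_smoothTransition
  set e := 2 * s + 2 with he
  set q := p - 1 with hq
  have he0 : 0 < e := by linarith
  have hq0 : 0 < q := by linarith
  obtain ⟨n, hn⟩ := exists_nat_ge (e / q)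
  -- The bound D is replaced by D + 1 so that the constant is strictly positive.
  set A₁ := C₀ * (16 * ((n : ℝ) + 1) ^ 2 * (D + 1) ^ 2) * 2 ^ |θ| with hA₁
  set A₂ := ((2 : ℝ) ^ |l|)⁻¹ with hA₂
  have hA₁0 : 0 < A₁ := by positivity
  have hA₂0 : 0 < A₂ := by positivity
  set ϖ := (volume : Measure (Euc N)).real (Metric.closedBall 0 1) with hϖ
  -- The scaling exponent of the Young remainder: R^N from the volume, R^{θ-2} from the cutoff, and
  -- the rest from the ratio of the weights to the power e/q.
  set E := (N : ℝ) + (θ - 2) + (θ - 2 - l) * (e / q) with hE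
  have hE0 : E < 0 := by
    have h1 : E * q < 0 := by
      have : E * q = (N + θ - 2) * q - (2 + l - θ) * e := by
        rw [hE]
        field_simp
        ring
      linarith
    by_contra h
    exact absurd h1 (not_lt.2 (mul_nonneg (not_lt.1 h) hq0.le))
  -- The leading 2 comes from absorbing half of the integral on the left.
  set A₃ := 2 * (2 ^ N * ϖ * (A₁ * (2 * A₁ / A₂) ^ (e / q))) with hA₃
  let F : Euc N → ℝ := fun x => ‖x‖ ^ l * (|v x| ^ q * |v x| ^ e)
  have hF0 : ∀ x, 0 ≤ F x := fun x => by positivity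
  have main : ∀ R : ℝ, 0 < R → IntegrableOn F (Metric.closedBall 0 R) ∧
      ∀ R', R ≤ R' → ∫ x in Metric.closedBall 0 R, F x ≤ A₃ * R' ^ E := by
    have step : ∀ R : ℝ, 0 < R → Integrable (fun x => F x * (ballCutoff R x ^ (n + 1)) ^ 2) ∧
        ∫ x, F x * (ballCutoff R x ^ (n + 1)) ^ 2 ≤ A₃ * R ^ E := fun R hR => by
      have hcs : HasCompactSupport fun x : Euc N => ballCutoff R x ^ (n + 1) :=
        (ballCutoff_hasCompactSupport hR).mono fun x hx hx0 => hx (by simp [hx0])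
      obtain ⟨i1, i2, hle⟩ := hest v hv (fun x => ballCutoff R x ^ (n + 1))
        ((ballCutoff_contDiff R).pow _) hcs
      refine ⟨i1, ?_⟩
      set Λ := A₁ * R ^ (θ - 2) with hΛ
      set μ := A₂ * R ^ l with hμ
      have hΛ0 : 0 < Λ := mul_pos hA₁0 (Real.rpow_pos_of_pos hR _)
      have hμ0 : 0 < μ := mul_pos hA₂0 (Real.rpow_pos_of_pos hR _)
      set T := Λ * (2 * Λ / μ) ^ (e / q) with hT
      have hT0 : 0 ≤ T := by positivity
      have hpt : ∀ x : Euc N,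
          C₀ * (‖x‖ ^ θ * |v x| ^ e * ‖gradient (fun x => ballCutoff R x ^ (n + 1)) x‖ ^ 2)
          ≤ 1 / 2 * (F x * (ballCutoff R x ^ (n + 1)) ^ 2)
            + (Metric.closedBall (0 : Euc N) (2 * R)).indicator (fun _ => T) x := fun x => by
        have hg := norm_gradient_ballCutoff_pow_sq_le (D := D + 1)
          (fun x => (hD x).trans (by linarith)) hR n x
        have hc0 : 0 ≤ ballCutoff R x := Real.smoothTransition.nonneg _
        have hc1 : ballCutoff R x ≤ 1 := Real.smoothTransition.le_one _
        have hpos : 0 ≤ 1 / 2 * (F x * (ballCutoff R x ^ (n + 1)) ^ 2) := by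
          have := hF0 x
          positivity
        have hind : 0 ≤ (Metric.closedBall (0 : Euc N) (2 * R)).indicator (fun _ => T) x :=
          indicator_nonneg (fun _ _ => hT0) x
        split_ifs at hg with hx
        · rw [one_mul] at hg
          rw [indicator_of_mem (mem_closedBall_zero_iff.2 hx.2)]
          have hr1 := rpow_le_of_mem_Icc hR hx.1 hx.2 θ
          have hr2 := le_rpow_of_mem_Icc hR hx.1 hx.2 l
          have hRθ : R ^ (θ - 2) = R ^ θ / R ^ 2 := by
            rw [Real.rpow_sub hR]
            norm_num
          have hv0 : 0 ≤ |v x| ^ e := by positivity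
          calc C₀ * (‖x‖ ^ θ * |v x| ^ e * ‖gradient (fun x => ballCutoff R x ^ (n + 1)) x‖ ^ 2)
              ≤ C₀ * ((2 ^ |θ| * R ^ θ) * |v x| ^ e *
                (16 * (n + 1) ^ 2 * (D + 1) ^ 2 / R ^ 2 * ballCutoff R x ^ (2 * n))) := by
                gcongr
            _ = Λ * (|v x| ^ e * ballCutoff R x ^ (2 * n)) := by
                rw [hΛ, hA₁, hRθ]
                ring
            _ ≤ 1 / 2 * (μ * (|v x| ^ q * |v x| ^ e) * ballCutoff R x ^ (2 * n + 2)) + T :=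
                mul_rpow_le_half_add hΛ0 hμ0 (abs_nonneg _) hc0 hc1 he0 hq0 hn
            _ ≤ 1 / 2 * (‖x‖ ^ l * (|v x| ^ q * |v x| ^ e) * ballCutoff R x ^ (2 * n + 2)) + T := by
                gcongr
            _ = _ := by
                simp only [F]
                ring
        · rw [zero_mul] at hg
          have hg0 := le_antisymm hg (sq_nonneg _)
          rw [hg0, mul_zero, mul_zero]
          exact add_nonneg hpos hind
      have i3 : Integrable ((Metric.closedBall (0 : Euc N) (2 * R)).indicator fun _ => T) :=
        (integrableOn_const (measure_closedBall_lt_top.ne)).integrable_indicator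
          measurableSet_closedBall
      have hint := integral_mono (i2.const_mul C₀) ((i1.const_mul (1 / 2)).add i3) hpt
      have hadd := integral_add (i1.const_mul (1 / 2)) i3
      rw [integral_const_mul] at hint
      have hI3 : ∫ x, (Metric.closedBall (0 : Euc N) (2 * R)).indicator (fun _ => T) x
          = (2 * R) ^ N * ϖ * T := by
        rw [integral_indicator measurableSet_closedBall, setIntegral_const, smul_eq_mul,
          Measure.addHaar_real_closedBall' volume (0 : Euc N) (by positivity : 0 ≤ 2 * R)]
        simp [hϖ]
      have hI : ∫ x, F x * (ballCutoff R x ^ (n + 1)) ^ 2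
          ≤ 1 / 2 * (∫ x, F x * (ballCutoff R x ^ (n + 1)) ^ 2) + (2 * R) ^ N * ϖ * T := by
        rw [← hI3, ← integral_const_mul]
        exact (hle.trans hint).trans_eq hadd
      have hTE : (2 * R) ^ N * ϖ * T
          = 2 ^ N * ϖ * (A₁ * (2 * A₁ / A₂) ^ (e / q)) * R ^ E := by
        have h1 : 2 * Λ / μ = (2 * A₁ / A₂) * R ^ (θ - 2 - l) := by
          rw [hΛ, hμ, Real.rpow_sub hR (θ - 2) l]
          ring
        rw [hT, h1, Real.mul_rpow (by positivity) (Real.rpow_nonneg hR.le _), ← Real.rpow_mul hR.le,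
          hE, Real.rpow_add hR, Real.rpow_add hR, Real.rpow_natCast, hΛ]
        ring
      rw [hA₃]
      linarith
    have hcut : ∀ R : ℝ, 0 < R → ∀ x ∈ Metric.closedBall (0 : Euc N) R,
        F x * (ballCutoff R x ^ (n + 1)) ^ 2 = F x := fun R hR x hx => by
      rw [ballCutoff_eq_one hR (mem_closedBall_zero_iff.1 hx)]
      simp
    have hio : ∀ R : ℝ, 0 < R → IntegrableOn F (Metric.closedBall 0 R) := fun R hR =>
      (step R hR).1.integrableOn.congr_fun (hcut R hR) measurableSet_closedBall
    refine fun R hR => ⟨hio R hR, fun R' hR' => ?_⟩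
    have hR'0 : 0 < R' := hR.trans_le hR'
    calc ∫ x in Metric.closedBall 0 R, F x ≤ ∫ x in Metric.closedBall 0 R', F x :=
          setIntegral_mono_set (hio R' hR'0) (Eventually.of_forall hF0)
            (Metric.closedBall_subset_closedBall hR').eventuallyLE
      _ = ∫ x in Metric.closedBall 0 R', F x * (ballCutoff R' x ^ (n + 1)) ^ 2 :=
          (setIntegral_congr_fun measurableSet_closedBall (hcut R' hR'0)).symm
      _ ≤ ∫ x, F x * (ballCutoff R' x ^ (n + 1)) ^ 2 :=
          setIntegral_le_integral (step R' hR'0).1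
            (Eventually.of_forall fun x => mul_nonneg (hF0 x) (sq_nonneg _))
      _ ≤ A₃ * R' ^ E := (step R' hR'0).2
  have hzero : ∀ k : ℕ, ∀ᵐ x, x ∈ Metric.closedBall (0 : Euc N) ((k : ℝ) + 1) → F x = 0 := by
    intro k
    have hk : (0 : ℝ) < (k : ℝ) + 1 := by positivity
    obtain ⟨hi, hb⟩ := main _ hk
    have hlim : Tendsto (fun R' : ℝ => A₃ * R' ^ E) atTop (𝓝 0) := by
      have := (tendsto_rpow_neg_atTop (neg_pos.2 hE0)).const_mul A₃
      simpa using this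
    have hle : ∫ x in Metric.closedBall (0 : Euc N) ((k : ℝ) + 1), F x ≤ 0 :=
      ge_of_tendsto hlim (by
        filter_upwards [eventually_ge_atTop ((k : ℝ) + 1)] with R' hR' using hb R' hR')
    have heq := le_antisymm hle (integral_nonneg hF0)
    have h1 := (integral_eq_zero_iff_of_nonneg hF0 hi).1 heq
    rw [EventuallyEq, ae_restrict_iff' measurableSet_closedBall] at h1
    exact h1
  filter_upwards [ae_all_iff.2 hzero, ae_ne_zero hN] with x hx hx0
  obtain ⟨k, hk⟩ := exists_nat_ge ‖x‖
  have h1 := hx k (mem_closedBall_zero_iff.2 (by linarith))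
  by_contra hne
  have hvx : 0 < |v x| := abs_pos.2 hne
  have hxp : 0 < ‖x‖ := norm_pos_iff.2 hx0
  have : 0 < F x := by positivity
  linarith

/-! ### Algebra of the critical exponent -/

section CriticalExponent

/-- `P_+` in terms of `m = (N' - 2) / (2 + τ)` and `s = √(2 * m + 1)`. -/
lemma PPlus_eq {N' τ m s : ℝ} (hτ : 0 < 2 + τ) (hm : m * (2 + τ) = N' - 2) (hs : 3 < s)
    (hsm : s ^ 2 = 2 * m + 1) : PPlus N' τ = (s - 1) ^ 2 / ((s - 1) ^ 2 - 4) := by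
  have hN' : N' = m * (2 + τ) + 2 := by linarith
  have hsqrt : Real.sqrt ((2 + τ) * (2 * N' + τ - 2)) = (2 + τ) * s := by
    have : (2 + τ) * (2 * N' + τ - 2) = ((2 + τ) * s) ^ 2 := by
      rw [mul_pow, hsm, hN']
      ring
    rw [this, Real.sqrt_sq (by positivity)]
  have hm' : m = (s ^ 2 - 1) / 2 := by linarith
  have h1 : 0 < s - 3 := by linarith
  have h2 : 0 < s - 1 := by linarith
  have h3 : 0 < s + 1 := by linarith
  have h4 : 0 < s + 3 := by linarith
  rw [PPlus, hsqrt]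
  have e1 : (N' - 2) ^ 2 - 2 * (2 + τ) * (N' + τ) + 2 * (2 + τ) * ((2 + τ) * s)
      = (2 + τ) ^ 2 * ((s - 1) ^ 3 * (s + 3) / 4) := by
    rw [hN', hm']
    ring
  have e2 : (N' - 2) * (N' - 4 * τ - 10) = (2 + τ) ^ 2 * ((s - 1) * (s + 1) * (s - 3) * (s + 3) / 4)
      := by
    rw [hN', hm']
    ring
  have e3 : (s - 1) ^ 2 - 4 = (s + 1) * (s - 3) := by ring
  rw [e1, e2, e3]
  field_simp

lemma lt_PPlus_iff {N' τ m s p : ℝ} (hτ : 0 < 2 + τ) (hm : m * (2 + τ) = N' - 2) (hs : 3 < s)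
    (hsm : s ^ 2 = 2 * m + 1) : p < PPlus N' τ ↔ (p - 1) * (s - 1) ^ 2 < 4 * p := by
  have h4 : 0 < (s - 1) ^ 2 - 4 := by nlinarith
  rw [PPlus_eq hτ hm hs hsm, lt_div_iff₀ h4]
  constructor <;> intro h <;> linarith

/-- Below the critical exponent there is an admissible exponent for the integral estimate. -/
lemma exists_admissible_exponent {p m : ℝ} (hp : 1 < p)
    (h : m * (p - 1) < 2 * p + 2 * Real.sqrt (p * (p - 1))) :
    ∃ s, 0 ≤ s ∧ (s + 1) ^ 2 < p * (2 * s + 1) ∧ m * (p - 1) < 2 * s + 2 := by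
  set d := Real.sqrt (p * (p - 1)) with hd
  have hd2 : d ^ 2 = p * (p - 1) := Real.sq_sqrt (by nlinarith)
  have hd0 : 0 < d := Real.sqrt_pos.2 (by nlinarith)
  have hdp : p - 1 < d := by nlinarith
  -- Here e stands for 2s + 2, and e > 2 makes s positive. Admissibility reads (e-2p)² < 4p(p-1);
  -- the lower bound in it holds because 2p - 2d < 2.
  obtain ⟨e, he1, he2⟩ := exists_between (max_lt h (show 2 < 2 * p + 2 * d by linarith))
  have he3 := (le_max_left _ _).trans_lt he1
  have he4 := (le_max_right _ _).trans_lt he1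
  refine ⟨e / 2 - 1, by linarith, ?_, by linarith⟩
  have h1 : (e - 2 * p) ^ 2 < (2 * d) ^ 2 := by
    refine sq_lt_sq' ?_ ?_ <;> linarith
  nlinarith

/-- With a = (p-1)(s-1) and d = √(p(p-1)), clearing factors turns the two sides into a² < (2d)² and
a² + 2(p-1)a < (2d)² + 2(p-1)(2d). Both mean a < 2d. -/
lemma mul_sq_lt_iff {p m s : ℝ} (hp : 1 < p) (hs : 1 < s) (hsm : s ^ 2 = 2 * m + 1) :
    (p - 1) * (s - 1) ^ 2 < 4 * p ↔ m * (p - 1) < 2 * p + 2 * Real.sqrt (p * (p - 1)) := by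
  set d := Real.sqrt (p * (p - 1)) with hd
  have hd2 : d ^ 2 = p * (p - 1) := Real.sq_sqrt (by nlinarith)
  have hd0 : 0 < d := Real.sqrt_pos.2 (by nlinarith)
  have hp1 : 0 < p - 1 := by linarith
  have hm : m = (s ^ 2 - 1) / 2 := by linarith
  set a := (p - 1) * (s - 1) with ha
  have ha0 : 0 < a := mul_pos hp1 (by linarith)
  have e1 : (p - 1) * ((p - 1) * (s - 1) ^ 2) = a ^ 2 := by rw [ha]; ring
  have e2 : (p - 1) * (2 * (m * (p - 1))) = a ^ 2 + 2 * (p - 1) * a := by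
    rw [ha, hm]
    ring
  have k1 : (p - 1) * (s - 1) ^ 2 < 4 * p ↔ a < 2 * d := by
    rw [← mul_lt_mul_iff_right₀ hp1, e1]
    constructor <;> intro h
    · nlinarith
    · nlinarith
  have k2 : m * (p - 1) < 2 * p + 2 * d ↔ a < 2 * d := by
    have e3 : (p - 1) * (2 * (2 * p + 2 * d)) = (2 * d) ^ 2 + 2 * (p - 1) * (2 * d) := by
      linear_combination -4 * hd2
    have h0 : m * (p - 1) < 2 * p + 2 * d ↔
        (p - 1) * (2 * (m * (p - 1))) < (p - 1) * (2 * (2 * p + 2 * d)) := by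
      rw [mul_lt_mul_iff_right₀ hp1, mul_lt_mul_iff_right₀ two_pos]
    rw [h0, e2, e3]
    constructor <;> intro h
    · by_contra hc
      nlinarith [not_lt.1 hc]
    · nlinarith
  rw [k1, k2]

/-- Multiplied by (p-1)², the discriminant (m-2k)² - 4(m-k) becomes (m(p-1)-2p)² - 4p(p-1), so the
threshold for m is that of real roots in the Emden–Fowler equation. -/
lemma supercritical_conditions {p m k : ℝ} (hp : 1 < p) (hk : k * (p - 1) = 1)
    (h : 2 * p + 2 * Real.sqrt (p * (p - 1)) ≤ m * (p - 1)) :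
    2 * k < m ∧ 4 * (m - k) ≤ (m - 2 * k) ^ 2 := by
  set d := Real.sqrt (p * (p - 1)) with hd
  have hd2 : d ^ 2 = p * (p - 1) := Real.sq_sqrt (by nlinarith)
  have hd0 : 0 < d := Real.sqrt_pos.2 (by nlinarith)
  have hp1 : 0 < p - 1 := by linarith
  constructor
  · have : 2 * k * (p - 1) < m * (p - 1) := by nlinarith
    exact lt_of_mul_lt_mul_right this hp1.le
  · have h1 : (2 * d) ^ 2 ≤ (m * (p - 1) - 2 * p) ^ 2 := by
      have : 2 * d ≤ m * (p - 1) - 2 * p := by linarith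
      gcongr
    have h2 : (p - 1) ^ 2 * ((m - 2 * k) ^ 2 - 4 * (m - k))
        = (m * (p - 1) - 2 * p) ^ 2 - (2 * d) ^ 2 := by
      have e1 : (p - 1) ^ 2 * ((m - 2 * k) ^ 2 - 4 * (m - k))
        = (m * (p - 1) - 2 * (k * (p - 1))) ^ 2
          - 4 * (p - 1) * (m * (p - 1) - k * (p - 1)) := by ring
      rw [e1, hk]
      linear_combination 4 * hd2
    have h3 : 0 ≤ (p - 1) ^ 2 * ((m - 2 * k) ^ 2 - 4 * (m - k)) := by linarith
    have h4 := nonneg_of_mul_nonneg_right h3 (by positivity)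
    linarith

end CriticalExponent

end WeightedElliptic

end

/-! ### The main theorem -/

theorem mainTheorem3 (N : ℕ) (hN : 2 ≤ N) (θ l p N' τ : ℝ)
    (hN' : N' = N + θ) (hτ : τ = l - θ) (hN'2 : 2 < N') (hτ2 : -2 < τ) (hp : 1 < p) :
    (((2 < N' ∧ N' ≤ 10 + 4 * τ) ∨
        (10 + 4 * τ < N' ∧ (p : EReal) < WeightedElliptic.pc N' τ)) →
      ∀ v : EuclideanSpace ℝ (Fin N) → ℝ,
        WeightedElliptic.IsStableSolution univ θ l p v → v =ᵐ[volume] 0) ∧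
    (WeightedElliptic.pc N' τ ≤ (p : EReal) →
      ∀ κ : ℝ, 0 < κ → ∃ v : EuclideanSpace ℝ (Fin N) → ℝ,
        WeightedElliptic.IsStableSolution univ θ l p v ∧
        Continuous v ∧ v 0 = κ ∧ (∀ x, 0 < v x) ∧
        (∀ x y, ‖x‖ = ‖y‖ → v x = v y)) := by
  have hσ : 0 < 2 + τ := by linarith
  have hσ' : 2 + l - θ = 2 + τ := by linarith
  have hN1 : 1 ≤ N := by omega
  have hp1 : 0 < p - 1 := by linarith
  obtain ⟨m, hm⟩ : ∃ m, m * (2 + τ) = N' - 2 := ⟨(N' - 2) / (2 + τ), by field_simp⟩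
  have hm0 : 0 < m := by
    by_contra h
    nlinarith [not_lt.1 h]
  set d := Real.sqrt (p * (p - 1)) with hd
  have hd2 : d ^ 2 = p * (p - 1) := Real.sq_sqrt (by nlinarith)
  have hd0 : 0 < d := Real.sqrt_pos.2 (by nlinarith)
  set s := Real.sqrt (2 * m + 1) with hs
  have hsm : s ^ 2 = 2 * m + 1 := Real.sq_sqrt (by linarith)
  have hs0 : 0 ≤ s := Real.sqrt_nonneg _
  -- N' - 2 > 4(2+τ) means m > 4, hence 2m + 1 > 9.
  have hs3 : 10 + 4 * τ < N' → 3 < s := fun h => by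
    have h4 : 4 < m := by
      by_contra hc
      nlinarith [not_lt.1 hc]
    nlinarith
  constructor
  · intro h v hv
    have hlt : m * (p - 1) < 2 * p + 2 * d := by
      rcases h with ⟨-, h⟩ | ⟨h, hpc⟩
      -- For m ≤ 4 every p > 1 is subcritical: d > p - 1 gives 2p + 2d > 4p - 2 > m(p-1).
      · have h4 : m ≤ 4 := by
          by_contra hc
          nlinarith [not_le.1 hc]
        have hdp : p - 1 < d := by nlinarith
        nlinarith
      · rw [WeightedElliptic.pc, if_neg (not_le.2 h), EReal.coe_lt_coe_iff,
          WeightedElliptic.lt_PPlus_iff hσ hm (hs3 h) hsm] at hpc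
        exact (WeightedElliptic.mul_sq_lt_iff hp (by linarith [hs3 h]) hsm).1 hpc
    obtain ⟨e, he0, he1, he2⟩ := WeightedElliptic.exists_admissible_exponent hp hlt
    refine WeightedElliptic.IsStableSolution.ae_eq_zero hN1 (by linarith) hp he0 he1 ?_ hv
    rw [hσ', ← hN', ← hm]
    nlinarith
  · intro hpc κ hκ
    have h10 : 10 + 4 * τ < N' := by
      by_contra hc
      rw [WeightedElliptic.pc, if_pos (not_lt.1 hc), top_le_iff] at hpc
      exact EReal.coe_ne_top p hpc
    rw [WeightedElliptic.pc, if_neg (not_le.2 h10), EReal.coe_le_coe_iff] at hpc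
    have hge : 2 * p + 2 * d ≤ m * (p - 1) := by
      by_contra hc
      exact absurd ((WeightedElliptic.lt_PPlus_iff hσ hm (hs3 h10) hsm).2
        ((WeightedElliptic.mul_sq_lt_iff hp (by linarith [hs3 h10]) hsm).2 (not_le.1 hc)))
        (not_lt.2 hpc)
    have hk : 1 / (p - 1) * (p - 1) = 1 := by field_simp
    obtain ⟨hmk, hcond⟩ := WeightedElliptic.supercritical_conditions hp hk hge
    exact WeightedElliptic.exists_stable_radial_solution hN1 (by linarith) (by linarith) hp hκ
      (by rw [hσ', hm, hN']) hk hmk hcond
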